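/- **Modulated quivers.** Paths are written as products from right to left: $\alpha\beta$ is first $\beta$, then $\alpha$, with $s(\alpha)=t(\beta)$. A modulated quiver $(Q,\mathcal M)$ over $\mathbb R$ is a finite quiver $Q=(Q_0,Q_1,s,t)$ with a division algebra $\mathcal M(i)\in\{\mathbb R,\mathbb C,\mathbb H\}$ for each vertex $i$ and a simple $\mathcal M(t(\alpha))$-$\mathcal M(s(\alpha))$-bimodule $\mathcal M(\alpha)$ for each arrow $\alpha$. Here $\mathbb H=\left\{\begin{bmatrix}a&b\\-\bar b&\bar a\end{bmatrix}\right\}\subset M_2(\mathbb C)$ has the basis $1$, $\mathbf j=\mathrm{diag}(\mathbf i,-\mathbf i)$, $\mathbf k=\begin{bmatrix}0&1\\-1&0\end{bmatrix}$, $\mathbf l=\mathbf j\mathbf k$, and the simple bimodules are $\mathbb R$ ($\mathbb R$-$\mathbb R$), $\mathbb H$ ($\mathbb H$-$\mathbb H$, $\mathbb H$-$\mathbb R$, $\mathbb R$-$\mathbb H$), $\mathbb C$ ($\mathbb C$-$\mathbb R$, $\mathbb R$-$\mathbb C$), the rows $[\mathbb C\ \mathbb C]$ ($\mathbb C$-$\mathbb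 H$), the columns $\begin{bmatrix}\mathbb C\\\mathbb C\end{bmatrix}$ ($\mathbb H$-$\mathbb C$), and, for $\mathbb C$-$\mathbb C$, $\mathbb C$ and its conjugate $\overline{\mathbb C}$ (one action twisted by conjugation). $T(Q,\mathcal M)$ is the tensor algebra of the $\prod_i\mathcal M(i)$-bimodule $\bigoplus_\alpha\mathcal M(\alpha)$, and $\mathcal M(\alpha\beta)=\mathcal M(\alpha)\otimes_{\mathcal M(s(\alpha))}\mathcal M(\beta)\subseteq T(Q,\mathcal M)$. Write $x_\alpha$ for $x\in\mathcal M(\alpha)$. Put $v^+=\{\alpha: s(\alpha)=v\}$, $v^-=\{\alpha: t(\alpha)=v\}$ and, for a two-sided ideal $I$ of $T(Q,\mathcal M)$, $I_v=I\cap\bigoplus_{\alpha\in v^+,\beta\in v^-}\mathcal M(\alpha\beta)$. Of two parallel arrows whose ends have the same division algebra $\mathbb R$ or $\mathbb H$, one is denoted $\gamma$ and the other $\gamma^{\mathbf i}$; fix such a choice once and for all and let $Q_1^{\mathbf i}$ be the set of all $\gamma^{\mathbf i}$. **Ordinarily gentle with $\mathbb C$.** $v$ is ordinarily gentle with $\mathbb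 C$ if $\mathcal M(v)=\mathbb C$; $|v^+|,|v^-|\le2$; for $\alpha\in v^+$ and $\beta\ne\gamma$ in $v^-$, exactly one of $\mathcal M(\alpha\beta),\mathcal M(\alpha\gamma)$ lies in $I$; for $\alpha\in v^-$ and $\beta\neq\gamma$ in $v^+$, exactly one of $\mathcal M(\beta\alpha),\mathcal M(\gamma\alpha)$ lies in $I$; $I\cap\mathcal M(\alpha\beta)$ is $\mathcal M(\alpha\beta)$ or $0$ if $\alpha\in v^+$, $\beta\in v^-$, $\mathcal M(t(\alpha))\ne\mathbb C\neq\mathcal M(s(\beta))$; and $I_v$ is the sum of those $\mathcal M(\alpha\beta)$, $\alpha\in v^+$, $\beta\in v^-$, which are contained in $I$. **Specially gentle.** Let $\mathcal M(v)\ne\mathbb C$. Say that $v^-$ has admissible form if all arrows of $v^-$ start at one vertex $u$ and $v^-=\{\beta,\beta^{\mathbf i}\}$ if $\mathcal M(u)=\mathcal M(v)$, while $v^-=\{\beta\}$ if $\mathcal M(u)\ne\mathcal M(v)$; likewise for $v^+$ (arrows $\alpha$, and $\alpha^{\mathbf i}$ if $\mathcal M(w)=\mathcal M(v)$, all ending at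 one vertex $w$). The vertices $u,v,w$ need not be different. If both have admissible form, let $I_v^0$ and $I_v^1$ be the $\mathcal M(w)$-$\mathcal M(u)$-subbimodules of $\bigoplus_{\alpha\in v^+,\beta\in v^-}\mathcal M(\alpha\beta)$ generated, respectively, by the following elements, according to $\mathcal M(u),\mathcal M(v),\mathcal M(w)$ (generators of $I_v^0$; generators of $I_v^1$): - $\mathbb{RRR}$: $1_\alpha\otimes1_\beta-1_{\alpha^{\mathbf i}}\otimes1_{\beta^{\mathbf i}}$ and $-1_\alpha\otimes1_{\beta^{\mathbf i}}-1_{\alpha^{\mathbf i}}\otimes1_\beta$; $1_\alpha\otimes1_\beta+1_{\alpha^{\mathbf i}}\otimes1_{\beta^{\mathbf i}}$ and $1_\alpha\otimes1_{\beta^{\mathbf i}}-1_{\alpha^{\mathbf i}}\otimes1_\beta$. - $\mathbb{RRH}$: $1_\alpha\otimes1_\beta+\mathbf j_\alpha\otimes1_{\beta^{\mathbf i}}$; $1_\alpha\otimes1_\beta-\mathbf j_\alpha\otimes1_{\beta^{\mathbf i}}$. - $\mathbb{RRC}$: $1_\alpha\otimes1_\beta+\mathbf i_\alpha\otimes1_{\beta^{\mathbf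 i}}$; $1_\alpha\otimes1_\beta-\mathbf i_\alpha\otimes1_{\beta^{\mathbf i}}$. - $\mathbb{HHR}$: $1_\alpha\otimes1_\beta+1_\alpha\otimes\mathbf j_{\beta^{\mathbf i}}$; $1_\alpha\otimes\mathbf k_\beta-1_\alpha\otimes\mathbf l_{\beta^{\mathbf i}}$. - $\mathbb{HHH}$: $1_\alpha\otimes1_\beta-1_{\alpha^{\mathbf i}}\otimes1_{\beta^{\mathbf i}}+1_\alpha\otimes\mathbf j_{\beta^{\mathbf i}}+1_{\alpha^{\mathbf i}}\otimes\mathbf j_\beta$; $1_\alpha\otimes\mathbf k_\beta+1_{\alpha^{\mathbf i}}\otimes\mathbf k_{\beta^{\mathbf i}}-1_\alpha\otimes\mathbf l_{\beta^{\mathbf i}}+1_{\alpha^{\mathbf i}}\otimes\mathbf l_\beta$. - $\mathbb{HHC}$: $[1\ 0]_\alpha\otimes1_\beta+[1\ 0]_\alpha\otimes\mathbf j_{\beta^{\mathbf i}}$; $[1\ 0]_\alpha\otimes\mathbf k_\beta-[1\ 0]_\alpha\otimes\mathbf l_{\beta^{\mathbf i}}$. - $\mathbb{HRR}$: $1_\alpha\otimes1_\beta+1_{\alpha^{\mathbf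 i}}\otimes\mathbf j_\beta$; $1_\alpha\otimes1_\beta-1_{\alpha^{\mathbf i}}\otimes\mathbf j_\beta$. - $\mathbb{CRR}$: $1_\alpha\otimes1_\beta+1_{\alpha^{\mathbf i}}\otimes\mathbf i_\beta$; $1_\alpha\otimes1_\beta-1_{\alpha^{\mathbf i}}\otimes\mathbf i_\beta$. - $\mathbb{RHH}$: $1_\alpha\otimes1_\beta+1_{\alpha^{\mathbf i}}\otimes\mathbf j_\beta$; $1_\alpha\otimes\mathbf k_\beta+1_{\alpha^{\mathbf i}}\otimes\mathbf l_\beta$. - $\mathbb{CHH}$, with $e=\begin{bmatrix}1\\0\end{bmatrix}$: $1_\alpha\otimes e_\beta+\mathbf j_{\alpha^{\mathbf i}}\otimes e_\beta$; $\mathbf k_\alpha\otimes e_\beta+\mathbf l_{\alpha^{\mathbf i}}\otimes e_\beta$. - $\mathbb{HRH}$: $1_\alpha\otimes1_\beta-\mathbf j_\alpha\otimes\mathbf j_\beta$; $1_\alpha\otimes1_\beta+\mathbf j_\alpha\otimes\mathbf j_\beta$. The cases $\mathbb{HRC}$, $\mathbb{CRH}$, $\mathbb{CRC}$ are the same with $\mathbf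 j_\alpha$, $\mathbf j_\beta$, or both, replaced by $\mathbf i_\alpha$, $\mathbf i_\beta$. - $\mathbb{RHC}$: $[1\ 0]_\alpha\otimes1_\beta$; $[1\ 0]_\alpha\otimes\mathbf k_\beta$. - $\mathbb{CHR}$: $1_\alpha\otimes e_\beta$; $-\mathbf k_\alpha\otimes e_\beta$. - $\mathbb{CHC}$: $[1\ 0]_\alpha\otimes e_\beta$; $[1\ 0]_\alpha\otimes\begin{bmatrix}0\\1\end{bmatrix}_\beta$. - $\mathbb{RHR}$: $1_\alpha\otimes1_\beta$ and $1_\alpha\otimes\mathbf j_\beta$; $1_\alpha\otimes\mathbf k_\beta$ and $1_\alpha\otimes\mathbf l_\beta$. $v$ is specially gentle if either $v^+$ and $v^-$ both have admissible form and exactly one of $I_v=I_v^0$, $I_v=I_v^1$ holds, or one of $v^+,v^-$ is empty and the other is empty or has admissible form. **Special type.** $T(Q,\mathcal M)/I$ is locally complexified-gentle of special type if every vertex is ordinarily gentle with $\mathbb C$ or specially gentle, and $I$ is generated by all $I_v$, $v\in Q_0$. **Semilinear clannish algebras.** For a finite quiver $Q$ and twists $\sigma_\alpha\in\{\mathrm{Id},\overline{(?)}\}=\mathrm{Gal}(\mathbb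 C/\mathbb R)$, $\mathbb C_\sigma Q$ is the $\mathbb R$-algebra generated by $\mathbb C$, idempotents $e_i$ and the arrows, with $e_ie_j=\delta_{ij}e_i$, $\sum_ie_i=1$, $e_{t(\alpha)}\alpha=\alpha=\alpha e_{s(\alpha)}$, $e_ic=ce_i$, $\alpha c=\sigma_\alpha(c)\alpha$ for $c\in\mathbb C$. Let $\mathbb S$ be a set of (special) loops, at most one at each vertex, each with twist $\overline{(?)}$ and associated with $x^2-1$ or $x^2+1$; $S$ is the set of all $s^2-e_i$, respectively $s^2+e_i$, for $s\in\mathbb S$ at $i$. Let $Z$ be a set of paths of length at least two, not starting or ending with a special loop and not containing $ss$ for $s\in\mathbb S$. $\mathbb C_\sigma Q/\langle S\cup Z\rangle$ is $\mathbb C$-semilinear clannish of gentle type if (G1) $|v^+|,|v^-|\le 2$ for all $v$ (special loops included); (G2) for every $\alpha\in Q_1\setminus\mathbb S$ there is at most one arrow $\beta$ with $\alpha\beta$ a path not in $Z$, at most one $\gamma$ with $\gamma\alpha$ a path not in $Z$, at most one $\beta$ with $\alpha\beta$ a path in $Z$, and at most one $\gamma$ with $\gamma\alpha$ a path in $Z$;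 (G3) all paths in $Z$ have length two. **Construction.** Let $T(Q,\mathcal M)/I$ be locally complexified-gentle of special type. $Q^{\mathrm s}$ has vertices $Q_0$ and arrows $(Q_1\setminus Q_1^{\mathbf i})\sqcup\{s_i:i\to i\mid\mathcal M(i)\ne\mathbb C\}$; the $s_i$ are the special loops, with $S=\{s_i^2-e_i\mid\mathcal M(i)=\mathbb R\}\cup\{s_i^2+e_i\mid\mathcal M(i)=\mathbb H\}$. Let $Z_{\mathbb C}$ be the set of paths $\alpha\beta$ in $Q$ with $v=s(\alpha)$, $\mathcal M(v)=\mathbb C$, $\mathcal M(\alpha\beta)\subseteq I_v$, and $$Z=\{\alpha\beta\mid\alpha,\beta\in Q_1\setminus Q_1^{\mathbf i},\ s(\alpha)=t(\beta),\ \mathcal M(s(\alpha))\neq\mathbb C\}\cup Z_{\mathbb C},$$ $$Z'=\{\alpha s_v^p\beta\mid\alpha,\beta\in Q_1\setminus Q_1^{\mathbf i},\ s(\alpha)=t(\beta)=v,\ \mathcal M(v)\neq\mathbb C,\ p\in\{0,1\},\ I_v=I_v^p\}\cup Z_{\mathbb C}.$$ The twists $\sigma,\sigma'$ are $\overline{(?)}$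 on all $s_i$; on an arrow between two vertices with $\mathbb C$ both are $\mathrm{Id}$ if it carries $\mathbb C$, and $\overline{(?)}$ if it carries $\overline{\mathbb C}$. On every other ordinary arrow $\sigma'$ is $\mathrm{Id}$. A special path is a path $\alpha_1\cdots\alpha_n$ ($n\geq 1$) of pairwise different ordinary arrows of $Q^{\mathrm s}$ with $\mathcal M(s(\alpha_i))\ne\mathbb C$ for $i<n$; it is maximal if it is not properly contained in another one, and is called an oriented cycle if $s(\alpha_n)=t(\alpha_1)$ and $\mathcal M(s(\alpha_n))\neq\mathbb C$. Every ordinary arrow $\alpha$ not between two vertices with $\mathbb C$ lies in exactly one maximal special path (up to rotation of oriented cycles); $\sigma_\alpha=\mathrm{Id}$ if this path is not an oriented cycle and $\alpha$ is its last factor $\alpha_n$, and otherwise $\sigma_\alpha=\overline{(?)}^{\,p}$, where $p\in\{0,1\}$ is such that $I^p_{s(\alpha)}\subseteq I$. **Proposition.** If $T(Q,\mathcal M)/I$ is locally complexified-gentle of special type, then 1. the $\mathbb R$-algebra $T(Q,\mathcal M)/I$ is Morita equivalent to $\mathbb C_{\sigma'}Q^{\mathrm s}/\langle S\cup Z'\rangle$;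 2. $\mathbb C_{\sigma'}Q^{\mathrm s}/\langle S\cup Z'\rangle$ and $\mathbb C_{\sigma}Q^{\mathrm s}/\langle S\cup Z\rangle$ are isomorphic as $\mathbb R$-algebras, by an isomorphism which is the identity on the scalars $\mathbb C$; 3. $\mathbb C_{\sigma}Q^{\mathrm s}/\langle S\cup Z\rangle$ is a $\mathbb C$-semilinear clannish algebra of gentle type. -/

import Mathlib

open scoped Quaternion

universe u w

/-! ## Tensor algebras of bimodules over a not necessarily commutative base ring -/

/-- The relations which turn the free `k`-algebra on the module `A × M` into the tensor algebra of
the `A`-bimodule `M`: the product and the unit of `A`, and the left and right actions of `A` on `M`,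
become the product and the unit of the algebra. -/
inductive TensorRing.Rel (k : Type*) (A : Type*) (M : Type*) [CommRing k] [Ring A] [Algebra k A]
    [AddCommGroup M] [Module k M] [Module A M] [Module Aᵐᵒᵖ M] :
    TensorAlgebra k (A × M) → TensorAlgebra k (A × M) → Prop
  | one : Rel k A M (TensorAlgebra.ι k ((1 : A), (0 : M))) 1
  | mul (a b : A) :
      Rel k A M (TensorAlgebra.ι k (a, (0 : M)) * TensorAlgebra.ι k (b, (0 : M)))
        (TensorAlgebra.ι k (a * b, (0 : M)))
  | left (a : A) (m : M) :
      Rel k A M (TensorAlgebra.ι k (a, (0 : M)) * TensorAlgebra.ι k ((0 : A), m))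
        (TensorAlgebra.ι k ((0 : A), a • m))
  | right (m : M) (a : A) :
      Rel k A M (TensorAlgebra.ι k ((0 : A), m) * TensorAlgebra.ι k (a, (0 : M)))
        (TensorAlgebra.ι k ((0 : A), MulOpposite.op a • m))

/-- The tensor algebra `T_A(M) = A ⊕ M ⊕ (M ⊗_A M) ⊕ ⋯` of the `A`-bimodule `M`, given by its
presentation as the `k`-algebra freely generated by the `k`-algebra `A` and the bimodule `M`. -/
abbrev TensorRing (k : Type*) (A : Type*) (M : Type*) [CommRing k] [Ring A] [Algebra k A]
    [AddCommGroup M] [Module k M] [Module A M] [Module Aᵐᵒᵖ M] :=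
  RingQuot (TensorRing.Rel k A M)

namespace TensorRing

variable (k : Type*) (A : Type*) (M : Type*) [CommRing k] [Ring A] [Algebra k A]
  [AddCommGroup M] [Module k M] [Module A M] [Module Aᵐᵒᵖ M]

/-- The canonical map `A → T_A(M)`. -/
noncomputable def ofBase : A →ₗ[k] TensorRing k A M :=
  (RingQuot.mkAlgHom k (TensorRing.Rel k A M)).toLinearMap ∘ₗ TensorAlgebra.ι k ∘ₗ
    LinearMap.inl k A M

/-- The canonical map `M → T_A(M)`. -/
noncomputable def ofModule : M →ₗ[k] TensorRing k A M :=
  (RingQuot.mkAlgHom k (TensorRing.Rel k A M)).toLinearMap ∘ₗ TensorAlgebra.ι k ∘ₗ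
    LinearMap.inr k A M

end TensorRing

/-! ## The division algebras `ℝ`, `ℂ`, `ℍ` and their simple bimodules -/

/-- The three finite-dimensional division algebras over `ℝ`. -/
inductive DivKind
  | real
  | cplx
  | quat

/-- The division algebra named by `D`. -/
def DivRing : DivKind → Type
  | .real => ℝ
  | .cplx => ℂ
  | .quat => ℍ[ℝ]

noncomputable instance : (D : DivKind) → Ring (DivRing D)
  | .real => inferInstanceAs (Ring ℝ)
  | .cplx => inferInstanceAs (Ring ℂ)
  | .quat => inferInstanceAs (Ring ℍ[ℝ])

noncomputable instance : (D : DivKind) → Algebra ℝ (DivRing D)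
  | .real => inferInstanceAs (Algebra ℝ ℝ)
  | .cplx => inferInstanceAs (Algebra ℝ ℂ)
  | .quat => inferInstanceAs (Algebra ℝ ℍ[ℝ])

/-- The standard embeddings of `ℝ`, `ℂ` and `ℍ` into `ℍ`. -/
noncomputable def toQuat : (D : DivKind) → DivRing D →ₐ[ℝ] ℍ[ℝ]
  | .real => Algebra.ofId ℝ ℍ[ℝ]
  | .cplx => Quaternion.ofComplex
  | .quat => AlgHom.id ℝ ℍ[ℝ]

/-- The first quaternion unit; it is the image of the imaginary unit of `ℂ`. -/
def qj : ℍ[ℝ] := ⟨0, 1, 0, 0⟩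
/-- The second quaternion unit. -/
def qk : ℍ[ℝ] := ⟨0, 0, 1, 0⟩
/-- The third quaternion unit, `ql = qj * qk`. -/
def ql : ℍ[ℝ] := ⟨0, 0, 0, 1⟩

/-- The simple `D`-`D'`-bimodules, realised inside `ℍ` with both actions given by the
multiplication of `ℍ`:
* `ℝ` for `ℝ`-`ℝ`, and `ℍ` for `ℍ`-`ℍ`, `ℍ`-`ℝ`, `ℝ`-`ℍ`;
* `ℂ = ℝ + ℝ j` for `ℂ`-`ℝ`, `ℝ`-`ℂ` and, if `bar` is false, for `ℂ`-`ℂ`;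
* for `ℂ`-`ℂ`, if `bar` is true, the bimodule `ℂ k = k ℂ = ℝ k + ℝ l`, on which
  `c • k = k • conj c`; this is the bimodule `ℂ` with one action twisted by conjugation;
* `ℍ` for `ℂ`-`ℍ`; this is the bimodule of rows `[a b]`, `a, b ∈ ℂ`, on which `ℍ ⊆ M₂(ℂ)` acts
  by matrix multiplication, via `[a b] ↦ a + b k` (the matrix in `ℍ` with first row `[a b]`);
* `ℍ` for `ℍ`-`ℂ`; this is the bimodule of columns `[a; b]`, `a, b ∈ ℂ`, via
  `[a; b] ↦ a - (conj b) k` (the matrix in `ℍ` with first column `[a; b]`).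
The flag `bar` has a meaning for `ℂ`-`ℂ`-bimodules only. -/
def simpleBimodule (D D' : DivKind) (bar : Prop) : Submodule ℝ ℍ[ℝ] where
  carrier := {q | match D, D' with
    | .real, .real => q.imI = 0 ∧ q.imJ = 0 ∧ q.imK = 0
    | .real, .cplx => q.imJ = 0 ∧ q.imK = 0
    | .cplx, .real => q.imJ = 0 ∧ q.imK = 0
    | .cplx, .cplx => (¬ bar → q.imJ = 0 ∧ q.imK = 0) ∧ (bar → q.re = 0 ∧ q.imI = 0)
    | .quat, _ => True
    | _, .quat => True}
  zero_mem' := by cases D <;> cases D' <;> simp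
  add_mem' := by
    intro a b ha hb
    cases D <;> cases D' <;> simp_all
  smul_mem' := by
    intro r a ha
    cases D <;> cases D' <;> simp_all

theorem toQuat_real (a : DivRing .real) :
    (toQuat .real a).imI = 0 ∧ (toQuat .real a).imJ = 0 ∧ (toQuat .real a).imK = 0 :=
  ⟨rfl, rfl, rfl⟩

theorem toQuat_cplx (a : DivRing .cplx) :
    (toQuat .cplx a).imJ = 0 ∧ (toQuat .cplx a).imK = 0 :=
  ⟨rfl, rfl⟩

theorem simpleBimodule_left {D D' : DivKind} {bar : Prop} (a : DivRing D) {q : ℍ[ℝ]}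
    (hq : q ∈ simpleBimodule D D' bar) : toQuat D a * q ∈ simpleBimodule D D' bar := by
  have hC := toQuat_cplx
  have hR := toQuat_real
  cases D <;> cases D' <;> simp only [simpleBimodule, Submodule.mem_mk, AddSubmonoid.mem_mk,
    AddSubsemigroup.mem_mk, Set.mem_ofPred_eq] at hq ⊢
  · simp [hq, hR a]
  · simp [hq, hR a]
  · simp [hq, hC a]
  · exact ⟨fun h => by simp [hq.1 h, hC a], fun h => by simp [hq.2 h, hC a]⟩

theorem simpleBimodule_right {D D' : DivKind} {bar : Prop} (a : DivRing D') {q : ℍ[ℝ]}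
    (hq : q ∈ simpleBimodule D D' bar) : q * toQuat D' a ∈ simpleBimodule D D' bar := by
  have hC := toQuat_cplx
  have hR := toQuat_real
  cases D <;> cases D' <;> simp only [simpleBimodule, Submodule.mem_mk, AddSubmonoid.mem_mk,
    AddSubsemigroup.mem_mk, Set.mem_ofPred_eq] at hq ⊢
  · simp [hq, hR a]
  · simp [hq, hC a]
  · simp [hq, hR a]
  · exact ⟨fun h => by simp [hq.1 h, hC a], fun h => by simp [hq.2 h, hC a]⟩

/-! ## Modulated quivers over `ℝ` and their tensor algebras -/

/-- A quiver with vertex set `V` and arrow set `E`, with a modulation over `ℝ`: a division algebra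
at each vertex and a simple bimodule at each arrow. Up to isomorphism, the simple bimodule is
determined by the division algebras at the ends of the arrow, except between two copies of `ℂ`,
where `bar` tells whether it is `ℂ` or its conjugate; elsewhere `bar` is not used. -/
structure ModulatedQuiver (V : Type u) (E : Type w) where
  src : E → V
  tgt : E → V
  mod : V → DivKind
  bar : E → Prop

namespace ModulatedQuiver

variable {V : Type u} {E : Type w} (Q : ModulatedQuiver V E)

/-- The bimodule at the arrow `α`, a `mod (tgt α)`-`mod (src α)`-bimodule. -/
def arrowModule (α : E) : Submodule ℝ ℍ[ℝ] :=
  simpleBimodule (Q.mod (Q.tgt α)) (Q.mod (Q.src α)) (Q.bar α)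

/-- The ring `∏ᵢ M(i)`. -/
abbrev BaseRing : Type u := (v : V) → DivRing (Q.mod v)

/-- The `∏ᵢ M(i)`-bimodule `⨁_α M(α)` (the quivers of interest are finite). -/
def ArrowBimodule : Type w := (α : E) → Q.arrowModule α

noncomputable instance : AddCommGroup Q.ArrowBimodule :=
  inferInstanceAs (AddCommGroup ((α : E) → Q.arrowModule α))

noncomputable instance : Module ℝ Q.ArrowBimodule :=
  inferInstanceAs (Module ℝ ((α : E) → Q.arrowModule α))

noncomputable instance : Module Q.BaseRing Q.ArrowBimodule where
  smul a m := fun α => ⟨toQuat _ (a (Q.tgt α)) * (m α).1, simpleBimodule_left _ (m α).2⟩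
  one_smul m := funext fun α => Subtype.ext <| by
    change toQuat _ (1 : DivRing _) * (m α).1 = (m α).1
    rw [map_one, one_mul]
  mul_smul a b m := funext fun α => Subtype.ext <| by
    change toQuat _ (a (Q.tgt α) * b (Q.tgt α)) * (m α).1 =
      toQuat _ (a (Q.tgt α)) * (toQuat _ (b (Q.tgt α)) * (m α).1)
    rw [map_mul, mul_assoc]
  smul_zero a := funext fun α => Subtype.ext <| by
    change toQuat _ (a (Q.tgt α)) * (0 : ℍ[ℝ]) = 0
    rw [mul_zero]
  smul_add a m n := funext fun α => Subtype.ext <| by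
    change toQuat _ (a (Q.tgt α)) * ((m α).1 + (n α).1) =
      toQuat _ (a (Q.tgt α)) * (m α).1 + toQuat _ (a (Q.tgt α)) * (n α).1
    rw [mul_add]
  add_smul a b m := funext fun α => Subtype.ext <| by
    change toQuat _ (a (Q.tgt α) + b (Q.tgt α)) * (m α).1 =
      toQuat _ (a (Q.tgt α)) * (m α).1 + toQuat _ (b (Q.tgt α)) * (m α).1
    rw [map_add, add_mul]
  zero_smul m := funext fun α => Subtype.ext <| by
    change toQuat _ (0 : DivRing _) * (m α).1 = 0
    rw [map_zero, zero_mul]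

noncomputable instance : Module Q.BaseRingᵐᵒᵖ Q.ArrowBimodule where
  smul a m := fun α =>
    ⟨(m α).1 * toQuat _ (a.unop (Q.src α)), simpleBimodule_right _ (m α).2⟩
  one_smul m := funext fun α => Subtype.ext <| by
    change (m α).1 * toQuat _ (1 : DivRing _) = (m α).1
    rw [map_one, mul_one]
  mul_smul a b m := funext fun α => Subtype.ext <| by
    change (m α).1 * toQuat _ (b.unop (Q.src α) * a.unop (Q.src α)) =
      (m α).1 * toQuat _ (b.unop (Q.src α)) * toQuat _ (a.unop (Q.src α))
    rw [map_mul, mul_assoc]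
  smul_zero a := funext fun α => Subtype.ext <| by
    change (0 : ℍ[ℝ]) * toQuat _ (a.unop (Q.src α)) = 0
    rw [zero_mul]
  smul_add a m n := funext fun α => Subtype.ext <| by
    change ((m α).1 + (n α).1) * toQuat _ (a.unop (Q.src α)) =
      (m α).1 * toQuat _ (a.unop (Q.src α)) + (n α).1 * toQuat _ (a.unop (Q.src α))
    rw [add_mul]
  add_smul a b m := funext fun α => Subtype.ext <| by
    change (m α).1 * toQuat _ (a.unop (Q.src α) + b.unop (Q.src α)) =
      (m α).1 * toQuat _ (a.unop (Q.src α)) + (m α).1 * toQuat _ (b.unop (Q.src α))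
    rw [map_add, mul_add]
  zero_smul m := funext fun α => Subtype.ext <| by
    change (m α).1 * toQuat _ (0 : DivRing _) = 0
    rw [map_zero, mul_zero]

/-- The two actions commute, so that `ArrowBimodule` is a bimodule. -/
instance : SMulCommClass Q.BaseRing Q.BaseRingᵐᵒᵖ Q.ArrowBimodule where
  smul_comm _ _ _ := funext fun _ => Subtype.ext (mul_assoc _ _ _).symm

/-- The tensor algebra `T(Q, M)` of a modulated quiver. -/
abbrev TensorAlg : Type (max u w) := TensorRing ℝ Q.BaseRing Q.ArrowBimodule

open scoped Classical in
/-- The element of `T(Q, M)` given by `a ∈ M(v)`. -/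
noncomputable def vtx (v : V) (a : DivRing (Q.mod v)) : Q.TensorAlg :=
  TensorRing.ofBase ℝ Q.BaseRing Q.ArrowBimodule (Pi.single v a)

open scoped Classical in
/-- The inclusion of `M(α)` into `⨁_α M(α)`, `M(α)` being realised in `ℍ`. -/
noncomputable def inArrowBimodule (α : E) : Q.arrowModule α →ₗ[ℝ] Q.ArrowBimodule :=
  LinearMap.single ℝ (fun α => Q.arrowModule α) α

/-- The subspace `M(α)` of `T(Q, M)`. -/
noncomputable def arrowSpace (α : E) : Submodule ℝ Q.TensorAlg :=
  LinearMap.range (TensorRing.ofModule ℝ Q.BaseRing Q.ArrowBimodule ∘ₗ Q.inArrowBimodule α)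

open scoped Classical in
/-- The element `x_α` of `T(Q, M)` given by an element `x` of `M(α)`, `M(α)` being realised in
`ℍ`. -/
noncomputable def arr (α : E) (x : ℍ[ℝ]) : Q.TensorAlg :=
  if h : x ∈ Q.arrowModule α then
    TensorRing.ofModule ℝ Q.BaseRing Q.ArrowBimodule (Q.inArrowBimodule α ⟨x, h⟩)
  else 0

/-- `Q.tens x α y β` is the element `x_α ⊗ y_β` of `M(α) ⊗ M(β) ⊆ T(Q, M)`. -/
noncomputable def tens (x : ℍ[ℝ]) (α : E) (y : ℍ[ℝ]) (β : E) : Q.TensorAlg :=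
  Q.arr α x * Q.arr β y

/-- The subspace `M(αβ) = M(α) ⊗ M(β)` of `T(Q, M)`, for a path `αβ` (first `β`, then `α`). -/
noncomputable def pathSpace (α β : E) : Submodule ℝ Q.TensorAlg :=
  Q.arrowSpace α * Q.arrowSpace β

/-- `v⁺`, the arrows starting at `v`. -/
def outArrows (v : V) : Set E := {α | Q.src α = v}

/-- `v⁻`, the arrows ending at `v`. -/
def inArrows (v : V) : Set E := {α | Q.tgt α = v}

variable {Q} in
/-- An ideal of `T(Q, M)` as a real subspace. -/
noncomputable def idealSpace (I : TwoSidedIdeal Q.TensorAlg) : Submodule ℝ Q.TensorAlg :=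
  (TwoSidedIdeal.asIdeal I).restrictScalars ℝ

/-- `I_v`, the intersection of `I` with the sum of all `M(αβ)`, `α ∈ v⁺`, `β ∈ v⁻`. -/
noncomputable def localIdeal (I : TwoSidedIdeal Q.TensorAlg) (v : V) : Submodule ℝ Q.TensorAlg :=
  (⨆ α ∈ Q.outArrows v, ⨆ β ∈ Q.inArrows v, Q.pathSpace α β) ⊓ idealSpace I

/-- `v` is ordinarily gentle with `ℂ`. -/
structure OrdinarilyGentle (I : TwoSidedIdeal Q.TensorAlg) (v : V) : Prop where
  mod_eq : Q.mod v = .cplx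
  out_le : (Q.outArrows v).encard ≤ 2
  in_le : (Q.inArrows v).encard ≤ 2
  xor_in : ∀ α ∈ Q.outArrows v, ∀ β ∈ Q.inArrows v, ∀ γ ∈ Q.inArrows v, β ≠ γ →
    Xor (Q.pathSpace α β ≤ idealSpace I) (Q.pathSpace α γ ≤ idealSpace I)
  xor_out : ∀ α ∈ Q.inArrows v, ∀ β ∈ Q.outArrows v, ∀ γ ∈ Q.outArrows v, β ≠ γ →
    Xor (Q.pathSpace β α ≤ idealSpace I) (Q.pathSpace γ α ≤ idealSpace I)
  all_or_zero : ∀ α ∈ Q.outArrows v, ∀ β ∈ Q.inArrows v,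
    Q.mod (Q.tgt α) ≠ .cplx → Q.mod (Q.src β) ≠ .cplx →
      idealSpace I ⊓ Q.pathSpace α β = Q.pathSpace α β ∨ idealSpace I ⊓ Q.pathSpace α β = ⊥
  /-- There are no commutativity relations at `v`: `I_v` is the sum of the `M(αβ)` contained
  in `I`. -/
  localIdeal_eq : Q.localIdeal I v =
    ⨆ α ∈ Q.outArrows v, ⨆ β ∈ Q.inArrows v, ⨆ _ : Q.pathSpace α β ≤ idealSpace I,
      Q.pathSpace α β

/-- Two parallel arrows between vertices with the same division algebra `ℝ` or `ℍ` are written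
`γ` and `γⁱ`. `IsLabelling L` says that `L` is the set of the arrows `γⁱ` for some such choice. -/
structure IsLabelling (L : Set E) : Prop where
  mod_eq : ∀ γ ∈ L, Q.mod (Q.src γ) = Q.mod (Q.tgt γ) ∧ Q.mod (Q.src γ) ≠ .cplx
  partner : ∀ γ' ∈ L, ∃ γ, γ ∉ L ∧ Q.src γ = Q.src γ' ∧ Q.tgt γ = Q.tgt γ'
  one_of_two : ∀ γ γ' : E, γ ≠ γ' → Q.src γ = Q.src γ' → Q.tgt γ = Q.tgt γ' →
    Q.mod (Q.src γ) = Q.mod (Q.tgt γ) → Q.mod (Q.src γ) ≠ .cplx → Xor (γ ∈ L) (γ' ∈ L)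

/-- `γ' = γⁱ` if the ends of `γ` have the same division algebra; otherwise there is no `γⁱ`, and
`γ' = γ` by convention. -/
def IsPartner (L : Set E) (γ γ' : E) : Prop :=
  (Q.mod (Q.src γ) = Q.mod (Q.tgt γ) ∧ γ ∉ L ∧ γ' ∈ L ∧
      Q.src γ = Q.src γ' ∧ Q.tgt γ = Q.tgt γ') ∨
    (Q.mod (Q.src γ) ≠ Q.mod (Q.tgt γ) ∧ γ' = γ)

/-- `v⁻` is `{β, βⁱ}` or, if `βⁱ` does not exist, `{β}`. -/
def IsIn (L : Set E) (v : V) (β β' : E) : Prop :=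
  Q.IsPartner L β β' ∧ Q.inArrows v = {β, β'}

/-- `v⁺` is `{α, αⁱ}` or, if `αⁱ` does not exist, `{α}`. -/
def IsOut (L : Set E) (v : V) (α α' : E) : Prop :=
  Q.IsPartner L α α' ∧ Q.outArrows v = {α, α'}

open DivKind in
/-- The generators `r₀` and `r₀ⁱ` of `I_v⁰`, where `a : v → w`, `a' = aⁱ`, `b : u → v`, `b' = bⁱ`;
the first three arguments are the division algebras at `u`, `v`, `w`. -/
noncomputable def gen0 (a a' b b' : E) : DivKind → DivKind → DivKind → Set Q.TensorAlg
  | real, real, real =>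
      {Q.tens 1 a 1 b - Q.tens 1 a' 1 b', - Q.tens 1 a 1 b' - Q.tens 1 a' 1 b}
  | real, real, quat => {Q.tens 1 a 1 b + Q.tens qj a 1 b'}
  | real, real, cplx => {Q.tens 1 a 1 b + Q.tens qj a 1 b'}
  | quat, quat, real => {Q.tens 1 a 1 b + Q.tens 1 a qj b'}
  | quat, quat, quat =>
      {Q.tens 1 a 1 b - Q.tens 1 a' 1 b' + Q.tens 1 a qj b' + Q.tens 1 a' qj b}
  | quat, quat, cplx => {Q.tens 1 a 1 b + Q.tens 1 a qj b'}
  | quat, real, real => {Q.tens 1 a 1 b + Q.tens 1 a' qj b}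
  | cplx, real, real => {Q.tens 1 a 1 b + Q.tens 1 a' qj b}
  | real, quat, quat => {Q.tens 1 a 1 b + Q.tens 1 a' qj b}
  | cplx, quat, quat => {Q.tens 1 a 1 b + Q.tens qj a' 1 b}
  | quat, real, quat => {Q.tens 1 a 1 b - Q.tens qj a qj b}
  | quat, real, cplx => {Q.tens 1 a 1 b - Q.tens qj a qj b}
  | cplx, real, quat => {Q.tens 1 a 1 b - Q.tens qj a qj b}
  | cplx, real, cplx => {Q.tens 1 a 1 b - Q.tens qj a qj b}
  | real, quat, cplx => {Q.tens 1 a 1 b}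
  | cplx, quat, real => {Q.tens 1 a 1 b}
  | cplx, quat, cplx => {Q.tens 1 a 1 b}
  | real, quat, real => {Q.tens 1 a 1 b, Q.tens 1 a qj b}
  | _, cplx, _ => ∅

open DivKind in
/-- The generators `r₁` and `r₁ⁱ` of `I_v¹`, with the notation of `gen0`. -/
noncomputable def gen1 (a a' b b' : E) : DivKind → DivKind → DivKind → Set Q.TensorAlg
  | real, real, real =>
      {Q.tens 1 a 1 b + Q.tens 1 a' 1 b', Q.tens 1 a 1 b' - Q.tens 1 a' 1 b}
  | real, real, quat => {Q.tens 1 a 1 b - Q.tens qj a 1 b'}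
  | real, real, cplx => {Q.tens 1 a 1 b - Q.tens qj a 1 b'}
  | quat, quat, real => {Q.tens 1 a qk b - Q.tens 1 a ql b'}
  | quat, quat, quat =>
      {Q.tens 1 a qk b + Q.tens 1 a' qk b' - Q.tens 1 a ql b' + Q.tens 1 a' ql b}
  | quat, quat, cplx => {Q.tens 1 a qk b - Q.tens 1 a ql b'}
  | quat, real, real => {Q.tens 1 a 1 b - Q.tens 1 a' qj b}
  | cplx, real, real => {Q.tens 1 a 1 b - Q.tens 1 a' qj b}
  | real, quat, quat => {Q.tens 1 a qk b + Q.tens 1 a' ql b}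
  | cplx, quat, quat => {Q.tens qk a 1 b + Q.tens ql a' 1 b}
  | quat, real, quat => {Q.tens 1 a 1 b + Q.tens qj a qj b}
  | quat, real, cplx => {Q.tens 1 a 1 b + Q.tens qj a qj b}
  | cplx, real, quat => {Q.tens 1 a 1 b + Q.tens qj a qj b}
  | cplx, real, cplx => {Q.tens 1 a 1 b + Q.tens qj a qj b}
  | real, quat, cplx => {Q.tens 1 a qk b}
  | cplx, quat, real => {- Q.tens qk a 1 b}
  -- here `-qk` is the column `[0; 1]`
  | cplx, quat, cplx => {Q.tens 1 a (-qk) b}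
  | real, quat, real => {Q.tens 1 a qk b, Q.tens 1 a ql b}
  | _, cplx, _ => ∅

/-- The `M(w)`-`M(u)`-subbimodule of `T(Q, M)` generated by `R`. -/
noncomputable def bimoduleSpan (w u : V) (R : Set Q.TensorAlg) : Submodule ℝ Q.TensorAlg :=
  Submodule.span ℝ {x | ∃ c : DivRing (Q.mod w), ∃ r ∈ R, ∃ d : DivRing (Q.mod u),
    x = Q.vtx w c * r * Q.vtx u d}

/-- `I_v⁰` (for `p = 0`) and `I_v¹` (for `p = 1`), for a vertex `v` for which `v⁺` and `v⁻` have the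
form required in `SpeciallyGentle`; the arrows over which the supremum is taken are then unique. -/
noncomputable def special (L : Set E) (p : Fin 2) (v : V) : Submodule ℝ Q.TensorAlg :=
  ⨆ (a : E) (a' : E) (b : E) (b' : E) (_ : Q.IsOut L v a a') (_ : Q.IsIn L v b b'),
    Q.bimoduleSpan (Q.tgt a) (Q.src b)
      ((if p = 0 then Q.gen0 else Q.gen1) a a' b b'
        (Q.mod (Q.src b)) (Q.mod v) (Q.mod (Q.tgt a)))

/-- `v` is specially gentle. The modulated quiver formed by `v`, `v⁻`, `v⁺` and the neighbours is
one of 18 cases, one for each choice of the division algebras of `u`, `v` and `w` with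
`M(v) ≠ ℂ`: there are one or, if `M(u) = M(v)`, two arrows ending at `v`, all of them starting
at `u`; and there are one or, if `M(w) = M(v)`, two arrows starting at `v`, all of them ending
at `w`; and `I_v` is `I_v⁰` or `I_v¹`. Or it is a degenerate case, where `v` is a source or
a sink. -/
def SpeciallyGentle (L : Set E) (I : TwoSidedIdeal Q.TensorAlg) (v : V) : Prop :=
  Q.mod v ≠ .cplx ∧
    (((∃ α α', Q.IsOut L v α α') ∧ (∃ β β', Q.IsIn L v β β') ∧
        Xor (Q.localIdeal I v = Q.special L 0 v) (Q.localIdeal I v = Q.special L 1 v)) ∨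
      (Q.inArrows v = ∅ ∧ (Q.outArrows v = ∅ ∨ ∃ α α', Q.IsOut L v α α')) ∨
      (Q.outArrows v = ∅ ∧ (Q.inArrows v = ∅ ∨ ∃ β β', Q.IsIn L v β β')))

/-- `T(Q, M)/I` is locally complexified-gentle of special type. -/
structure IsSpecialType (L : Set E) (I : TwoSidedIdeal Q.TensorAlg) : Prop where
  gentle : ∀ v, Q.OrdinarilyGentle I v ∨ Q.SpeciallyGentle L I v
  generated : I = TwoSidedIdeal.span (⋃ v, (Q.localIdeal I v : Set Q.TensorAlg))

/-- The algebra `T(Q, M)/I`. -/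
abbrev QuotientAlg (I : TwoSidedIdeal Q.TensorAlg) : Type (max u w) := I.ringCon.Quotient

end ModulatedQuiver

/-! ## `ℂ`-semilinear path algebras and semilinear clannish algebras of gentle type -/

/-- A quiver with special loops; `loopsR` are the special loops with polynomial `x² - 1`, and
`loopsH` those with polynomial `x² + 1`. -/
structure LoopQuiver (V : Type u) (E : Type w) where
  src : E → V
  tgt : E → V
  loopsR : Set E
  loopsH : Set E

/-- Generators of a semilinear path algebra. -/
inductive PathGen (V : Type u) (E : Type w) : Type (max u w)
  | scalar (c : ℂ) : PathGen V E
  | idem (v : V) : PathGen V E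
  | arrow (α : E) : PathGen V E

namespace LoopQuiver

variable {V : Type u} {E : Type w} [Fintype V] (Q : LoopQuiver V E) (σ : E → (ℂ ≃ₐ[ℝ] ℂ))

open FreeAlgebra PathGen in
/-- The relations of the semilinear path algebra `ℂ_σ Q`. The first three make `ℂ` a subring. -/
inductive PathRel : FreeAlgebra ℝ (PathGen V E) → FreeAlgebra ℝ (PathGen V E) → Prop
  | scalar_real (r : ℝ) : PathRel (ι ℝ (scalar (r : ℂ))) (algebraMap ℝ _ r)
  | scalar_add (c d : ℂ) :
      PathRel (ι ℝ (scalar (c + d))) (ι ℝ (scalar c) + ι ℝ (scalar d))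
  | scalar_mul (c d : ℂ) :
      PathRel (ι ℝ (scalar (c * d))) (ι ℝ (scalar c) * ι ℝ (scalar d))
  | idem_self (i : V) : PathRel (ι ℝ (idem i) * ι ℝ (idem i)) (ι ℝ (idem i))
  | idem_ne (i j : V) (h : i ≠ j) : PathRel (ι ℝ (idem i) * ι ℝ (idem j)) 0
  | idem_sum : PathRel (∑ i : V, ι ℝ (idem i)) 1
  | idem_arrow (α : E) : PathRel (ι ℝ (idem (Q.tgt α)) * ι ℝ (arrow α)) (ι ℝ (arrow α))
  | arrow_idem (α : E) : PathRel (ι ℝ (arrow α) * ι ℝ (idem (Q.src α))) (ι ℝ (arrow α))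
  | idem_scalar (i : V) (c : ℂ) :
      PathRel (ι ℝ (idem i) * ι ℝ (scalar c)) (ι ℝ (scalar c) * ι ℝ (idem i))
  | arrow_scalar (α : E) (c : ℂ) :
      PathRel (ι ℝ (arrow α) * ι ℝ (scalar c)) (ι ℝ (scalar (σ α c)) * ι ℝ (arrow α))

/-- The semilinear path algebra `ℂ_σ Q`, as an `ℝ`-algebra. -/
abbrev PathAlg : Type (max u w) := RingQuot (Q.PathRel σ)

/-- The image of a generator in `ℂ_σ Q`. -/
noncomputable def gen (x : PathGen V E) : Q.PathAlg σ :=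
  RingQuot.mkAlgHom ℝ (Q.PathRel σ) (FreeAlgebra.ι ℝ x)

/-- The relations `S` at the special loops: `s² - e_i` and `s² + e_i`. -/
def loopRel : Set (Q.PathAlg σ) :=
  {x | ∃ s ∈ Q.loopsR,
      x = Q.gen σ (.arrow s) * Q.gen σ (.arrow s) - Q.gen σ (.idem (Q.src s))} ∪
    {x | ∃ s ∈ Q.loopsH,
      x = Q.gen σ (.arrow s) * Q.gen σ (.arrow s) + Q.gen σ (.idem (Q.src s))}

/-- The elements of `ℂ_σ Q` given by the paths in `Z`; a path is a list of arrows, written from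
left to right as a product, so that the last arrow of the list comes first. -/
def zeroRel (Z : Set (List E)) : Set (Q.PathAlg σ) :=
  (fun l : List E => (l.map fun α => Q.gen σ (.arrow α)).prod) '' Z

/-- The algebra `ℂ_σ Q / ⟨S ∪ Z⟩`. -/
abbrev ClannishAlg (Z : Set (List E)) : Type (max u w) :=
  (TwoSidedIdeal.span (Q.loopRel σ ∪ Q.zeroRel σ Z)).ringCon.Quotient

/-- The image of `c ∈ ℂ` in `ℂ_σ Q / ⟨S ∪ Z⟩`. -/
noncomputable def scalarMap (Z : Set (List E)) (c : ℂ) : Q.ClannishAlg σ Z :=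
  (TwoSidedIdeal.span (Q.loopRel σ ∪ Q.zeroRel σ Z)).ringCon.mk' (Q.gen σ (.scalar c))

/-- The set of special loops. -/
def specialLoops : Set E := Q.loopsR ∪ Q.loopsH

/-- `ℂ_σ Q / ⟨S ∪ Z⟩` is a `ℂ`-semilinear clannish algebra of gentle type. -/
structure IsClannishGentle (Z : Set (List E)) : Prop where
  /-- The special loops are loops with conjugation as twist; -/
  loop : ∀ s ∈ Q.specialLoops, Q.src s = Q.tgt s
  twist : ∀ s ∈ Q.specialLoops, σ s = Complex.conjAe
  /-- each is associated with one of the polynomials, and there is at most one at each vertex. -/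
  disjoint : Disjoint Q.loopsR Q.loopsH
  unique : ∀ s ∈ Q.specialLoops, ∀ s' ∈ Q.specialLoops, Q.src s = Q.src s' → s = s'
  /-- `Z` consists of paths of length at least two; -/
  path : ∀ p ∈ Z, p.IsChain fun α β => Q.src α = Q.tgt β
  two_le : ∀ p ∈ Z, 2 ≤ p.length
  /-- they neither start nor end with a special loop, nor contain the square of one. -/
  head : ∀ p ∈ Z, ∀ s ∈ Q.specialLoops, p.head? ≠ some s ∧ p.getLast? ≠ some s
  square : ∀ p ∈ Z, ∀ s ∈ Q.specialLoops, ¬ [s, s] <:+: p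
  /-- (G1) -/
  out_le : ∀ v, {α | Q.src α = v}.encard ≤ 2
  in_le : ∀ v, {α | Q.tgt α = v}.encard ≤ 2
  /-- (G2) -/
  right_not_mem : ∀ α ∉ Q.specialLoops,
    {β | Q.src α = Q.tgt β ∧ [α, β] ∉ Z}.Subsingleton
  left_not_mem : ∀ α ∉ Q.specialLoops,
    {γ | Q.src γ = Q.tgt α ∧ [γ, α] ∉ Z}.Subsingleton
  right_mem : ∀ α ∉ Q.specialLoops,
    {β | Q.src α = Q.tgt β ∧ [α, β] ∈ Z}.Subsingleton
  left_mem : ∀ α ∉ Q.specialLoops,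
    {γ | Q.src γ = Q.tgt α ∧ [γ, α] ∈ Z}.Subsingleton
  /-- (G3) -/
  length_eq : ∀ p ∈ Z, p.length = 2

end LoopQuiver

/-! ## The construction of `Q^s`, `σ`, `σ'`, `Z`, `Z'` -/

namespace ModulatedQuiver

variable {V : Type u} {E : Type w} (Q : ModulatedQuiver V E) (L : Set E)
  (I : TwoSidedIdeal Q.TensorAlg)

/-- The ordinary arrows of `Q^s`: the arrows of `Q` other than the `γⁱ`. -/
abbrev OrdArrow (_ : ModulatedQuiver V E) (L : Set E) : Type w := {α : E // α ∉ L}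

/-- The arrows of `Q^s`: the ordinary arrows, and a special loop at each vertex `i` with
`M(i) ≠ ℂ`. -/
abbrev SArrow : Type (max u w) := Q.OrdArrow L ⊕ {i : V // Q.mod i ≠ .cplx}

/-- The quiver `Q^s` with its special loops. -/
def sQuiver : LoopQuiver V (Q.SArrow L) where
  src := Sum.elim (fun α => Q.src α.1) (fun i => i.1)
  tgt := Sum.elim (fun α => Q.tgt α.1) (fun i => i.1)
  loopsR := {x | ∃ i, x = Sum.inr i ∧ Q.mod i.1 = .real}
  loopsH := {x | ∃ i, x = Sum.inr i ∧ Q.mod i.1 = .quat}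

/-- The part of `Z` and `Z'` at the vertices with `ℂ`: the paths `αβ` with `M(αβ) ⊆ I_v`. -/
def zeroC : Set (List (Q.SArrow L)) :=
  {l | ∃ α β : Q.OrdArrow L, Q.src α.1 = Q.tgt β.1 ∧ Q.mod (Q.src α.1) = .cplx ∧
    Q.pathSpace α.1 β.1 ≤ Q.localIdeal I (Q.src α.1) ∧ l = [Sum.inl α, Sum.inl β]}

/-- The relation set `Z`. -/
def zeroSet : Set (List (Q.SArrow L)) :=
  {l | ∃ α β : Q.OrdArrow L, Q.src α.1 = Q.tgt β.1 ∧ Q.mod (Q.src α.1) ≠ .cplx ∧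
    l = [Sum.inl α, Sum.inl β]} ∪ Q.zeroC L I

/-- The relation set `Z'`: at a vertex `v` with `M(v) ≠ ℂ` it has `αβ` if `I_v = I_v⁰`, and
`α s_v β` if `I_v = I_v¹`. -/
def zeroSet' : Set (List (Q.SArrow L)) :=
  {l | ∃ α β : Q.OrdArrow L, Q.src α.1 = Q.tgt β.1 ∧
    ∃ h : Q.mod (Q.src α.1) ≠ .cplx,
      (Q.localIdeal I (Q.src α.1) = Q.special L 0 (Q.src α.1) ∧
        l = [Sum.inl α, Sum.inl β]) ∨
      (Q.localIdeal I (Q.src α.1) = Q.special L 1 (Q.src α.1) ∧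
        l = [Sum.inl α, Sum.inr ⟨Q.src α.1, h⟩, Sum.inl β])} ∪ Q.zeroC L I

/-- Special paths `α₁ α₂ ⋯ αₙ`: paths of pairwise different ordinary arrows, passing through no
vertex with `ℂ` (except possibly at their ends). -/
structure IsSpecialPath (l : List (Q.OrdArrow L)) : Prop where
  ne_nil : l ≠ []
  nodup : l.Nodup
  chain : l.IsChain fun α β => Q.src α.1 = Q.tgt β.1 ∧ Q.mod (Q.src α.1) ≠ .cplx

/-- Special paths which are not properly contained in another special path. -/
def IsMaximalSpecialPath (l : List (Q.OrdArrow L)) : Prop :=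
  Q.IsSpecialPath L l ∧ ∀ l', Q.IsSpecialPath L l' → l <:+: l' → l' = l

/-- A special path `α₁ ⋯ αₙ` is an oriented cycle (all of whose vertices have a division algebra
different from `ℂ`). -/
def IsOrientedCycle (l : List (Q.OrdArrow L)) : Prop :=
  ∃ α ∈ l.head?, ∃ β ∈ l.getLast?, Q.src β.1 = Q.tgt α.1 ∧ Q.mod (Q.src β.1) ≠ .cplx

open scoped Classical in
/-- The exponent `p` with `I_v^p ⊆ I`. -/
noncomputable def exponent (v : V) : ℕ := if Q.special L 1 v ≤ idealSpace I then 1 else 0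

open scoped Classical in
/-- The twist `σ'`. -/
noncomputable def twist' : Q.SArrow L → (ℂ ≃ₐ[ℝ] ℂ)
  | .inr _ => Complex.conjAe
  | .inl α =>
      if Q.mod (Q.src α.1) = .cplx ∧ Q.mod (Q.tgt α.1) = .cplx ∧ Q.bar α.1 then Complex.conjAe
      else 1

open scoped Classical in
/-- The twist `σ`. An ordinary arrow `α` not between two vertices with `ℂ` lies in exactly one
maximal special path; if it is the last arrow of this path and the path is not an oriented cycle,
then `σ_α = 1`; otherwise `σ_α` is the `p`-th power of conjugation, where `I_{s(α)}^p ⊆ I`. -/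
noncomputable def twist : Q.SArrow L → (ℂ ≃ₐ[ℝ] ℂ)
  | .inr _ => Complex.conjAe
  | .inl α =>
      if Q.mod (Q.src α.1) = .cplx ∧ Q.mod (Q.tgt α.1) = .cplx then
        if Q.bar α.1 then Complex.conjAe else 1
      else if ∃ l, Q.IsMaximalSpecialPath L l ∧ ¬ Q.IsOrientedCycle L l ∧ l.getLast? = some α then 1
      else Complex.conjAe ^ Q.exponent L I (Q.src α.1)

end ModulatedQuiver

/-! Write `C` for `ℂ_{σ'} Q^s / ⟨S ∪ Z'⟩`. At a vertex with a special loop, the relations make `ℂ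
e_v + ℂ s_v` an image of `ℍ` if `s_v² = -e_v`, and of `M₂(ℝ)` if `s_v² = e_v`. In the second case
put `ε_v = (e_v + s_v)/2`, and otherwise `ε_v = e_v`. With `M(v) = ℝ` one has `ε_v c ε_v = Re(c)
ε_v` for `c ∈ ℂ`, and `e_v = ε_v + i ε_v (-i)`, because `s_v` anticommutes with `i`. Hence `ε = ∑
ε_v` is a full idempotent, `C` is Morita equivalent to `ε C ε`, and claim 1 becomes `T(Q, M)/I ≅ ε C
ε`.

The map `T(Q, M) → ε C ε` sends `M(v)` to combinations of scalars and loops, and `M(α)` to the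
bimodule generated by `core α`. If both ends carry `ℝ`, or both carry `ℍ`, a single ordinary arrow
of `Q^s` yields two simple bimodules, those of `γ` and `γⁱ`. Conversely, the decomposition `e_v = ∑
rowU v k * colV v k` turns elements of `C` into 2×2 matrices over the corner. The same matrices
written over `T(Q, M)/I` (`hat`, `loopHat`, `scalHat`) represent `C`.

The link between the relations is `map_gens_eq_zero_iff`: a homomorphism `F` on `T(Q, M)` kills the
generators of `I_v^p` exactly if `hat a * loopHat^p * hat b = 0`. The generators are the entries of
this product, up to real factors and multiplication by `j`. For the projection onto `T(Q, M)/I` this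
gives the relations `Z'` for the matrices (`exists_toMatrix`). For the map to the corner it shows
that `I` is killed (`IsToCorner.map_eq_zero`). The upper left matrix entry recovers an element of
`T(Q, M)/I` from its image (`IsToMatrix.recovers`), which gives injectivity. Surjectivity holds
because the matrix entries of the generators of `C` lie in the image (`IsToCorner.inRange`).

For claim 2, replacing `α` by `α s_v` changes its twist by conjugation and exchanges the relations
`α s_v β = 0` and `α β = 0`, as `s_v² = ±e_v`. This is done where `σ` and `σ'` differ. An arrow
exempted from the change because it ends a maximal special path that is no cycle meets no relation
at a source without `ℂ`: no ordinary arrow ends there. It must also be known that `I_v^1 ⊆ I` fails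
when `I_v = I_v^0`; a representation of `C` with `a b = 0` and `a s_v b ≠ 0` shows this
(`ord_mul_loop_mul_ord_ne_zero`). Claim 3 is a check at each vertex. -/

/-! ## Morita equivalence with the corner of a full idempotent -/

namespace IsIdempotentElem

section CornerAlgebra

variable {k B : Type*} [CommRing k] [Ring B] [Algebra k B] {e : B} (he : IsIdempotentElem e)

theorem mul_corner (c : he.Corner) : e * c.1 = c.1 :=
  ((Subsemigroup.mem_corner_iff he).mp c.2).1

theorem corner_mul (c : he.Corner) : c.1 * e = c.1 :=
  ((Subsemigroup.mem_corner_iff he).mp c.2).2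

/-- An element of the corner `e B e`. -/
def toCorner (b : B) (h₁ : e * b = b) (h₂ : b * e = b) : he.Corner :=
  ⟨b, (Subsemigroup.mem_corner_iff he).mpr ⟨h₁, h₂⟩⟩

noncomputable instance : Module k he.Corner where
  smul r c := he.toCorner (r • c.1) (by rw [mul_smul_comm, he.mul_corner])
    (by rw [smul_mul_assoc, he.corner_mul])
  one_smul c := Subtype.ext (one_smul k c.1)
  mul_smul r s c := Subtype.ext (mul_smul r s c.1)
  smul_zero r := Subtype.ext (smul_zero r)
  smul_add r c d := Subtype.ext (smul_add r c.1 d.1)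
  add_smul r s c := Subtype.ext (add_smul r s c.1)
  zero_smul c := Subtype.ext (zero_smul k c.1)

noncomputable instance : Algebra k he.Corner :=
  Algebra.ofModule (fun r c d => Subtype.ext (smul_mul_assoc r c.1 d.1))
    (fun r c d => Subtype.ext (mul_smul_comm r c.1 d.1))

@[simp] theorem corner_val_mul (c d : he.Corner) : (c * d).1 = c.1 * d.1 := rfl
@[simp] theorem corner_val_add (c d : he.Corner) : (c + d).1 = c.1 + d.1 := rfl
@[simp] theorem corner_val_zero : (0 : he.Corner).1 = 0 := rfl
@[simp] theorem corner_val_one : (1 : he.Corner).1 = e := rfl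
@[simp] theorem corner_val_smul (r : k) (c : he.Corner) : (r • c).1 = r • c.1 := rfl

/-- The inclusion of the corner `e B e` into `B`. -/
def cornerVal : he.Corner →ₗ[k] B where
  toFun := Subtype.val
  map_add' _ _ := rfl
  map_smul' _ _ := rfl

@[simp] theorem corner_val_sum {ι : Type*} (s : Finset ι) (f : ι → he.Corner) :
    (∑ i ∈ s, f i).1 = ∑ i ∈ s, (f i).1 :=
  map_sum (he.cornerVal (k := ℤ)) f s

end CornerAlgebra

/-! ### The functor `N ↦ e N`. -/

section CornerModule

variable {B : Type*} [Ring B] {e : B} (he : IsIdempotentElem e)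

/-- The module `e N` over the corner `e B e`. -/
def CornerModule (_ : IsIdempotentElem e) (N : Type*) [AddCommGroup N] [Module B N] : AddSubgroup N where
  carrier := {n | e • n = n}
  zero_mem' := smul_zero e
  add_mem' := by
    intro a b ha hb
    simp only [Set.mem_ofPred_eq] at *
    rw [smul_add, ha, hb]
  neg_mem' := by
    intro a ha
    simp only [Set.mem_ofPred_eq] at *
    rw [smul_neg, ha]

variable (N : Type*) [AddCommGroup N] [Module B N]

instance : Module he.Corner (he.CornerModule N) where
  smul c n := ⟨c.1 • n.1, by
    change e • c.1 • n.1 = c.1 • n.1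
    rw [← mul_smul, he.mul_corner]⟩
  one_smul n := Subtype.ext n.2
  mul_smul c d n := Subtype.ext (mul_smul c.1 d.1 n.1)
  smul_zero c := Subtype.ext (smul_zero c.1)
  smul_add c m n := Subtype.ext (smul_add c.1 m.1 n.1)
  add_smul c d n := Subtype.ext (add_smul c.1 d.1 n.1)
  zero_smul n := Subtype.ext (zero_smul B n.1)

variable {N} {N' : Type*} [AddCommGroup N'] [Module B N']

@[simp] theorem cornerModule_val_smul (c : he.Corner) (n : he.CornerModule N) :
    (c • n).1 = c.1 • n.1 := rfl

/-- The restriction of a `B`-linear map to the modules over the corner. -/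
def cornerMap (f : N →ₗ[B] N') : he.CornerModule N →ₗ[he.Corner] he.CornerModule N' where
  toFun n := ⟨f n.1, by
    change e • f n.1 = f n.1
    rw [← map_smul]
    exact congrArg f n.2⟩
  map_add' m n := Subtype.ext (map_add f m.1 n.1)
  map_smul' c n := Subtype.ext (map_smul f c.1 n.1)

open CategoryTheory

/-- The functor `N ↦ e N`. -/
@[simps]
def cornerFunctor {B : Type u} [Ring B] {e : B} (he : IsIdempotentElem e) :
    ModuleCat.{w} B ⥤ ModuleCat.{w} he.Corner where
  obj N := ModuleCat.of he.Corner (he.CornerModule N)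
  map f := ModuleCat.ofHom (he.cornerMap f.hom)
  map_id _ := rfl
  map_comp _ _ := rfl

end CornerModule

/-! ### Recovering modules and maps from the corner of a full idempotent. -/

section Full

variable {B : Type*} [Ring B] {e : B} (he : IsIdempotentElem e) {K : Type*} [Fintype K]
  {u v : K → B} (huv : ∑ i, u i * e * v i = 1)

/-- The element `e b` of `e N`. -/
def intoCorner {N : Type*} [AddCommGroup N] [Module B N] : N →+ he.CornerModule N where
  toFun n := ⟨e • n, by change e • e • n = e • n; rw [← mul_smul, he.eq]⟩
  map_zero' := Subtype.ext (smul_zero e)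
  map_add' m n := Subtype.ext (smul_add e m n)

@[simp] theorem intoCorner_val {N : Type*} [AddCommGroup N] [Module B N] (n : N) :
    (he.intoCorner n).1 = e • n := rfl

/-- The entries `e bᵢ b b'ⱼ e` of an element of `B`. -/
def cornerMatrix (u v : K → B) (b : B) : Matrix K K he.Corner :=
  fun i j => he.toCorner (e * (v i * b * u j) * e) (by simp only [← mul_assoc, he.eq])
    (by simp only [mul_assoc, he.eq])

omit [Fintype K] in
theorem cornerMatrix_val (b : B) (i j : K) :
    (he.cornerMatrix u v b i j).1 = e * (v i * b * u j) * e := rfl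

include huv in
-- The relation `1 = ∑ u x * e * v x` is inserted between `b` and `c`. So `cornerMatrix` respects
-- sums and products, while `1` goes only to an idempotent matrix; `Induced` is the image of that
-- idempotent on column vectors.
theorem cornerMatrix_mul (b c : B) :
    he.cornerMatrix u v (b * c) = he.cornerMatrix u v b * he.cornerMatrix u v c := by
  ext i j
  apply Subtype.ext
  rw [Matrix.mul_apply, corner_val_sum]
  simp only [corner_val_mul, cornerMatrix_val]
  have : b * c = ∑ x, b * (u x * e * v x) * c := by
    rw [← Finset.sum_mul, ← Finset.mul_sum, huv, mul_one]
  rw [this, Finset.mul_sum, Finset.sum_mul, Finset.mul_sum, Finset.sum_mul]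
  refine Finset.sum_congr rfl fun x _ => ?_
  have h : e * e = e := he.eq
  calc _ = e * (v i * b * u x) * e * (v x * c * u j) * e := by noncomm_ring
    _ = e * (v i * b * u x) * (e * e) * (v x * c * u j) * e := by rw [h]
    _ = _ := by noncomm_ring

omit [Fintype K] in
theorem cornerMatrix_add (b c : B) :
    he.cornerMatrix u v (b + c) = he.cornerMatrix u v b + he.cornerMatrix u v c := by
  ext i j
  apply Subtype.ext
  simp only [Matrix.add_apply, corner_val_add, cornerMatrix_val]
  noncomm_ring

open Matrix.Module in
/-- The `B`-module `B e ⊗ X`, as a submodule of the module of vectors with entries in `X`. -/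
def Induced (u v : K → B) [DecidableEq K] (X : Type*) [AddCommGroup X] [Module he.Corner X] :
    AddSubgroup (K → X) where
  carrier := {x | he.cornerMatrix u v 1 • x = x}
  zero_mem' := smul_zero _
  add_mem' := by
    intro a b ha hb
    simp only [Set.mem_ofPred_eq] at *
    rw [smul_add, ha, hb]
  neg_mem' := by
    intro a ha
    simp only [Set.mem_ofPred_eq] at *
    rw [smul_neg, ha]

variable [DecidableEq K] {X : Type*} [AddCommGroup X] [Module he.Corner X]

open Matrix.Module in
/-- The action of `B` on the induced module. -/
@[reducible]
def inducedModule : Module B (he.Induced u v X) where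
  smul b x := ⟨he.cornerMatrix u v b • x.1, by
    change he.cornerMatrix u v 1 • he.cornerMatrix u v b • x.1 = _
    rw [← mul_smul, ← he.cornerMatrix_mul huv, one_mul]⟩
  one_smul x := Subtype.ext x.2
  mul_smul b c x := Subtype.ext (by
    change he.cornerMatrix u v (b * c) • x.1 = he.cornerMatrix u v b • he.cornerMatrix u v c • x.1
    rw [← mul_smul, ← he.cornerMatrix_mul huv])
  smul_zero b := Subtype.ext (smul_zero _)
  smul_add b x y := Subtype.ext (smul_add _ x.1 y.1)
  add_smul b c x := Subtype.ext (by
    change he.cornerMatrix u v (b + c) • x.1 = he.cornerMatrix u v b • x.1 +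
      he.cornerMatrix u v c • x.1
    rw [he.cornerMatrix_add, add_smul])
  zero_smul x := Subtype.ext (by
    change he.cornerMatrix u v 0 • x.1 = 0
    have : he.cornerMatrix u v 0 = 0 := by
      ext i j; apply Subtype.ext; simp [cornerMatrix_val]
    exact (congrArg (· • x.1) this).trans (zero_smul (Matrix K K he.Corner) x.1))

/-- The column with entries `e bᵢ e`. -/
def cornerColumn (v : K → B) (i : K) : he.Corner :=
  he.toCorner (e * v i * e) (by simp only [← mul_assoc, he.eq]) (by simp only [mul_assoc, he.eq])

include huv in
omit [DecidableEq K] in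
theorem sum_cornerMatrix_mul_cornerColumn (b : B) (i : K) :
    (∑ j, he.cornerMatrix u v b i j * he.cornerColumn v j).1 = e * (v i * b) * e := by
  rw [corner_val_sum]
  simp only [corner_val_mul, cornerMatrix_val]
  have h : e * e = e := he.eq
  calc _ = ∑ j, e * (v i * b) * (u j * e * v j) * e := by
        refine Finset.sum_congr rfl fun j _ => ?_
        change e * (v i * b * u j) * e * (e * v j * e) = _
        calc _ = e * (v i * b * u j) * (e * e) * v j * e := by noncomm_ring
          _ = _ := by rw [h]; noncomm_ring
    _ = _ := by rw [← Finset.sum_mul, ← Finset.mul_sum, huv, mul_one]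

open Matrix.Module in
include huv in
theorem cornerMatrix_smul_cornerColumn (b : B) (x : X) (c : he.Corner)
    (h : ∀ i, e * (v i * b) * e = (he.cornerColumn v i * c).1) :
    he.cornerMatrix u v b • (fun i => he.cornerColumn v i • x) =
      fun i => he.cornerColumn v i • c • x := by
  funext i
  change ∑ j, he.cornerMatrix u v b i j • he.cornerColumn v j • x = _
  simp only [← mul_smul]
  rw [← Finset.sum_smul]
  exact congrArg (· • x) (Subtype.ext ((he.sum_cornerMatrix_mul_cornerColumn huv b i).trans (h i)))

open Matrix.Module in
/-- The corner of the induced module is the module. -/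
noncomputable def inducedEquiv :
    letI := he.inducedModule huv (X := X)
    X ≃ₗ[he.Corner] he.CornerModule (he.Induced u v X) :=
  letI := he.inducedModule huv (X := X)
  { toFun := fun x => ⟨⟨fun i => he.cornerColumn v i • x, by
        refine (he.cornerMatrix_smul_cornerColumn huv 1 x 1 fun i => ?_).trans ?_
        · rw [mul_one, mul_one]
          rfl
        · exact funext fun i => congrArg (he.cornerColumn v i • ·) (one_smul he.Corner x)⟩, by
      apply Subtype.ext
      refine (he.cornerMatrix_smul_cornerColumn huv e x 1 fun i => ?_).trans ?_
      · rw [mul_one]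
        change e * (v i * e) * e = e * v i * e
        simp only [mul_assoc, he.eq]
      · exact funext fun i => congrArg (he.cornerColumn v i • ·) (one_smul he.Corner x)⟩
    map_add' := fun x y => Subtype.ext <| Subtype.ext <| funext fun i => smul_add _ x y
    map_smul' := fun c x => by
      apply Subtype.ext
      apply Subtype.ext
      refine Eq.symm ((he.cornerMatrix_smul_cornerColumn huv c.1 x c fun i => ?_).trans ?_)
      · change e * (v i * c.1) * e = e * v i * e * c.1
        simp only [mul_assoc, he.mul_corner, he.corner_mul]
      · funext i
        rfl
    -- The row `e * u i * e` is a left inverse of the column `e * v i * e`, since `∑ e * u i * e * v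
    -- i * e = e`.
    invFun := fun x => ∑ i, he.cornerColumn u i • x.1.1 i
    left_inv := fun x => by
      change ∑ i, he.cornerColumn u i • he.cornerColumn v i • x = x
      simp only [← mul_smul]
      rw [← Finset.sum_smul]
      convert one_smul he.Corner x
      apply Subtype.ext
      rw [corner_val_sum]
      change ∑ i, (e * u i * e) * (e * v i * e) = e
      have h : e * e = e := he.eq
      calc _ = ∑ i, e * (u i * e * v i) * e := by
            refine Finset.sum_congr rfl fun i _ => ?_
            calc _ = e * u i * (e * e) * v i * e := by noncomm_ring
              _ = _ := by rw [h]; noncomm_ring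
        _ = e := by rw [← Finset.sum_mul, ← Finset.mul_sum, huv, mul_one, h]
    right_inv := fun x => by
      apply Subtype.ext
      refine Eq.trans ?_ x.2
      apply Subtype.ext
      change (fun i => he.cornerColumn v i • ∑ j, he.cornerColumn u j • x.1.1 j) =
        he.cornerMatrix u v e • x.1.1
      funext i
      rw [Finset.smul_sum]
      change _ = ∑ j, he.cornerMatrix u v e i j • x.1.1 j
      refine Finset.sum_congr rfl fun j _ => ?_
      rw [← mul_smul]
      congr 1
      apply Subtype.ext
      change (e * v i * e) * (e * u j * e) = e * (v i * e * u j) * e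
      have h : e * e = e := he.eq
      calc _ = e * v i * (e * e) * u j * e := by noncomm_ring
        _ = _ := by rw [h]; noncomm_ring }

include huv in
omit [DecidableEq K] in
theorem sum_smul_intoCorner {N : Type*} [AddCommGroup N] [Module B N] (n : N) :
    ∑ i, u i • (he.intoCorner (v i • n)).1 = n := by
  simp only [intoCorner_val, ← mul_smul]
  rw [← Finset.sum_smul]
  simp only [← mul_assoc, huv, one_smul]

/-- The extension of a linear map between the modules over the corner. -/
noncomputable def extendCornerMap {N N' : Type*} [AddCommGroup N] [Module B N] [AddCommGroup N']
    [Module B N'] (g : he.CornerModule N →ₗ[he.Corner] he.CornerModule N') : N →ₗ[B] N' where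
  toFun n := ∑ i, u i • (g (he.intoCorner (v i • n))).1
  map_add' m n := by
    simp only [smul_add, map_add, AddSubgroup.coe_add, Finset.sum_add_distrib]
  map_smul' b n := by
    -- Inserting `1 = ∑ u j * e * v j` between `b` and `n` expresses the action of `b` by corner
    -- elements, with which `g` commutes.
    have key : ∀ i, he.intoCorner (v i • b • n) =
        ∑ j, he.cornerMatrix u v b i j • he.intoCorner (v j • n) := by
      intro i
      apply Subtype.ext
      rw [AddSubgroup.val_finsetSum]
      simp only [cornerModule_val_smul, cornerMatrix_val, intoCorner_val, ← mul_smul]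
      rw [← Finset.sum_smul]
      congr 1
      have h : e * e = e := he.eq
      calc e * (v i * b) = ∑ j, e * (v i * b) * (u j * e * v j) := by
            rw [← Finset.mul_sum, huv, mul_one]
        _ = _ := by
            refine Finset.sum_congr rfl fun j _ => ?_
            calc _ = e * (v i * b) * (u j * (e * e) * v j) := by rw [h]
              _ = _ := by noncomm_ring
    simp only [key, map_sum, map_smul, RingHom.id_apply, AddSubgroup.val_finsetSum,
      cornerModule_val_smul, cornerMatrix_val, Finset.smul_sum]
    rw [Finset.sum_comm]
    refine Finset.sum_congr rfl fun j _ => ?_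
    simp only [← mul_smul]
    rw [← Finset.sum_smul]
    have h2 : (g (he.intoCorner (v j • n))).1 = e • (g (he.intoCorner (v j • n))).1 :=
      (g (he.intoCorner (v j • n))).2.symm
    conv_rhs => rw [h2, ← mul_smul]
    congr 1
    calc _ = ∑ i, (u i * e * v i) * (b * u j * e) :=
          Finset.sum_congr rfl fun i _ => by noncomm_ring
      _ = _ := by rw [← Finset.sum_mul, huv, one_mul]

end Full

open CategoryTheory in
open scoped ModuleCat.Algebra in
-- The functor `N ↦ e N` is faithful and full because `n = ∑ u i • (e * v i) • n` expresses `N`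
-- through `e N`, and essentially surjective by the induced modules. The index type lies in the
-- universe of `B` so that vectors indexed by it stay in the same module category.
theorem isMoritaEquivalent_corner_aux {k : Type*} [Field k] {B : Type u} [Ring B] [Algebra k B] {e : B}
    (he : IsIdempotentElem e) {K : Type u} [Fintype K] {u v : K → B}
    (huv : ∑ i, u i * e * v i = 1) : IsMoritaEquivalent k he.Corner B := by
  classical
  let F : ModuleCat.{u} B ⥤ ModuleCat.{u} he.Corner := he.cornerFunctor
  have hfaith : F.Faithful := ⟨fun {N N'} f g hfg => by
    ext n
    have h1 := he.sum_smul_intoCorner huv n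
    have h2 : ∀ n : he.CornerModule N, f.hom n.1 = g.hom n.1 := fun n =>
      congrArg Subtype.val (LinearMap.congr_fun (congrArg ModuleCat.Hom.hom hfg) n)
    rw [← h1]
    simp only [map_sum, map_smul, h2]⟩
  have hfull : F.Full := ⟨fun {N N'} g => by
    refine ⟨ModuleCat.ofHom (he.extendCornerMap huv g.hom), ?_⟩
    apply ModuleCat.hom_ext
    apply LinearMap.ext
    intro n
    apply Subtype.ext
    change ∑ i, u i • (g.hom (he.intoCorner (v i • n.1))).1 = (g.hom n).1
    have key : ∀ i, he.intoCorner (v i • n.1) = he.cornerColumn v i • n := by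
      intro i
      apply Subtype.ext
      change e • v i • n.1 = (e * v i * e) • n.1
      rw [mul_smul, show e • n.1 = n.1 from n.2, mul_smul]
    simp only [key, map_smul]
    change ∑ i, u i • (he.cornerColumn v i).1 • (g.hom n).1 = (g.hom n).1
    simp only [← mul_smul]
    rw [← Finset.sum_smul]
    have : ∑ i, u i * (he.cornerColumn v i).1 = e := by
      change ∑ i, u i * (e * v i * e) = e
      simp only [← mul_assoc]
      rw [← Finset.sum_mul, huv, one_mul]
    rw [this]
    exact (g.hom n).2⟩
  have hess : F.EssSurj := ⟨fun X => by
    let := he.inducedModule huv (X := X)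
    exact ⟨ModuleCat.of B (he.Induced u v X),
      ⟨(LinearEquiv.toModuleIso (he.inducedEquiv huv (X := X))).symm⟩⟩⟩
  have : F.IsEquivalence := {}
  -- A scalar `r` acts as `r • 1` on `N` and as `r • e` on `e N`; these agree on vectors fixed by
  -- `e`.
  have hlin : F.Linear k := ⟨fun {N N'} f r => by
    apply ModuleCat.hom_ext
    apply LinearMap.ext
    intro n
    apply Subtype.ext
    change algebraMap k B r • f.hom n.1 = (algebraMap k he.Corner r).1 • f.hom n.1
    have h : e • f.hom n.1 = f.hom n.1 := by rw [← map_smul, show e • n.1 = n.1 from n.2]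
    rw [Algebra.algebraMap_eq_smul_one, Algebra.algebraMap_eq_smul_one]
    change (r • (1 : B)) • f.hom n.1 = (r • e) • f.hom n.1
    conv_lhs => rw [← h]
    rw [← mul_smul, smul_mul_assoc, one_mul]⟩
  exact IsMoritaEquivalent.symm k ⟨⟨F.asEquivalence, hlin⟩⟩

/-- An algebra is Morita equivalent to the corner of a full idempotent. -/
theorem isMoritaEquivalent_corner {k : Type*} [Field k] {B : Type u} [Ring B] [Algebra k B] {e : B}
    (he : IsIdempotentElem e) {K : Type*} [Fintype K] {u v : K → B}
    (huv : ∑ i, u i * e * v i = 1) : IsMoritaEquivalent k he.Corner B := by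
  -- Reindexing by a lifted `Fin n` removes the universe constraint on the index type.
  let f : ULift.{u} (Fin (Fintype.card K)) ≃ K := Equiv.ulift.trans (Fintype.equivFin K).symm
  refine isMoritaEquivalent_corner_aux he (K := ULift.{u} (Fin (Fintype.card K)))
    (u := u ∘ f) (v := v ∘ f) ?_
  rw [← huv]
  exact f.sum_comp fun i => u i * e * v i

end IsIdempotentElem

/-! ## The tensor algebra of a bimodule -/

namespace TensorRing

variable {k : Type*} {A : Type*} {M : Type*} [CommRing k] [Ring A] [Algebra k A]
  [AddCommGroup M] [Module k M] [Module A M] [Module Aᵐᵒᵖ M]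

theorem ofBase_one : ofBase k A M 1 = 1 := by
  have := RingQuot.mkAlgHom_rel k (Rel.one (k := k) (A := A) (M := M))
  rwa [map_one] at this

theorem ofBase_mul (a b : A) : ofBase k A M (a * b) = ofBase k A M a * ofBase k A M b := by
  have := RingQuot.mkAlgHom_rel k (Rel.mul (k := k) (M := M) a b)
  rw [map_mul] at this
  exact this.symm

theorem ofBase_mul_ofModule (a : A) (m : M) :
    ofBase k A M a * ofModule k A M m = ofModule k A M (a • m) := by
  have := RingQuot.mkAlgHom_rel k (Rel.left (k := k) a m)
  rwa [map_mul] at this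

theorem ofModule_mul_ofBase (m : M) (a : A) :
    ofModule k A M m * ofBase k A M a = ofModule k A M (MulOpposite.op a • m) := by
  have := RingQuot.mkAlgHom_rel k (Rel.right (k := k) m a)
  rwa [map_mul] at this

variable (k A M) in
/-- The canonical map `A → T_A(M)` as a homomorphism of algebras. -/
noncomputable def baseHom : A →ₐ[k] TensorRing k A M :=
  AlgHom.ofLinearMap (ofBase k A M) ofBase_one ofBase_mul

@[simp] theorem baseHom_apply (a : A) : baseHom k A M a = ofBase k A M a := rfl

/-- The universal property of the tensor algebra of a bimodule. -/
noncomputable def lift {R : Type*} [Ring R] [Algebra k R] (f : A →ₐ[k] R) (g : M →ₗ[k] R)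
    (hl : ∀ a m, g (a • m) = f a * g m) (hr : ∀ m a, g (MulOpposite.op a • m) = g m * f a) :
    TensorRing k A M →ₐ[k] R :=
  RingQuot.liftAlgHom k ⟨TensorAlgebra.lift k (f.toLinearMap.coprod g), by
    intro x y h
    cases h <;> simp [hl, hr]⟩

section

variable {R : Type*} [Ring R] [Algebra k R] (f : A →ₐ[k] R) (g : M →ₗ[k] R)
    (hl : ∀ a m, g (a • m) = f a * g m) (hr : ∀ m a, g (MulOpposite.op a • m) = g m * f a)

@[simp] theorem lift_ofBase (a : A) : lift f g hl hr (ofBase k A M a) = f a := by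
  simp [lift, ofBase]

@[simp] theorem lift_ofModule (m : M) : lift f g hl hr (ofModule k A M m) = g m := by
  simp [lift, ofModule]

end

theorem induction {P : TensorRing k A M → Prop} (hbase : ∀ a, P (ofBase k A M a))
    (hmodule : ∀ m, P (ofModule k A M m)) (hmul : ∀ s t, P s → P t → P (s * t))
    (hadd : ∀ s t, P s → P t → P (s + t)) (t : TensorRing k A M) : P t := by
  obtain ⟨t, rfl⟩ := RingQuot.mkAlgHom_surjective k (Rel k A M) t
  induction t using TensorAlgebra.induction with
  | algebraMap r =>
    have := hbase (algebraMap k A r)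
    rw [← baseHom_apply, AlgHom.commutes] at this
    rwa [AlgHom.commutes]
  | ι x =>
    have : x = (x.1, 0) + (0, x.2) := by simp
    rw [this, map_add, map_add]
    exact hadd _ _ (hbase x.1) (hmodule x.2)
  | mul s t hs ht => rw [map_mul]; exact hmul _ _ hs ht
  | add s t hs ht => rw [map_add]; exact hadd _ _ hs ht

end TensorRing

/-! ## The division algebras inside the quaternions -/

/-- The projection of `ℍ` onto a division algebra. -/
noncomputable def ofQuat : (D : DivKind) → ℍ[ℝ] →ₗ[ℝ] DivRing D
  | .real =>
    { toFun := fun q => (q.re : ℝ)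
      map_add' := fun _ _ => rfl
      map_smul' := fun _ _ => rfl }
  | .cplx =>
    { toFun := fun q => (⟨q.re, q.imI⟩ : ℂ)
      map_add' := fun _ _ => rfl
      map_smul' := fun r q => (Complex.ext (by simp) (by simp) :
        (⟨(r • q).re, (r • q).imI⟩ : ℂ) = r • (⟨q.re, q.imI⟩ : ℂ)) }
  | .quat => LinearMap.id

theorem ofQuat_toQuat {D : DivKind} (d : DivRing D) : ofQuat D (toQuat D d) = d := by
  cases D
  · rfl
  · rfl
  · rfl

/-- The division algebra named by `D`, as a subalgebra of `ℍ`. -/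
noncomputable def divSub (D : DivKind) : Subalgebra ℝ ℍ[ℝ] := (toQuat D).range

theorem toQuat_mem (D : DivKind) (d : DivRing D) : toQuat D d ∈ divSub D := ⟨d, rfl⟩

theorem mem_divSub_real {x : ℍ[ℝ]} :
    x ∈ divSub .real ↔ x.imI = 0 ∧ x.imJ = 0 ∧ x.imK = 0 := by
  constructor
  · rintro ⟨d, rfl⟩
    exact toQuat_real d
  · rintro ⟨h1, h2, h3⟩
    exact ⟨(x.re : ℝ), QuaternionAlgebra.ext rfl h1.symm h2.symm h3.symm⟩

theorem mem_divSub_cplx {x : ℍ[ℝ]} : x ∈ divSub .cplx ↔ x.imJ = 0 ∧ x.imK = 0 := by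
  constructor
  · rintro ⟨d, rfl⟩
    exact toQuat_cplx d
  · rintro ⟨h2, h3⟩
    exact ⟨(⟨x.re, x.imI⟩ : ℂ), QuaternionAlgebra.ext rfl rfl h2.symm h3.symm⟩

theorem mem_divSub_quat (x : ℍ[ℝ]) : x ∈ divSub .quat := ⟨x, rfl⟩

theorem mem_simpleBimodule {D D' : DivKind} {bar : Prop} {q : ℍ[ℝ]} :
    q ∈ simpleBimodule D D' bar ↔ match D, D' with
    | .real, .real => q.imI = 0 ∧ q.imJ = 0 ∧ q.imK = 0
    | .real, .cplx => q.imJ = 0 ∧ q.imK = 0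
    | .cplx, .real => q.imJ = 0 ∧ q.imK = 0
    | .cplx, .cplx => (¬ bar → q.imJ = 0 ∧ q.imK = 0) ∧ (bar → q.re = 0 ∧ q.imI = 0)
    | .quat, _ => True
    | _, .quat => True := Iff.rfl

/-! ## Calculations in `T(Q, M)` -/

namespace ModulatedQuiver

variable {V : Type u} {E : Type w} (Q : ModulatedQuiver V E)

/-- The element of `T(Q, M)` given by an element of `M(v)`, `M(v)` being realised in `ℍ`. -/
noncomputable def vq (v : V) : ℍ[ℝ] →ₗ[ℝ] Q.TensorAlg where
  toFun x := Q.vtx v (ofQuat _ x)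
  map_add' x y := by
    classical
    simp only [vtx, map_add, Pi.single_add]
  map_smul' r x := by
    classical
    simp only [vtx, map_smul, Pi.single_smul, RingHom.id_apply]

theorem vq_toQuat (v : V) (d : DivRing (Q.mod v)) : Q.vq v (toQuat _ d) = Q.vtx v d :=
  congrArg (Q.vtx v) (ofQuat_toQuat d)

/-- Membership is essential: `vq` first projects `ℍ` linearly onto `M(v)`, and this projection is
multiplicative only on the subalgebra itself. -/
theorem vq_mul_vq {v : V} {x y : ℍ[ℝ]} (hx : x ∈ divSub (Q.mod v)) (hy : y ∈ divSub (Q.mod v)) :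
    Q.vq v x * Q.vq v y = Q.vq v (x * y) := by
  classical
  obtain ⟨c, rfl⟩ := hx
  obtain ⟨d, rfl⟩ := hy
  have h : (toQuat (Q.mod v)) c * (toQuat (Q.mod v)) d = toQuat _ (c * d) := (map_mul _ _ _).symm
  change Q.vq v (toQuat _ c) * Q.vq v (toQuat _ d) = Q.vq v (toQuat _ c * toQuat _ d)
  rw [h, vq_toQuat, vq_toQuat, vq_toQuat, vtx, vtx, vtx, ← TensorRing.ofBase_mul, ← Pi.single_mul]

theorem vq_mul_vq_of_ne {v v' : V} (h : v ≠ v') (x y : ℍ[ℝ]) : Q.vq v x * Q.vq v' y = 0 := by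
  classical
  change Q.vtx v _ * Q.vtx v' _ = 0
  rw [vtx, vtx, ← TensorRing.ofBase_mul]
  refine Eq.trans (congrArg _ ?_) (map_zero (TensorRing.ofBase ℝ Q.BaseRing Q.ArrowBimodule))
  ext i
  by_cases hi : i = v
  · subst hi
    simp [Pi.single_eq_of_ne h]
  · simp [Pi.single_eq_of_ne hi]

theorem sum_vtx [Fintype V] (f : Q.BaseRing) :
    ∑ v, Q.vtx v (f v) = TensorRing.ofBase ℝ Q.BaseRing Q.ArrowBimodule f := by
  classical
  simp only [vtx]
  rw [← map_sum, Finset.univ_sum_single]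

theorem sum_vq_one [Fintype V] : ∑ v, Q.vq v 1 = 1 := by
  rw [← TensorRing.ofBase_one, ← Q.sum_vtx]
  refine Finset.sum_congr rfl fun v _ => ?_
  rw [← map_one (toQuat (Q.mod v)), vq_toQuat]
  rfl

theorem arr_of_mem {α : E} {x : ℍ[ℝ]} (h : x ∈ Q.arrowModule α) : Q.arr α x =
    TensorRing.ofModule ℝ Q.BaseRing Q.ArrowBimodule (Q.inArrowBimodule α ⟨x, h⟩) := dif_pos h

theorem arr_zero (α : E) : Q.arr α 0 = 0 := by
  rw [arr_of_mem Q (zero_mem _)]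
  exact (congrArg _ (map_zero (Q.inArrowBimodule α))).trans (map_zero _)

theorem arr_add {α : E} {x y : ℍ[ℝ]} (hx : x ∈ Q.arrowModule α) (hy : y ∈ Q.arrowModule α) :
    Q.arr α (x + y) = Q.arr α x + Q.arr α y := by
  rw [arr_of_mem Q hx, arr_of_mem Q hy, arr_of_mem Q (add_mem hx hy), ← map_add, ← map_add]
  rfl

theorem arr_smul {α : E} (r : ℝ) {x : ℍ[ℝ]} (hx : x ∈ Q.arrowModule α) :
    Q.arr α (r • x) = r • Q.arr α x := by
  rw [arr_of_mem Q hx, arr_of_mem Q (Submodule.smul_mem _ r hx), ← map_smul, ← map_smul]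
  rfl

theorem arr_neg {α : E} {x : ℍ[ℝ]} (hx : x ∈ Q.arrowModule α) :
    Q.arr α (-x) = - Q.arr α x := by
  have h := Q.arr_add hx (neg_mem hx)
  rw [add_neg_cancel, arr_zero] at h
  exact eq_neg_of_add_eq_zero_right h.symm

theorem vq_mul_arr {α : E} {c x : ℍ[ℝ]} (hc : c ∈ divSub (Q.mod (Q.tgt α)))
    (hx : x ∈ Q.arrowModule α) : Q.vq (Q.tgt α) c * Q.arr α x = Q.arr α (c * x) := by
  classical
  obtain ⟨d, rfl⟩ := hc
  change Q.vq _ (toQuat _ d) * _ = Q.arr α (toQuat _ d * x)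
  rw [vq_toQuat, arr_of_mem Q hx, arr_of_mem Q (simpleBimodule_left d hx), vtx,
    TensorRing.ofBase_mul_ofModule]
  congr 1
  funext β
  apply Subtype.ext
  change toQuat (Q.mod (Q.tgt β)) (Pi.single (M := fun v => DivRing (Q.mod v)) (Q.tgt α) d (Q.tgt β)) *
    (Pi.single (M := fun α => Q.arrowModule α) α ⟨x, hx⟩ β).1 = (Pi.single (M := fun α => Q.arrowModule α) α _ β).1
  by_cases h : β = α
  · subst h
    simp
  · simp [Pi.single_eq_of_ne h]

theorem arr_mul_vq {α : E} {c x : ℍ[ℝ]} (hx : x ∈ Q.arrowModule α)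
    (hc : c ∈ divSub (Q.mod (Q.src α))) : Q.arr α x * Q.vq (Q.src α) c = Q.arr α (x * c) := by
  classical
  obtain ⟨d, rfl⟩ := hc
  change _ * Q.vq _ (toQuat _ d) = Q.arr α (x * toQuat _ d)
  rw [vq_toQuat, arr_of_mem Q hx, arr_of_mem Q (simpleBimodule_right d hx), vtx,
    TensorRing.ofModule_mul_ofBase]
  congr 1
  funext β
  apply Subtype.ext
  change (Pi.single (M := fun α => Q.arrowModule α) α ⟨x, hx⟩ β).1 *
    toQuat (Q.mod (Q.src β)) (Pi.single (M := fun v => DivRing (Q.mod v)) (Q.src α) d (Q.src β)) = (Pi.single (M := fun α => Q.arrowModule α) α _ β).1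
  by_cases h : β = α
  · subst h
    simp
  · simp [Pi.single_eq_of_ne h]

theorem one_mem_divSub (D : DivKind) : (1 : ℍ[ℝ]) ∈ divSub D := one_mem _

theorem arr_of_not_mem {α : E} {x : ℍ[ℝ]} (hx : x ∉ Q.arrowModule α) : Q.arr α x = 0 := dif_neg hx

/-- True for every quaternion `x`, because `arr` takes the value `0` outside the bimodule. -/
theorem one_vq_mul_arr (α : E) (x : ℍ[ℝ]) : Q.vq (Q.tgt α) 1 * Q.arr α x = Q.arr α x := by
  by_cases hx : x ∈ Q.arrowModule α
  · rw [Q.vq_mul_arr (one_mem _) hx, one_mul]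
  · rw [Q.arr_of_not_mem hx, mul_zero]

theorem arr_mul_one_vq (α : E) (x : ℍ[ℝ]) : Q.arr α x * Q.vq (Q.src α) 1 = Q.arr α x := by
  by_cases hx : x ∈ Q.arrowModule α
  · rw [Q.arr_mul_vq hx (one_mem _), mul_one]
  · rw [Q.arr_of_not_mem hx, zero_mul]

theorem sum_arr [Fintype E] (m : Q.ArrowBimodule) :
    ∑ α, Q.arr α (m α).1 = TensorRing.ofModule ℝ Q.BaseRing Q.ArrowBimodule m := by
  classical
  have : ∀ α, Q.arr α (m α).1 = TensorRing.ofModule ℝ Q.BaseRing Q.ArrowBimodule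
      (Q.inArrowBimodule α (m α)) := fun α => Q.arr_of_mem (m α).2
  simp only [this]
  rw [← map_sum]
  congr 1
  exact Finset.univ_sum_single (M := fun α => Q.arrowModule α) m

theorem tensorAlg_induction [Fintype V] [Finite E] {P : Q.TensorAlg → Prop}
    (hvq : ∀ v, ∀ x ∈ divSub (Q.mod v), P (Q.vq v x))
    (harr : ∀ α, ∀ x ∈ Q.arrowModule α, P (Q.arr α x)) (hzero : P 0)
    (hmul : ∀ s t, P s → P t → P (s * t)) (hadd : ∀ s t, P s → P t → P (s + t))
    (t : Q.TensorAlg) : P t := by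
  have := Fintype.ofFinite E
  -- Needed twice, because the sums over `V` and over `E` have index types in different universes.
  have hsum : ∀ {ι : Type _} (s : Finset ι) (f : ι → Q.TensorAlg), (∀ i, P (f i)) →
      P (∑ i ∈ s, f i) := fun s f h => Finset.sum_induction _ P hadd hzero fun i _ => h i
  have hsum' : ∀ {ι : Type _} (s : Finset ι) (f : ι → Q.TensorAlg), (∀ i, P (f i)) →
      P (∑ i ∈ s, f i) := fun s f h => Finset.sum_induction _ P hadd hzero fun i _ => h i
  induction t using TensorRing.induction with
  | hbase f =>
    rw [← Q.sum_vtx]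
    refine hsum _ _ fun v => ?_
    rw [← vq_toQuat]
    exact hvq v _ (toQuat_mem _ _)
  | hmodule m =>
    rw [← Q.sum_arr]
    exact hsum' _ _ fun α => harr α _ (m α).2
  | hmul s t hs ht => exact hmul s t hs ht
  | hadd s t hs ht => exact hadd s t hs ht

/-! ### The universal property of `T(Q, M)`. -/

section Lift

variable [Fintype V] [Fintype E] {R : Type*} [Ring R] [Algebra ℝ R]
  (ρ : V → ℍ[ℝ] →ₗ[ℝ] R) (g : E → ℍ[ℝ] →ₗ[ℝ] R)

/-- Linear maps on the division algebras and the bimodules which are compatible with the products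
define a homomorphism on `T(Q, M)`. -/
noncomputable def lift (hone : ∑ v, ρ v 1 = 1)
    (hmul : ∀ v, ∀ x ∈ divSub (Q.mod v), ∀ y ∈ divSub (Q.mod v), ρ v (x * y) = ρ v x * ρ v y)
    (hne : ∀ v v', v ≠ v' → ∀ x y, ρ v x * ρ v' y = 0)
    (hleft : ∀ α, ∀ c ∈ divSub (Q.mod (Q.tgt α)), ∀ x ∈ Q.arrowModule α,
      g α (c * x) = ρ (Q.tgt α) c * g α x)
    (hright : ∀ α, ∀ x ∈ Q.arrowModule α, ∀ c ∈ divSub (Q.mod (Q.src α)),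
      g α (x * c) = g α x * ρ (Q.src α) c) : Q.TensorAlg →ₐ[ℝ] R :=
  TensorRing.lift
    (AlgHom.ofLinearMap
      (∑ v, ρ v ∘ₗ (toQuat (Q.mod v)).toLinearMap ∘ₗ LinearMap.proj v)
      (by
        rw [← hone, LinearMap.sum_apply]
        exact Finset.sum_congr rfl fun v _ => congrArg (ρ v) (map_one (toQuat (Q.mod v))))
      (by
        intro a b
        simp only [LinearMap.sum_apply, LinearMap.comp_apply, LinearMap.proj_apply]
        rw [Finset.sum_mul_sum]
        refine Finset.sum_congr rfl fun v _ => ?_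
        rw [Finset.sum_eq_single v (fun v' _ h => hne _ _ h.symm _ _) (by simp)]
        change ρ v (toQuat _ (a v * b v)) = _
        rw [map_mul]
        exact hmul v _ (toQuat_mem _ _) _ (toQuat_mem _ _)))
    (∑ α, g α ∘ₗ (Q.arrowModule α).subtype ∘ₗ LinearMap.proj (φ := fun α => Q.arrowModule α) α)
    (by
      intro a m
      -- Compatibility with `1 ∈ M(t(α))` places the values of `g α` on the bimodule in the block of
      -- `t(α)`; only that vertex survives in the double sum.
      have hne' : ∀ v α, v ≠ Q.tgt α → ∀ x (y : Q.arrowModule α), ρ v x * g α y = 0 := by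
        intro v α h x y
        rw [← one_mul y.1, hleft α 1 (one_mem _) _ y.2, ← mul_assoc, hne _ _ h, zero_mul]
      simp only [LinearMap.sum_apply, LinearMap.comp_apply, LinearMap.proj_apply,
        AlgHom.ofLinearMap_apply]
      rw [Finset.sum_mul_sum, Finset.sum_comm]
      refine Finset.sum_congr rfl fun α _ => ?_
      refine Eq.trans ?_ (Finset.sum_eq_single (Q.tgt α) (fun v _ h => hne' v α h _ (m α))
        (by simp)).symm
      exact hleft α _ (toQuat_mem _ _) _ (m α).2)
    (by
      intro m a
      have hne' : ∀ v α, Q.src α ≠ v → ∀ x (y : Q.arrowModule α), g α y * ρ v x = 0 := by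
        intro v α h x y
        rw [← mul_one y.1, hright α _ y.2 1 (one_mem _), mul_assoc, hne _ _ h, mul_zero]
      simp only [LinearMap.sum_apply, LinearMap.comp_apply, LinearMap.proj_apply,
        AlgHom.ofLinearMap_apply]
      rw [Finset.sum_mul_sum]
      refine Finset.sum_congr rfl fun α _ => ?_
      refine Eq.trans ?_ (Finset.sum_eq_single (Q.src α) (fun v _ h => hne' v α h.symm _ (m α))
        (by simp)).symm
      exact hright α _ (m α).2 _ (toQuat_mem _ _))

variable {ρ g} (hone : ∑ v, ρ v 1 = 1)
    (hmul : ∀ v, ∀ x ∈ divSub (Q.mod v), ∀ y ∈ divSub (Q.mod v), ρ v (x * y) = ρ v x * ρ v y)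
    (hne : ∀ v v', v ≠ v' → ∀ x y, ρ v x * ρ v' y = 0)
    (hleft : ∀ α, ∀ c ∈ divSub (Q.mod (Q.tgt α)), ∀ x ∈ Q.arrowModule α,
      g α (c * x) = ρ (Q.tgt α) c * g α x)
    (hright : ∀ α, ∀ x ∈ Q.arrowModule α, ∀ c ∈ divSub (Q.mod (Q.src α)),
      g α (x * c) = g α x * ρ (Q.src α) c)

theorem lift_vq (v : V) {x : ℍ[ℝ]} (hx : x ∈ divSub (Q.mod v)) :
    Q.lift ρ g hone hmul hne hleft hright (Q.vq v x) = ρ v x := by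
  classical
  obtain ⟨d, rfl⟩ := hx
  change Q.lift ρ g hone hmul hne hleft hright (Q.vq v (toQuat _ d)) = ρ v (toQuat _ d)
  rw [vq_toQuat, vtx, lift, TensorRing.lift_ofBase]
  simp only [AlgHom.ofLinearMap_apply, LinearMap.sum_apply, LinearMap.comp_apply,
    LinearMap.proj_apply]
  rw [Finset.sum_eq_single v (fun v' _ h => by simp [Pi.single_eq_of_ne h]) (by simp)]
  simp

theorem lift_arr (α : E) {x : ℍ[ℝ]} (hx : x ∈ Q.arrowModule α) :
    Q.lift ρ g hone hmul hne hleft hright (Q.arr α x) = g α x := by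
  classical
  rw [Q.arr_of_mem hx, lift, TensorRing.lift_ofModule]
  simp only [LinearMap.sum_apply, LinearMap.comp_apply]
  change ∑ β, g β (Pi.single (M := fun α => Q.arrowModule α) α ⟨x, hx⟩ β).1 = _
  rw [Finset.sum_eq_single α (fun v' _ h => by simp [Pi.single_eq_of_ne h]) (by simp)]
  simp

end Lift

end ModulatedQuiver

/-! ## Quotients by two-sided ideals -/

namespace TwoSidedIdeal

variable {k A R : Type*} [CommRing k] [Ring A] [Algebra k A] [Ring R] [Algebra k R]

theorem eq_zero_of_mem_span {s : Set A} (f : A →+* R) (h : ∀ x ∈ s, f x = 0) {x : A}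
    (hx : x ∈ span s) : f x = 0 := by
  have : span s ≤ ker f := span_le.mpr fun y hy => (mem_ker f).mpr (h y hy)
  exact (mem_ker f).mp (this hx)

/-- A homomorphism which vanishes on an ideal, as a homomorphism on the quotient. -/
noncomputable def quotientLift (I : TwoSidedIdeal A) (f : A →ₐ[k] R) (h : ∀ x ∈ I, f x = 0) :
    I.ringCon.Quotient →ₐ[k] R :=
  I.ringCon.liftₐ f fun x y hxy => by
    have := h _ ((I.rel_iff x y).mp hxy)
    rw [map_sub, sub_eq_zero] at this
    exact this

/-- The quotient map. -/
noncomputable def quotientMk (k : Type*) {A : Type*} [CommRing k] [Ring A] [Algebra k A]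
    (I : TwoSidedIdeal A) : A →ₐ[k] I.ringCon.Quotient := I.ringCon.mkₐ k

@[simp] theorem quotientLift_mk (I : TwoSidedIdeal A) (f : A →ₐ[k] R) (h : ∀ x ∈ I, f x = 0)
    (x : A) : I.quotientLift f h (quotientMk k I x) = f x := rfl

theorem quotientMk_surjective (I : TwoSidedIdeal A) : Function.Surjective (quotientMk k I) :=
  RingCon.mk'_surjective _

theorem quotientMk_eq_zero (I : TwoSidedIdeal A) {x : A} : quotientMk k I x = 0 ↔ x ∈ I := by
  rw [mem_iff, ← map_zero (quotientMk k I)]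
  exact RingCon.eq I.ringCon

end TwoSidedIdeal

/-! ## Calculations in `ℂ_σ Q / ⟨S ∪ Z⟩` -/

namespace LoopQuiver

variable {V : Type u} {E : Type w} [Fintype V] (Q : LoopQuiver V E) (σ : E → (ℂ ≃ₐ[ℝ] ℂ))
  (Z : Set (List E))

/-- The quotient map from `ℂ_σ Q`. -/
noncomputable def quot : Q.PathAlg σ →ₐ[ℝ] Q.ClannishAlg σ Z := TwoSidedIdeal.quotientMk ℝ _

theorem gen_real (r : ℝ) : Q.gen σ (.scalar r) = algebraMap ℝ _ r := by
  have := RingQuot.mkAlgHom_rel ℝ (PathRel.scalar_real (Q := Q) (σ := σ) r)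
  rwa [AlgHom.commutes] at this

theorem gen_add (c d : ℂ) :
    Q.gen σ (.scalar (c + d)) = Q.gen σ (.scalar c) + Q.gen σ (.scalar d) := by
  have := RingQuot.mkAlgHom_rel ℝ (PathRel.scalar_add (Q := Q) (σ := σ) c d)
  rwa [map_add] at this

theorem gen_mul (c d : ℂ) :
    Q.gen σ (.scalar (c * d)) = Q.gen σ (.scalar c) * Q.gen σ (.scalar d) := by
  have := RingQuot.mkAlgHom_rel ℝ (PathRel.scalar_mul (Q := Q) (σ := σ) c d)
  rwa [map_mul] at this

/-- The scalars. -/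
noncomputable def sc : ℂ →ₐ[ℝ] Q.ClannishAlg σ Z where
  toFun c := Q.quot σ Z (Q.gen σ (.scalar c))
  map_one' := by
    have h := Q.gen_real σ 1
    rw [map_one, Complex.ofReal_one] at h
    rw [h, map_one]
  map_mul' c d := by rw [gen_mul, map_mul]
  map_zero' := by
    have h := Q.gen_real σ 0
    rw [map_zero, Complex.ofReal_zero] at h
    rw [h, map_zero]
  map_add' c d := by rw [gen_add, map_add]
  commutes' r := by
    change Q.quot σ Z (Q.gen σ (.scalar (r : ℂ))) = _
    rw [gen_real, AlgHom.commutes]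

/-- The idempotents. -/
noncomputable def ide (v : V) : Q.ClannishAlg σ Z := Q.quot σ Z (Q.gen σ (.idem v))

/-- The arrows. -/
noncomputable def arw (α : E) : Q.ClannishAlg σ Z := Q.quot σ Z (Q.gen σ (.arrow α))

theorem ide_mul_self (v : V) : Q.ide σ Z v * Q.ide σ Z v = Q.ide σ Z v := by
  have := RingQuot.mkAlgHom_rel ℝ (PathRel.idem_self (Q := Q) (σ := σ) v)
  rw [map_mul] at this
  rw [ide, ← map_mul]
  exact congrArg _ this

theorem ide_mul_ne {v v' : V} (h : v ≠ v') : Q.ide σ Z v * Q.ide σ Z v' = 0 := by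
  have := RingQuot.mkAlgHom_rel ℝ (PathRel.idem_ne (Q := Q) (σ := σ) v v' h)
  rw [map_mul, map_zero] at this
  rw [ide, ide, ← map_mul, ← map_zero (Q.quot σ Z)]
  exact congrArg _ this

theorem sum_ide : ∑ v, Q.ide σ Z v = 1 := by
  have := RingQuot.mkAlgHom_rel ℝ (PathRel.idem_sum (Q := Q) (σ := σ))
  rw [map_sum, map_one] at this
  simp only [ide]
  rw [← map_sum, ← map_one (Q.quot σ Z)]
  exact congrArg _ this

theorem ide_mul_arw (α : E) : Q.ide σ Z (Q.tgt α) * Q.arw σ Z α = Q.arw σ Z α := by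
  have := RingQuot.mkAlgHom_rel ℝ (PathRel.idem_arrow (Q := Q) (σ := σ) α)
  rw [map_mul] at this
  rw [ide, arw, ← map_mul]
  exact congrArg _ this

theorem arw_mul_ide (α : E) : Q.arw σ Z α * Q.ide σ Z (Q.src α) = Q.arw σ Z α := by
  have := RingQuot.mkAlgHom_rel ℝ (PathRel.arrow_idem (Q := Q) (σ := σ) α)
  rw [map_mul] at this
  rw [ide, arw, ← map_mul]
  exact congrArg _ this

theorem ide_mul_sc (v : V) (c : ℂ) :
    Q.ide σ Z v * Q.sc σ Z c = Q.sc σ Z c * Q.ide σ Z v := by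
  have := RingQuot.mkAlgHom_rel ℝ (PathRel.idem_scalar (Q := Q) (σ := σ) v c)
  rw [map_mul, map_mul] at this
  change Q.quot σ Z _ * Q.quot σ Z _ = Q.quot σ Z _ * Q.quot σ Z _
  rw [← map_mul, ← map_mul]
  exact congrArg _ this

theorem arw_mul_sc (α : E) (c : ℂ) :
    Q.arw σ Z α * Q.sc σ Z c = Q.sc σ Z (σ α c) * Q.arw σ Z α := by
  have := RingQuot.mkAlgHom_rel ℝ (PathRel.arrow_scalar (Q := Q) (σ := σ) α c)
  rw [map_mul, map_mul] at this
  change Q.quot σ Z _ * Q.quot σ Z _ = Q.quot σ Z _ * Q.quot σ Z _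
  rw [← map_mul, ← map_mul]
  exact congrArg _ this

theorem quot_eq_zero {x : Q.PathAlg σ} (hx : x ∈ Q.loopRel σ ∪ Q.zeroRel σ Z) :
    Q.quot σ Z x = 0 :=
  (TwoSidedIdeal.quotientMk_eq_zero _).mpr (TwoSidedIdeal.subset_span hx)

theorem loop_mul_self_real {s : E} (hs : s ∈ Q.loopsR) :
    Q.arw σ Z s * Q.arw σ Z s = Q.ide σ Z (Q.src s) := by
  have := Q.quot_eq_zero σ Z (Or.inl (Or.inl ⟨s, hs, rfl⟩))
  rwa [map_sub, sub_eq_zero, map_mul] at this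

theorem loop_mul_self_quat {s : E} (hs : s ∈ Q.loopsH) :
    Q.arw σ Z s * Q.arw σ Z s = - Q.ide σ Z (Q.src s) := by
  have := Q.quot_eq_zero σ Z (Or.inl (Or.inr ⟨s, hs, rfl⟩))
  rwa [map_add, add_eq_zero_iff_eq_neg, map_mul] at this

theorem prod_arw_eq_zero {l : List E} (hl : l ∈ Z) : (l.map (Q.arw σ Z)).prod = 0 := by
  have := Q.quot_eq_zero σ Z (Or.inr ⟨l, hl, rfl⟩)
  rwa [map_list_prod, List.map_map] at this

variable {σ Z} in
theorem clannish_induction {P : Q.ClannishAlg σ Z → Prop} (hsc : ∀ c, P (Q.sc σ Z c))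
    (hide : ∀ v, P (Q.ide σ Z v)) (harw : ∀ α, P (Q.arw σ Z α))
    (hmul : ∀ s t, P s → P t → P (s * t)) (hadd : ∀ s t, P s → P t → P (s + t))
    (t : Q.ClannishAlg σ Z) : P t := by
  obtain ⟨t, rfl⟩ := TwoSidedIdeal.quotientMk_surjective (k := ℝ) _ t
  obtain ⟨t, rfl⟩ := RingQuot.mkAlgHom_surjective ℝ (Q.PathRel σ) t
  induction t using FreeAlgebra.induction with
  | grade0 r =>
    rw [AlgHom.commutes, AlgHom.commutes]
    have := hsc r
    rwa [show (r : ℂ) = algebraMap ℝ ℂ r from rfl, AlgHom.commutes] at this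
  | grade1 x =>
    cases x with
    | scalar c => exact hsc c
    | idem v => exact hide v
    | arrow α => exact harw α
  | mul s t hs ht => rw [map_mul, map_mul]; exact hmul _ _ hs ht
  | add s t hs ht => rw [map_add, map_add]; exact hadd _ _ hs ht

section Lift

variable {R : Type*} [Ring R] [Algebra ℝ R] (f : ℂ →ₐ[ℝ] R) (e : V → R) (a : E → R)

/-- The universal property of `ℂ_σ Q`. -/
noncomputable def pathLift (hself : ∀ v, e v * e v = e v) (hne : ∀ v v', v ≠ v' → e v * e v' = 0)
    (hsum : ∑ v, e v = 1) (htgt : ∀ α, e (Q.tgt α) * a α = a α)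
    (hsrc : ∀ α, a α * e (Q.src α) = a α) (hef : ∀ v c, e v * f c = f c * e v)
    (haf : ∀ α c, a α * f c = f (σ α c) * a α) : Q.PathAlg σ →ₐ[ℝ] R :=
  RingQuot.liftAlgHom ℝ ⟨FreeAlgebra.lift ℝ fun x => match x with
    | .scalar c => f c
    | .idem v => e v
    | .arrow α => a α, by
    intro x y h
    cases h with
    | scalar_real r =>
      simp only [FreeAlgebra.lift_ι_apply, AlgHom.commutes]
      exact f.commutes r
    | scalar_add c d => simp
    | scalar_mul c d => simp
    | idem_self v => simp [hself]
    | idem_ne v v' h => simp [hne v v' h]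
    | idem_sum => simp [hsum]
    | idem_arrow α => simp [htgt]
    | arrow_idem α => simp [hsrc]
    | idem_scalar v c => simp [hef]
    | arrow_scalar α c => simp [haf]⟩

variable {σ Z f e a} {hself : ∀ v, e v * e v = e v} {hne : ∀ v v', v ≠ v' → e v * e v' = 0}
    {hsum : ∑ v, e v = 1} {htgt : ∀ α, e (Q.tgt α) * a α = a α}
    {hsrc : ∀ α, a α * e (Q.src α) = a α} {hef : ∀ v c, e v * f c = f c * e v}
    {haf : ∀ α c, a α * f c = f (σ α c) * a α}

theorem pathLift_scalar (c : ℂ) :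
    Q.pathLift σ f e a hself hne hsum htgt hsrc hef haf (Q.gen σ (.scalar c)) = f c := by
  simp [pathLift, gen]

theorem pathLift_idem (v : V) :
    Q.pathLift σ f e a hself hne hsum htgt hsrc hef haf (Q.gen σ (.idem v)) = e v := by
  simp [pathLift, gen]

theorem pathLift_arrow (α : E) :
    Q.pathLift σ f e a hself hne hsum htgt hsrc hef haf (Q.gen σ (.arrow α)) = a α := by
  simp [pathLift, gen]

/-- The universal property of `ℂ_σ Q / ⟨S ∪ Z⟩`. -/
theorem exists_lift (hself : ∀ v, e v * e v = e v) (hne : ∀ v v', v ≠ v' → e v * e v' = 0)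
    (hsum : ∑ v, e v = 1) (htgt : ∀ α, e (Q.tgt α) * a α = a α)
    (hsrc : ∀ α, a α * e (Q.src α) = a α) (hef : ∀ v c, e v * f c = f c * e v)
    (haf : ∀ α c, a α * f c = f (σ α c) * a α)
    (hR : ∀ s ∈ Q.loopsR, a s * a s = e (Q.src s))
    (hH : ∀ s ∈ Q.loopsH, a s * a s = - e (Q.src s))
    (hZ : ∀ l ∈ Z, (l.map a).prod = 0) :
    ∃ F : Q.ClannishAlg σ Z →ₐ[ℝ] R, (∀ c, F (Q.sc σ Z c) = f c) ∧ (∀ v, F (Q.ide σ Z v) = e v) ∧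
      ∀ α, F (Q.arw σ Z α) = a α := by
  refine ⟨TwoSidedIdeal.quotientLift _ (Q.pathLift σ f e a hself hne hsum htgt hsrc hef haf)
    fun x hx => TwoSidedIdeal.eq_zero_of_mem_span
      (Q.pathLift σ f e a hself hne hsum htgt hsrc hef haf).toRingHom ?_ hx, fun c => ?_,
      fun v => ?_, fun α => ?_⟩
  · rintro x ((⟨s, hs, rfl⟩ | ⟨s, hs, rfl⟩) | ⟨l, hl, rfl⟩)
    · change Q.pathLift σ f e a hself hne hsum htgt hsrc hef haf _ = 0
      rw [map_sub, map_mul, pathLift_arrow, pathLift_idem, hR s hs, sub_self]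
    · change Q.pathLift σ f e a hself hne hsum htgt hsrc hef haf _ = 0
      rw [map_add, map_mul, pathLift_arrow, pathLift_idem, hH s hs, neg_add_cancel]
    · change Q.pathLift σ f e a hself hne hsum htgt hsrc hef haf _ = 0
      rw [map_list_prod, List.map_map, ← hZ l hl]
      congr 2
      funext α
      exact Q.pathLift_arrow α
  · exact (TwoSidedIdeal.quotientLift_mk _ _ _ _).trans (Q.pathLift_scalar c)
  · exact (TwoSidedIdeal.quotientLift_mk _ _ _ _).trans (Q.pathLift_idem v)
  · exact (TwoSidedIdeal.quotientLift_mk _ _ _ _).trans (Q.pathLift_arrow α)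

end Lift

theorem hom_ext {σ : E → (ℂ ≃ₐ[ℝ] ℂ)} {Z : Set (List E)} {R : Type*} [Ring R] [Algebra ℝ R]
    {F G : Q.ClannishAlg σ Z →ₐ[ℝ] R} (hsc : ∀ c, F (Q.sc σ Z c) = G (Q.sc σ Z c))
    (hide : ∀ v, F (Q.ide σ Z v) = G (Q.ide σ Z v))
    (harw : ∀ α, F (Q.arw σ Z α) = G (Q.arw σ Z α)) : F = G := by
  refine AlgHom.ext fun t => ?_
  induction t using Q.clannish_induction with
  | hsc c => exact hsc c
  | hide v => exact hide v
  | harw α => exact harw α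
  | hmul s t hs ht => rw [map_mul, map_mul, hs, ht]
  | hadd s t hs ht => rw [map_add, map_add, hs, ht]

end LoopQuiver

/-! ## Calculations in `ℂ_{σ'} Q^s / ⟨S ∪ Z⟩` -/

namespace ModulatedQuiver

variable {V : Type u} {E : Type w} (Q : ModulatedQuiver V E) (L : Set E)

open scoped Classical in
/-- The arrow `γ` for an arrow `γⁱ`, and `γ` itself for an ordinary arrow `γ`. -/
noncomputable def base (α : E) : E :=
  if h : α ∈ L ∧ ∃ γ, γ ∉ L ∧ Q.src γ = Q.src α ∧ Q.tgt γ = Q.tgt α then h.2.choose else α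

theorem src_base (α : E) : Q.src (Q.base L α) = Q.src α := by
  unfold base
  split_ifs with h
  · exact h.2.choose_spec.2.1
  · rfl

theorem tgt_base (α : E) : Q.tgt (Q.base L α) = Q.tgt α := by
  unfold base
  split_ifs with h
  · exact h.2.choose_spec.2.2
  · rfl

variable {Q L} in
theorem base_of_not_mem {α : E} (h : α ∉ L) : Q.base L α = α := dif_neg fun h' => h h'.1

variable {Q L} in
theorem base_not_mem (hL : Q.IsLabelling L) (α : E) : Q.base L α ∉ L := by
  unfold base
  split_ifs with h
  · exact h.2.choose_spec.1
  · intro hα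
    exact h ⟨hα, hL.partner α hα⟩

variable [Fintype V] (Z : Set (List (Q.SArrow L)))

/-- The algebra `ℂ_{σ'} Q^s / ⟨S ∪ Z⟩`. -/
abbrev SAlg : Type (max u w) := (Q.sQuiver L).ClannishAlg (Q.twist' L) Z

/-- The scalars. -/
noncomputable abbrev scal : ℂ →ₐ[ℝ] Q.SAlg L Z := (Q.sQuiver L).sc (Q.twist' L) Z

/-- The idempotents. -/
noncomputable abbrev idem (v : V) : Q.SAlg L Z := (Q.sQuiver L).ide (Q.twist' L) Z v

open scoped Classical in
/-- The special loops, or `0` if there is none at the vertex. -/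
noncomputable def loop (v : V) : Q.SAlg L Z :=
  if h : Q.mod v ≠ .cplx then (Q.sQuiver L).arw (Q.twist' L) Z (.inr ⟨v, h⟩) else 0

open scoped Classical in
/-- The ordinary arrow `γ` for `γ` and for `γⁱ`. -/
noncomputable def ord (α : E) : Q.SAlg L Z :=
  if h : Q.base L α ∉ L then (Q.sQuiver L).arw (Q.twist' L) Z (.inl ⟨Q.base L α, h⟩) else 0

theorem loop_of_ne {v : V} (h : Q.mod v ≠ .cplx) :
    Q.loop L Z v = (Q.sQuiver L).arw (Q.twist' L) Z (.inr ⟨v, h⟩) := dif_pos h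

theorem loop_of_cplx {v : V} (h : Q.mod v = .cplx) : Q.loop L Z v = 0 := dif_neg (not_not.mpr h)

variable {L Z} in
theorem ord_of_not_mem {α : E} (h : α ∉ L) :
    Q.ord L Z α = (Q.sQuiver L).arw (Q.twist' L) Z (.inl ⟨α, h⟩) := by
  unfold ord
  have h' := base_of_not_mem (Q := Q) h
  rw [dif_pos (by rwa [h'])]
  congr 3

theorem idem_mul_loop (v : V) : Q.idem L Z v * Q.loop L Z v = Q.loop L Z v := by
  by_cases h : Q.mod v = .cplx
  · rw [Q.loop_of_cplx L Z h, mul_zero]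
  · rw [Q.loop_of_ne L Z h]
    exact (Q.sQuiver L).ide_mul_arw _ Z (.inr ⟨v, h⟩)

theorem loop_mul_idem (v : V) : Q.loop L Z v * Q.idem L Z v = Q.loop L Z v := by
  by_cases h : Q.mod v = .cplx
  · rw [Q.loop_of_cplx L Z h, zero_mul]
  · rw [Q.loop_of_ne L Z h]
    exact (Q.sQuiver L).arw_mul_ide _ Z (.inr ⟨v, h⟩)

theorem loop_mul_scal (v : V) (c : ℂ) :
    Q.loop L Z v * Q.scal L Z c = Q.scal L Z (starRingEnd ℂ c) * Q.loop L Z v := by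
  by_cases h : Q.mod v = .cplx
  · rw [Q.loop_of_cplx L Z h, zero_mul, mul_zero]
  · rw [Q.loop_of_ne L Z h]
    exact (Q.sQuiver L).arw_mul_sc _ Z (.inr ⟨v, h⟩) c

theorem loop_mul_loop_real {v : V} (h : Q.mod v = .real) :
    Q.loop L Z v * Q.loop L Z v = Q.idem L Z v := by
  have h' : Q.mod v ≠ .cplx := by simp [h]
  rw [Q.loop_of_ne L Z h']
  exact (Q.sQuiver L).loop_mul_self_real _ Z ⟨⟨v, h'⟩, rfl, h⟩

theorem loop_mul_loop_quat {v : V} (h : Q.mod v = .quat) :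
    Q.loop L Z v * Q.loop L Z v = - Q.idem L Z v := by
  have h' : Q.mod v ≠ .cplx := by simp [h]
  rw [Q.loop_of_ne L Z h']
  exact (Q.sQuiver L).loop_mul_self_quat _ Z ⟨⟨v, h'⟩, rfl, h⟩

theorem idem_mul_ord (α : E) : Q.idem L Z (Q.tgt α) * Q.ord L Z α = Q.ord L Z α := by
  unfold ord
  split_ifs with h
  · rw [mul_zero]
  · rw [← Q.tgt_base L α]
    exact (Q.sQuiver L).ide_mul_arw _ Z (.inl ⟨_, h⟩)

theorem ord_mul_idem (α : E) : Q.ord L Z α * Q.idem L Z (Q.src α) = Q.ord L Z α := by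
  unfold ord
  split_ifs with h
  · rw [zero_mul]
  · rw [← Q.src_base L α]
    exact (Q.sQuiver L).arw_mul_ide _ Z (.inl ⟨_, h⟩)

/-- On ordinary arrows `σ'` is nontrivial only between two vertices with `ℂ`, and passing from `γⁱ`
to `γ` does not change the ends. -/
theorem ord_mul_scal {α : E} (h : ¬ (Q.mod (Q.src α) = .cplx ∧ Q.mod (Q.tgt α) = .cplx)) (c : ℂ) :
    Q.ord L Z α * Q.scal L Z c = Q.scal L Z c * Q.ord L Z α := by
  unfold ord
  split_ifs with h'
  · rw [mul_zero, zero_mul]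
  · have := (Q.sQuiver L).arw_mul_sc (Q.twist' L) Z (.inl ⟨_, h'⟩) c
    have ht : Q.twist' L (.inl ⟨_, h'⟩) = 1 := by
      refine if_neg fun h1 => h ⟨?_, ?_⟩
      · rw [← Q.src_base L α]
        exact h1.1
      · rw [← Q.tgt_base L α]
        exact h1.2.1
    rw [ht] at this
    exact this

open scoped Classical in
theorem ord_mul_scal_cplx {α : E} (hα : α ∉ L)
    (h : Q.mod (Q.src α) = .cplx ∧ Q.mod (Q.tgt α) = .cplx) (c : ℂ) :
    Q.ord L Z α * Q.scal L Z c =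
      Q.scal L Z (if Q.bar α then starRingEnd ℂ c else c) * Q.ord L Z α := by
  rw [Q.ord_of_not_mem hα]
  have := (Q.sQuiver L).arw_mul_sc (Q.twist' L) Z (.inl ⟨α, hα⟩) c
  rw [this]
  congr 2
  simp only [twist', h, true_and]
  split_ifs <;> rfl

theorem idem_mul_scal (v : V) (c : ℂ) :
    Q.idem L Z v * Q.scal L Z c = Q.scal L Z c * Q.idem L Z v := (Q.sQuiver L).ide_mul_sc _ _ v c

theorem idem_mul_idem (v : V) : Q.idem L Z v * Q.idem L Z v = Q.idem L Z v :=
  (Q.sQuiver L).ide_mul_self _ _ v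

theorem idem_mul_idem_of_ne {v v' : V} (h : v ≠ v') : Q.idem L Z v * Q.idem L Z v' = 0 :=
  (Q.sQuiver L).ide_mul_ne _ _ h

theorem scal_real (r : ℝ) (x : Q.SAlg L Z) : Q.scal L Z (r : ℂ) * x = r • x := by
  rw [show (r : ℂ) = algebraMap ℝ ℂ r from rfl, AlgHom.commutes, Algebra.smul_def]

end ModulatedQuiver

/-- The first component of a quaternion `z + w k` with `z, w ∈ ℂ`. -/
def fstC (x : ℍ[ℝ]) : ℂ := ⟨x.re, x.imI⟩

/-- The second component of a quaternion `z + w k` with `z, w ∈ ℂ`. -/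
def sndC (x : ℍ[ℝ]) : ℂ := ⟨x.imJ, x.imK⟩

theorem fstC_add (x y : ℍ[ℝ]) : fstC (x + y) = fstC x + fstC y := rfl
theorem sndC_add (x y : ℍ[ℝ]) : sndC (x + y) = sndC x + sndC y := rfl
theorem fstC_smul (r : ℝ) (x : ℍ[ℝ]) : fstC (r • x) = r • fstC x := by
  apply Complex.ext <;> simp [fstC]
theorem sndC_smul (r : ℝ) (x : ℍ[ℝ]) : sndC (r • x) = r • sndC x := by
  apply Complex.ext <;> simp [sndC]
-- Both product formulas express `k c = c̄ k` and `k² = -1` for `c ∈ ℂ`.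
theorem fstC_mul (x y : ℍ[ℝ]) :
    fstC (x * y) = fstC x * fstC y - sndC x * starRingEnd ℂ (sndC y) := by
  apply Complex.ext <;> simp [fstC, sndC] <;> ring
theorem sndC_mul (x y : ℍ[ℝ]) :
    sndC (x * y) = fstC x * sndC y + sndC x * starRingEnd ℂ (fstC y) := by
  apply Complex.ext <;> simp [fstC, sndC] <;> ring
theorem sndC_of_mem {x : ℍ[ℝ]} (hx : x ∈ divSub .cplx) : sndC x = 0 := by
  rw [mem_divSub_cplx] at hx
  exact Complex.ext hx.1 hx.2
theorem sndC_of_mem_real {x : ℍ[ℝ]} (hx : x ∈ divSub .real) : sndC x = 0 := by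
  rw [mem_divSub_real] at hx
  exact Complex.ext hx.2.1 hx.2.2
theorem fstC_of_mem_real {x : ℍ[ℝ]} (hx : x ∈ divSub .real) : fstC x = (x.re : ℂ) := by
  rw [mem_divSub_real] at hx
  exact Complex.ext rfl hx.1

/-! ### The quaternion map `kap` and the idempotents `ε_v`. -/

namespace ModulatedQuiver

variable {V : Type u} {E : Type w} (Q : ModulatedQuiver V E) (L : Set E)
  [Fintype V] (Z : Set (List (Q.SArrow L)))

/-- The map `z + w k ↦ z e_v + w s_v`. -/
noncomputable def kap (v : V) : ℍ[ℝ] →ₗ[ℝ] Q.SAlg L Z where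
  toFun x := Q.scal L Z (fstC x) * Q.idem L Z v + Q.scal L Z (sndC x) * Q.loop L Z v
  map_add' x y := by
    rw [fstC_add, sndC_add, map_add, map_add]
    noncomm_ring
  map_smul' r x := by
    rw [fstC_smul, sndC_smul, map_smul, map_smul]
    simp [smul_add]

theorem kap_apply (v : V) (x : ℍ[ℝ]) : Q.kap L Z v x =
    Q.scal L Z (fstC x) * Q.idem L Z v + Q.scal L Z (sndC x) * Q.loop L Z v := rfl

theorem kap_of_cplx (v : V) {x : ℍ[ℝ]} (hx : x ∈ divSub .cplx) :
    Q.kap L Z v x = Q.scal L Z (fstC x) * Q.idem L Z v := by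
  rw [kap_apply, sndC_of_mem hx, map_zero, zero_mul, add_zero]

theorem kap_of_real (v : V) {x : ℍ[ℝ]} (hx : x ∈ divSub .real) :
    Q.kap L Z v x = x.re • Q.idem L Z v := by
  rw [kap_apply, sndC_of_mem_real hx, map_zero, zero_mul, add_zero, fstC_of_mem_real hx, scal_real]

theorem kap_one (v : V) : Q.kap L Z v 1 = Q.idem L Z v := by
  rw [Q.kap_of_real L Z v (one_mem _)]
  simp

theorem idem_mul_kap (v : V) (x : ℍ[ℝ]) : Q.idem L Z v * Q.kap L Z v x = Q.kap L Z v x := by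
  rw [kap_apply, mul_add, ← mul_assoc, ← mul_assoc, idem_mul_scal, idem_mul_scal, mul_assoc,
    mul_assoc, idem_mul_idem, idem_mul_loop]

theorem kap_mul_idem (v : V) (x : ℍ[ℝ]) : Q.kap L Z v x * Q.idem L Z v = Q.kap L Z v x := by
  rw [kap_apply, add_mul, mul_assoc, mul_assoc, idem_mul_idem, loop_mul_idem]

/-- With one factor in `ℂ` the square of `s_v` never occurs, so this holds at every vertex, whatever
the sign of `s_v²`. -/
theorem kap_mul_of_left (v : V) {x : ℍ[ℝ]} (hx : x ∈ divSub .cplx) (y : ℍ[ℝ]) :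
    Q.kap L Z v (x * y) = Q.kap L Z v x * Q.kap L Z v y := by
  rw [Q.kap_of_cplx L Z v hx, mul_assoc, idem_mul_kap, kap_apply, kap_apply, fstC_mul, sndC_mul,
    sndC_of_mem hx]
  simp only [zero_mul, sub_zero, add_zero, map_mul]
  noncomm_ring

theorem kap_mul_of_right (v : V) (x : ℍ[ℝ]) {y : ℍ[ℝ]} (hy : y ∈ divSub .cplx) :
    Q.kap L Z v (x * y) = Q.kap L Z v x * Q.kap L Z v y := by
  rw [Q.kap_of_cplx L Z v hy, kap_apply, kap_apply, fstC_mul, sndC_mul, sndC_of_mem hy]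
  simp only [map_zero, mul_zero, sub_zero, zero_add, map_mul, add_mul]
  rw [mul_assoc (Q.scal L Z (fstC x)) (Q.idem L Z v), ← mul_assoc (Q.idem L Z v), idem_mul_scal,
    mul_assoc (Q.scal L Z (sndC x)) (Q.loop L Z v), ← mul_assoc (Q.loop L Z v), loop_mul_scal,
    mul_assoc _ (Q.idem L Z v) (Q.idem L Z v), idem_mul_idem, mul_assoc _ (Q.loop L Z v),
    loop_mul_idem]
  simp only [mul_assoc]

/-- At a vertex with `ℍ` the loop satisfies `s_v c = c̄ s_v` and `s_v² = -e_v`, the relations of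
`k`. -/
theorem kap_mul_quat {v : V} (hv : Q.mod v = .quat) (x y : ℍ[ℝ]) :
    Q.kap L Z v (x * y) = Q.kap L Z v x * Q.kap L Z v y := by
  have h1 : ∀ c d, Q.scal L Z c * Q.idem L Z v * (Q.scal L Z d * Q.idem L Z v) =
      Q.scal L Z (c * d) * Q.idem L Z v := fun c d => by
    rw [mul_assoc, ← mul_assoc (Q.idem L Z v), idem_mul_scal, mul_assoc _ (Q.idem L Z v),
      idem_mul_idem, ← mul_assoc, ← map_mul]
  have h2 : ∀ c d, Q.scal L Z c * Q.idem L Z v * (Q.scal L Z d * Q.loop L Z v) =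
      Q.scal L Z (c * d) * Q.loop L Z v := fun c d => by
    rw [mul_assoc, ← mul_assoc (Q.idem L Z v), idem_mul_scal, mul_assoc _ (Q.idem L Z v),
      idem_mul_loop, ← mul_assoc, ← map_mul]
  have h3 : ∀ c d, Q.scal L Z c * Q.loop L Z v * (Q.scal L Z d * Q.idem L Z v) =
      Q.scal L Z (c * starRingEnd ℂ d) * Q.loop L Z v := fun c d => by
    rw [mul_assoc, ← mul_assoc (Q.loop L Z v), loop_mul_scal, mul_assoc _ (Q.loop L Z v),
      loop_mul_idem, ← mul_assoc, ← map_mul]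
  have h4 : ∀ c d, Q.scal L Z c * Q.loop L Z v * (Q.scal L Z d * Q.loop L Z v) =
      - (Q.scal L Z (c * starRingEnd ℂ d) * Q.idem L Z v) := fun c d => by
    rw [mul_assoc, ← mul_assoc (Q.loop L Z v), loop_mul_scal, mul_assoc _ (Q.loop L Z v),
      Q.loop_mul_loop_quat L Z hv, mul_neg, mul_neg, ← mul_assoc, ← map_mul]
  rw [kap_apply, kap_apply, kap_apply, add_mul, mul_add, mul_add, h1, h2, h3, h4, fstC_mul,
    sndC_mul, map_sub, map_add]
  noncomm_ring

theorem cplx_of_real {x : ℍ[ℝ]} (hx : x ∈ divSub .real) : x ∈ divSub .cplx := by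
  rw [mem_divSub_real] at hx
  rw [mem_divSub_cplx]
  exact hx.2

theorem kap_mul {v : V} {x : ℍ[ℝ]} (hx : x ∈ divSub (Q.mod v)) (y : ℍ[ℝ]) :
    Q.kap L Z v (x * y) = Q.kap L Z v x * Q.kap L Z v y := by
  cases h : Q.mod v <;> rw [h] at hx
  · exact Q.kap_mul_of_left L Z v (cplx_of_real hx) y
  · exact Q.kap_mul_of_left L Z v hx y
  · exact Q.kap_mul_quat L Z h x y

theorem kap_mul' {v : V} (x : ℍ[ℝ]) {y : ℍ[ℝ]} (hy : y ∈ divSub (Q.mod v)) :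
    Q.kap L Z v (x * y) = Q.kap L Z v x * Q.kap L Z v y := by
  cases h : Q.mod v <;> rw [h] at hy
  · exact Q.kap_mul_of_right L Z v x (cplx_of_real hy)
  · exact Q.kap_mul_of_right L Z v x hy
  · exact Q.kap_mul_quat L Z h x y

/-- The idempotent `ε_v`, equal to `(1 + s_v) / 2` if `M(v) = ℝ` and to `e_v` otherwise. -/
noncomputable def eps (v : V) : Q.SAlg L Z :=
  match Q.mod v with
  | .real => (2⁻¹ : ℝ) • (Q.idem L Z v + Q.loop L Z v)
  | _ => Q.idem L Z v

theorem eps_real {v : V} (h : Q.mod v = .real) :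
    Q.eps L Z v = (2⁻¹ : ℝ) • (Q.idem L Z v + Q.loop L Z v) := by
  unfold eps; rw [h]

theorem eps_of_ne {v : V} (h : Q.mod v ≠ .real) : Q.eps L Z v = Q.idem L Z v := by
  unfold eps
  cases h' : Q.mod v
  · exact absurd h' h
  · rfl
  · rfl

theorem idem_mul_eps (v : V) : Q.idem L Z v * Q.eps L Z v = Q.eps L Z v := by
  by_cases h : Q.mod v = .real
  · rw [Q.eps_real L Z h, mul_smul_comm, mul_add, idem_mul_idem, idem_mul_loop]
  · rw [Q.eps_of_ne L Z h, idem_mul_idem]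

theorem eps_mul_idem (v : V) : Q.eps L Z v * Q.idem L Z v = Q.eps L Z v := by
  by_cases h : Q.mod v = .real
  · rw [Q.eps_real L Z h, smul_mul_assoc, add_mul, idem_mul_idem, loop_mul_idem]
  · rw [Q.eps_of_ne L Z h, idem_mul_idem]

theorem eps_mul_eps (v : V) : Q.eps L Z v * Q.eps L Z v = Q.eps L Z v := by
  by_cases h : Q.mod v = .real
  · rw [Q.eps_real L Z h, smul_mul_smul_comm, add_mul, mul_add, mul_add, idem_mul_idem,
      idem_mul_loop, loop_mul_idem, Q.loop_mul_loop_real L Z h]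
    module
  · rw [Q.eps_of_ne L Z h, idem_mul_idem]

theorem eps_mul_eps_of_ne {v v' : V} (h : v ≠ v') : Q.eps L Z v * Q.eps L Z v' = 0 := by
  rw [← Q.eps_mul_idem L Z v, ← Q.idem_mul_eps L Z v', mul_assoc, ← mul_assoc (Q.idem L Z v),
    Q.idem_mul_idem_of_ne L Z h, zero_mul, mul_zero]

/-- At a vertex with `ℝ` only real scalars are involved; conjugation by `i` would turn `ε_v` into
`e_v - ε_v`. Elsewhere `ε_v = e_v`. -/
theorem kap_mul_eps {v : V} {x : ℍ[ℝ]} (hx : x ∈ divSub (Q.mod v)) :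
    Q.kap L Z v x * Q.eps L Z v = Q.eps L Z v * Q.kap L Z v x := by
  by_cases h : Q.mod v = .real
  · rw [h] at hx
    rw [Q.kap_of_real L Z v hx, smul_mul_assoc, mul_smul_comm, idem_mul_eps, eps_mul_idem]
  · rw [Q.eps_of_ne L Z h, idem_mul_kap, kap_mul_idem]

/-- The idempotent `ε`, the sum of the `ε_v`. -/
noncomputable def epsSum : Q.SAlg L Z := ∑ v, Q.eps L Z v

theorem epsSum_mul {v : V} {x : Q.SAlg L Z} (hx : Q.eps L Z v * x = x) :
    Q.epsSum L Z * x = x := by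
  rw [epsSum, Finset.sum_mul, Finset.sum_eq_single v, hx]
  · intro v' _ h
    rw [← hx, ← mul_assoc, Q.eps_mul_eps_of_ne L Z h, zero_mul]
  · simp

theorem mul_epsSum {v : V} {x : Q.SAlg L Z} (hx : x * Q.eps L Z v = x) :
    x * Q.epsSum L Z = x := by
  rw [epsSum, Finset.mul_sum, Finset.sum_eq_single v, hx]
  · intro v' _ h
    rw [← hx, mul_assoc, Q.eps_mul_eps_of_ne L Z h.symm, mul_zero]
  · simp

theorem isIdempotentElem_epsSum : IsIdempotentElem (Q.epsSum L Z) := by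
  unfold IsIdempotentElem
  conv_lhs => rw [epsSum, Finset.sum_mul]
  rw [epsSum]
  exact Finset.sum_congr rfl fun v _ => Q.mul_epsSum L Z (Q.eps_mul_eps L Z v)

end ModulatedQuiver

/-! ## The homomorphism from `T(Q, M)` to the corner of `ℂ_{σ'} Q^s / ⟨S ∪ Z⟩` -/

@[simp] theorem qj_re : qj.re = 0 := rfl
@[simp] theorem qj_imI : qj.imI = 1 := rfl
@[simp] theorem qj_imJ : qj.imJ = 0 := rfl
@[simp] theorem qj_imK : qj.imK = 0 := rfl
@[simp] theorem qk_re : qk.re = 0 := rfl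
@[simp] theorem qk_imI : qk.imI = 0 := rfl
@[simp] theorem qk_imJ : qk.imJ = 1 := rfl
@[simp] theorem qk_imK : qk.imK = 0 := rfl
@[simp] theorem ql_re : ql.re = 0 := rfl
@[simp] theorem ql_imI : ql.imI = 0 := rfl
@[simp] theorem ql_imJ : ql.imJ = 0 := rfl
@[simp] theorem ql_imK : ql.imK = 1 := rfl

namespace ModulatedQuiver

variable {V : Type u} {E : Type w} (Q : ModulatedQuiver V E) (L : Set E)

theorem mem_arrowModule {α : E} {q : ℍ[ℝ]} {D D' : DivKind} (ht : Q.mod (Q.tgt α) = D)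
    (hs : Q.mod (Q.src α) = D') : q ∈ Q.arrowModule α ↔ q ∈ simpleBimodule D D' (Q.bar α) := by
  rw [arrowModule, ht, hs]

variable [Fintype V] (Z : Set (List (Q.SArrow L)))

open scoped Classical in
/-- The element of `ℂ_{σ'} Q^s / ⟨S ∪ Z⟩` which generates the image of `M(α)`. -/
noncomputable def core (α : E) : Q.SAlg L Z :=
  -- Between two `ℍ`, the elements `α - sαs` and `i(α + sαs)` commute with `ℂ` and with the loops
  -- (`core_mul_kap`), so they generate two copies of `ℍ`. Between two `ℝ`, the elements `ε α ε` and
  -- `ε i α ε` play the same role. The sign `-1` in the cores of the `γⁱ` matches the choice of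
  -- generators of the `I_v^p`.
  match Q.mod (Q.tgt α), Q.mod (Q.src α) with
  | .quat, .quat =>
      if α ∈ L then - (Q.scal L Z Complex.I * (Q.ord L Z α +
        Q.loop L Z (Q.tgt α) * Q.ord L Z α * Q.loop L Z (Q.src α)))
      else Q.ord L Z α - Q.loop L Z (Q.tgt α) * Q.ord L Z α * Q.loop L Z (Q.src α)
  | .real, .real =>
      if α ∈ L then
        - (Q.eps L Z (Q.tgt α) * (Q.scal L Z Complex.I * Q.ord L Z α) * Q.eps L Z (Q.src α))
      else Q.eps L Z (Q.tgt α) * Q.ord L Z α * Q.eps L Z (Q.src α)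
  | _, _ => Q.eps L Z (Q.tgt α) * Q.ord L Z α * Q.eps L Z (Q.src α)

open scoped Classical in
/-- The map from `M(α)` to `ℂ_{σ'} Q^s / ⟨S ∪ Z⟩`. -/
noncomputable def arrowMap (α : E) : ℍ[ℝ] →ₗ[ℝ] Q.SAlg L Z :=
  -- The coefficient is put on the side whose division algebra contains the other one.
  match Q.mod (Q.tgt α), Q.mod (Q.src α) with
  | .real, _ => LinearMap.mulLeft ℝ (Q.core L Z α) ∘ₗ Q.kap L Z (Q.src α)
  | .cplx, .quat => LinearMap.mulLeft ℝ (Q.core L Z α) ∘ₗ Q.kap L Z (Q.src α)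
  | .cplx, .cplx =>
      LinearMap.mulRight ℝ (Q.core L Z α) ∘ₗ Q.kap L Z (Q.tgt α) ∘ₗ
        -- Here `x` lies in `ℂ k`, and `x * -qk` is its coefficient in `ℂ`, because `k * (-k) = 1`.
        (if Q.bar α then LinearMap.mulRight ℝ (-qk) else LinearMap.id)
  | _, _ => LinearMap.mulRight ℝ (Q.core L Z α) ∘ₗ Q.kap L Z (Q.tgt α)

section Cases

variable {α : E}

theorem core_of_ne (h : Q.mod (Q.tgt α) = Q.mod (Q.src α) → Q.mod (Q.src α) = .cplx) :
    Q.core L Z α = Q.eps L Z (Q.tgt α) * Q.ord L Z α * Q.eps L Z (Q.src α) := by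
  unfold core
  cases ht : Q.mod (Q.tgt α) <;> cases hs : Q.mod (Q.src α) <;> simp_all

theorem core_quat (ht : Q.mod (Q.tgt α) = .quat) (hs : Q.mod (Q.src α) = .quat) (hα : α ∉ L) :
    Q.core L Z α = Q.ord L Z α - Q.loop L Z (Q.tgt α) * Q.ord L Z α * Q.loop L Z (Q.src α) := by
  unfold core
  rw [ht, hs]
  exact if_neg hα

theorem core_quat' (ht : Q.mod (Q.tgt α) = .quat) (hs : Q.mod (Q.src α) = .quat) (hα : α ∈ L) :
    Q.core L Z α = - (Q.scal L Z Complex.I * (Q.ord L Z α +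
        Q.loop L Z (Q.tgt α) * Q.ord L Z α * Q.loop L Z (Q.src α))) := by
  unfold core
  rw [ht, hs]
  exact if_pos hα

theorem core_real (ht : Q.mod (Q.tgt α) = .real) (hs : Q.mod (Q.src α) = .real) (hα : α ∉ L) :
    Q.core L Z α = Q.eps L Z (Q.tgt α) * Q.ord L Z α * Q.eps L Z (Q.src α) := by
  unfold core
  rw [ht, hs]
  exact if_neg hα

theorem core_real' (ht : Q.mod (Q.tgt α) = .real) (hs : Q.mod (Q.src α) = .real) (hα : α ∈ L) :
    Q.core L Z α =
      - (Q.eps L Z (Q.tgt α) * (Q.scal L Z Complex.I * Q.ord L Z α) * Q.eps L Z (Q.src α)) := by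
  unfold core
  rw [ht, hs]
  exact if_pos hα

/-- The arrows for which the bimodule is realised on the right of the arrow. -/
def IsRight (α : E) : Prop :=
  Q.mod (Q.tgt α) = .real ∨ Q.mod (Q.tgt α) = .cplx ∧ Q.mod (Q.src α) = .quat

theorem arrowMap_right (h : Q.IsRight α) (x : ℍ[ℝ]) :
    Q.arrowMap L Z α x = Q.core L Z α * Q.kap L Z (Q.src α) x := by
  unfold arrowMap
  cases ht : Q.mod (Q.tgt α) <;> cases hs : Q.mod (Q.src α) <;> simp_all [IsRight]

theorem arrowMap_left (h : ¬ Q.IsRight α)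
    (hb : ¬ (Q.mod (Q.tgt α) = .cplx ∧ Q.mod (Q.src α) = .cplx ∧ Q.bar α)) (x : ℍ[ℝ]) :
    Q.arrowMap L Z α x = Q.kap L Z (Q.tgt α) x * Q.core L Z α := by
  unfold arrowMap
  cases ht : Q.mod (Q.tgt α) <;> cases hs : Q.mod (Q.src α) <;> simp_all [IsRight]

theorem arrowMap_bar (hb : Q.mod (Q.tgt α) = .cplx ∧ Q.mod (Q.src α) = .cplx ∧ Q.bar α)
    (x : ℍ[ℝ]) : Q.arrowMap L Z α x = Q.kap L Z (Q.tgt α) (x * -qk) * Q.core L Z α := by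
  unfold arrowMap
  rw [hb.1, hb.2.1]
  simp [hb.2.2]

end Cases

theorem eps_mul_core (α : E) : Q.eps L Z (Q.tgt α) * Q.core L Z α = Q.core L Z α := by
  have h1 := Q.eps_mul_eps L Z (Q.tgt α)
  have h2 : ∀ x, Q.eps L Z (Q.tgt α) * (Q.eps L Z (Q.tgt α) * x) = Q.eps L Z (Q.tgt α) * x :=
    fun x => by rw [← mul_assoc, h1]
  by_cases hq : Q.mod (Q.tgt α) = .quat ∧ Q.mod (Q.src α) = .quat
  · have he := Q.eps_of_ne L Z (v := Q.tgt α) (by simp [hq])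
    by_cases hα : α ∈ L
    · rw [Q.core_quat' L Z hq.1 hq.2 hα, he, mul_neg, ← mul_assoc, idem_mul_scal, mul_assoc,
        mul_add, idem_mul_ord, ← mul_assoc, ← mul_assoc, idem_mul_loop]
    · rw [Q.core_quat L Z hq.1 hq.2 hα, he, mul_sub, idem_mul_ord, ← mul_assoc, ← mul_assoc,
        idem_mul_loop]
  · by_cases hr : Q.mod (Q.tgt α) = .real ∧ Q.mod (Q.src α) = .real
    · by_cases hα : α ∈ L
      · rw [Q.core_real' L Z hr.1 hr.2 hα]
        simp only [mul_assoc, mul_neg, h2]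
      · rw [Q.core_real L Z hr.1 hr.2 hα]
        simp only [mul_assoc, h2]
    · rw [Q.core_of_ne L Z]
      · simp only [mul_assoc, h2]
      · intro h
        rw [h] at hq hr
        cases hs : Q.mod (Q.src α) <;> simp_all

theorem core_mul_eps (α : E) : Q.core L Z α * Q.eps L Z (Q.src α) = Q.core L Z α := by
  have h1 := Q.eps_mul_eps L Z (Q.src α)
  by_cases hq : Q.mod (Q.tgt α) = .quat ∧ Q.mod (Q.src α) = .quat
  · have he := Q.eps_of_ne L Z (v := Q.src α) (by simp [hq])
    by_cases hα : α ∈ L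
    · rw [Q.core_quat' L Z hq.1 hq.2 hα, he, neg_mul, mul_assoc, add_mul, ord_mul_idem, mul_assoc,
        mul_assoc, loop_mul_idem, ← mul_assoc]
    · rw [Q.core_quat L Z hq.1 hq.2 hα, he, sub_mul, ord_mul_idem, mul_assoc, mul_assoc,
        loop_mul_idem, ← mul_assoc]
  · by_cases hr : Q.mod (Q.tgt α) = .real ∧ Q.mod (Q.src α) = .real
    · by_cases hα : α ∈ L
      · rw [Q.core_real' L Z hr.1 hr.2 hα, neg_mul, mul_assoc, h1]
      · rw [Q.core_real L Z hr.1 hr.2 hα, mul_assoc, h1]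
    · rw [Q.core_of_ne L Z, mul_assoc, h1]
      intro h
      rw [h] at hq hr
      cases hs : Q.mod (Q.src α) <;> simp_all

/-- For arrows between two vertices with `ℍ`, `core` is central. -/
theorem core_mul_kap {α : E} (ht : Q.mod (Q.tgt α) = .quat) (hs : Q.mod (Q.src α) = .quat)
    (x : ℍ[ℝ]) : Q.core L Z α * Q.kap L Z (Q.src α) x = Q.kap L Z (Q.tgt α) x * Q.core L Z α := by
  have ha : ∀ c, Q.ord L Z α * Q.scal L Z c = Q.scal L Z c * Q.ord L Z α :=
    Q.ord_mul_scal L Z (by simp [hs])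
  have hb : ∀ c, Q.loop L Z (Q.tgt α) * Q.ord L Z α * Q.loop L Z (Q.src α) * Q.scal L Z c =
      Q.scal L Z c * (Q.loop L Z (Q.tgt α) * Q.ord L Z α * Q.loop L Z (Q.src α)) := fun c => by
    rw [mul_assoc, loop_mul_scal, ← mul_assoc, mul_assoc _ _ (Q.scal L Z _), ha, ← mul_assoc,
      loop_mul_scal, Complex.conj_conj]
    simp only [mul_assoc]
  have ht2 := Q.loop_mul_loop_quat L Z ht
  have hs2 := Q.loop_mul_loop_quat L Z hs
  have h3 : Q.loop L Z (Q.tgt α) * (Q.loop L Z (Q.tgt α) * Q.ord L Z α * Q.loop L Z (Q.src α)) =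
      - (Q.ord L Z α * Q.loop L Z (Q.src α)) := by
    rw [← mul_assoc, ← mul_assoc, ht2, neg_mul, neg_mul, idem_mul_ord]
  have h4 : Q.loop L Z (Q.tgt α) * Q.ord L Z α * Q.loop L Z (Q.src α) * Q.loop L Z (Q.src α) =
      - (Q.loop L Z (Q.tgt α) * Q.ord L Z α) := by
    rw [mul_assoc _ _ (Q.loop L Z (Q.src α)), hs2, mul_neg, mul_assoc, ord_mul_idem]
  have key1 : ∀ c, Q.core L Z α * Q.scal L Z c = Q.scal L Z c * Q.core L Z α := fun c => by
    by_cases hα : α ∈ L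
    · rw [Q.core_quat' L Z ht hs hα, neg_mul, mul_assoc, add_mul, ha, hb, mul_neg, ← mul_add,
        ← mul_assoc, ← mul_assoc, ← map_mul, ← map_mul, mul_comm c]
    · rw [Q.core_quat L Z ht hs hα, sub_mul, ha, hb, mul_sub]
  have key2 : Q.core L Z α * Q.loop L Z (Q.src α) = Q.loop L Z (Q.tgt α) * Q.core L Z α := by
    by_cases hα : α ∈ L
    · rw [Q.core_quat' L Z ht hs hα, neg_mul, mul_neg, ← mul_assoc (Q.loop L Z (Q.tgt α)),
        loop_mul_scal, mul_assoc _ _ (Q.loop L Z (Q.src α)), mul_assoc _ (Q.loop L Z (Q.tgt α)),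
        add_mul, mul_add (Q.loop L Z (Q.tgt α)), h3, h4, Complex.conj_I, map_neg]
      noncomm_ring
    · rw [Q.core_quat L Z ht hs hα, sub_mul, mul_sub, h3, h4]
      noncomm_ring
  have he1 := Q.core_mul_eps L Z α
  have he2 := Q.eps_mul_core L Z α
  rw [Q.eps_of_ne L Z (by simp [hs])] at he1
  rw [Q.eps_of_ne L Z (by simp [ht])] at he2
  rw [kap_apply, kap_apply, mul_add, add_mul, ← mul_assoc, ← mul_assoc, key1, key1, mul_assoc,
    mul_assoc, he1, key2, mul_assoc, he2, mul_assoc]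

theorem core_eq_ord {α : E} (hs : Q.mod (Q.src α) = .cplx ∨ Q.mod (Q.tgt α) = .cplx)
    (hne : Q.mod (Q.src α) ≠ .real) (hnt : Q.mod (Q.tgt α) ≠ .real) :
    Q.core L Z α = Q.ord L Z α := by
  rw [Q.core_of_ne L Z (by intro h; rw [h] at hs; simpa using hs), Q.eps_of_ne L Z hne,
    Q.eps_of_ne L Z hnt, idem_mul_ord, ord_mul_idem]

theorem idem_mul_core (α : E) : Q.idem L Z (Q.tgt α) * Q.core L Z α = Q.core L Z α := by
  rw [← eps_mul_core, ← mul_assoc, idem_mul_eps]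

theorem core_mul_idem (α : E) : Q.core L Z α * Q.idem L Z (Q.src α) = Q.core L Z α := by
  rw [← core_mul_eps, mul_assoc, eps_mul_idem]

variable {Q L} in
-- Under these hypotheses `M(s(α)) ⊆ M(t(α))` inside `ℍ`, and the core commutes with the smaller
-- algebra. This makes the left-sided realisation of `M(α)` compatible with the right action.
theorem kap_mul_core (hL : Q.IsLabelling L) {α : E} (h : ¬ Q.IsRight α)
    (hb : ¬ (Q.mod (Q.tgt α) = .cplx ∧ Q.mod (Q.src α) = .cplx ∧ Q.bar α)) {d : ℍ[ℝ]}
    (hd : d ∈ divSub (Q.mod (Q.src α))) :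
    Q.kap L Z (Q.tgt α) d * Q.core L Z α = Q.core L Z α * Q.kap L Z (Q.src α) d := by
  cases hs : Q.mod (Q.src α) with
  | real =>
    rw [hs] at hd
    rw [Q.kap_of_real L Z _ hd, Q.kap_of_real L Z _ hd, smul_mul_assoc, mul_smul_comm,
      idem_mul_core, core_mul_idem]
  | cplx =>
    rw [hs] at hd
    have ht : Q.mod (Q.tgt α) ≠ .real := fun ht => h (Or.inl ht)
    rw [Q.kap_of_cplx L Z _ hd, Q.kap_of_cplx L Z _ hd, mul_assoc, idem_mul_core, ← idem_mul_scal,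
      ← mul_assoc, core_mul_idem, Q.core_eq_ord L Z (Or.inl hs) (by simp [hs]) ht]
    by_cases ht' : Q.mod (Q.tgt α) = .cplx
    · have hα : α ∉ L := fun hα => (hL.mod_eq α hα).2 hs
      rw [Q.ord_mul_scal_cplx L Z hα ⟨hs, ht'⟩, if_neg fun h' => hb ⟨ht', hs, h'⟩]
    · rw [Q.ord_mul_scal L Z fun h' => ht' h'.2]
  | quat =>
    have ht : Q.mod (Q.tgt α) = .quat := by
      cases ht : Q.mod (Q.tgt α)
      · exact absurd (Or.inl ht) h
      · exact absurd (Or.inr ⟨ht, hs⟩) h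
      · rfl
    exact (Q.core_mul_kap L Z ht hs d).symm

/-- Moving a complex coefficient past `k` conjugates it, which is the twist carried by an arrow with
the conjugate bimodule. -/
theorem bar_conj {d : ℍ[ℝ]} (hd : d ∈ divSub .cplx) :
    d * -qk = -qk * star d ∧ star d ∈ divSub .cplx ∧ fstC (star d) = starRingEnd ℂ (fstC d) := by
  rw [mem_divSub_cplx] at hd ⊢
  refine ⟨?_, by simp [hd], ?_⟩
  · ext <;> simp [hd]
  · apply Complex.ext <;> simp [fstC]

theorem arrowMap_mul_left (α : E) {c : ℍ[ℝ]}
    (hc : c ∈ divSub (Q.mod (Q.tgt α))) (x : ℍ[ℝ]) : Q.arrowMap L Z α (c * x) =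
      Q.kap L Z (Q.tgt α) c * Q.eps L Z (Q.tgt α) * Q.arrowMap L Z α x := by
  by_cases hr : Q.IsRight α
  · rw [Q.arrowMap_right L Z hr, Q.arrowMap_right L Z hr, ← mul_assoc, mul_assoc _ _ (Q.core L Z α),
      eps_mul_core]
    rcases hr with ht | ⟨ht, hs⟩
    · rw [ht] at hc
      have : c * x = c.re • x := by
        rw [mem_divSub_real] at hc
        ext <;> simp [hc]
      rw [this, map_smul, Q.kap_of_real L Z _ hc, smul_mul_assoc, smul_mul_assoc, mul_smul_comm,
        idem_mul_core]
    · rw [ht] at hc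
      rw [Q.kap_mul_of_left L Z _ hc, Q.kap_of_cplx L Z _ hc, Q.kap_of_cplx L Z _ hc,
        ← mul_assoc, ← idem_mul_scal, ← mul_assoc, core_mul_idem, mul_assoc (Q.scal L Z _),
        idem_mul_core, Q.core_eq_ord L Z (Or.inr ht) (by simp [hs]) (by simp [ht]),
        Q.ord_mul_scal L Z (by simp [hs])]
  · have ht : Q.mod (Q.tgt α) ≠ .real := fun ht => hr (Or.inl ht)
    by_cases hb : Q.mod (Q.tgt α) = .cplx ∧ Q.mod (Q.src α) = .cplx ∧ Q.bar α
    · rw [Q.arrowMap_bar L Z hb, Q.arrowMap_bar L Z hb, Q.eps_of_ne L Z ht, kap_mul_idem, mul_assoc,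
        Q.kap_mul L Z hc, mul_assoc]
    · rw [Q.arrowMap_left L Z hr hb, Q.arrowMap_left L Z hr hb, Q.eps_of_ne L Z ht, kap_mul_idem,
        Q.kap_mul L Z hc, mul_assoc]

variable {Q L} in
theorem arrowMap_mul_right (hL : Q.IsLabelling L) (α : E) {c x : ℍ[ℝ]} (hx : x ∈ Q.arrowModule α)
    (hc : c ∈ divSub (Q.mod (Q.src α))) : Q.arrowMap L Z α (x * c) =
      Q.arrowMap L Z α x * (Q.kap L Z (Q.src α) c * Q.eps L Z (Q.src α)) := by
  by_cases hr : Q.IsRight α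
  · rw [Q.arrowMap_right L Z hr, Q.arrowMap_right L Z hr, Q.kap_mul' L Z _ hc, ← mul_assoc]
    by_cases hs : Q.mod (Q.src α) = .real
    · have hx' : x ∈ divSub (Q.mod (Q.src α)) := by
        have ht : Q.mod (Q.tgt α) = .real := by
          rcases hr with ht | ⟨_, h⟩
          · exact ht
          · rw [hs] at h; cases h
        rw [Q.mem_arrowModule ht hs, mem_simpleBimodule] at hx
        rw [hs]
        exact mem_divSub_real.mpr hx
      rw [Q.kap_mul_eps L Z hc, ← mul_assoc, mul_assoc _ _ (Q.eps L Z _), Q.kap_mul_eps L Z hx',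
        ← mul_assoc, core_mul_eps]
    · rw [Q.eps_of_ne L Z hs, kap_mul_idem]
  · have hce : Q.core L Z α * (Q.kap L Z (Q.src α) c * Q.eps L Z (Q.src α)) =
        Q.core L Z α * Q.kap L Z (Q.src α) c := by
      rw [Q.kap_mul_eps L Z hc, ← mul_assoc, core_mul_eps]
    have ht : Q.mod (Q.tgt α) ≠ .real := fun ht => hr (Or.inl ht)
    by_cases hb : Q.mod (Q.tgt α) = .cplx ∧ Q.mod (Q.src α) = .cplx ∧ Q.bar α
    · rw [Q.arrowMap_bar L Z hb, Q.arrowMap_bar L Z hb, mul_assoc (Q.kap L Z (Q.tgt α) (x * -qk)), hce]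
      rw [hb.2.1] at hc
      obtain ⟨h1, h2, h3⟩ := bar_conj hc
      have hα : α ∉ L := fun hα => (hL.mod_eq α hα).2 hb.2.1
      rw [mul_assoc, h1, ← mul_assoc, Q.kap_mul_of_right L Z _ _ h2, mul_assoc]
      congr 1
      rw [Q.kap_of_cplx L Z _ h2, Q.kap_of_cplx L Z _ hc, h3, mul_assoc, idem_mul_core,
        ← idem_mul_scal, ← mul_assoc, core_mul_idem,
        Q.core_eq_ord L Z (Or.inl hb.2.1) (by simp [hb.2.1]) ht,
        Q.ord_mul_scal_cplx L Z hα ⟨hb.2.1, hb.1⟩, if_pos hb.2.2]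
    · rw [Q.arrowMap_left L Z hr hb, Q.arrowMap_left L Z hr hb, mul_assoc, hce,
        ← kap_mul_core Z hL hr hb hc, ← mul_assoc]
      congr 1
      by_cases hq : Q.mod (Q.src α) = .quat
      · have ht : Q.mod (Q.tgt α) = .quat := by
          cases ht : Q.mod (Q.tgt α)
          · exact absurd (Or.inl ht) hr
          · exact absurd (Or.inr ⟨ht, hq⟩) hr
          · rfl
        exact Q.kap_mul_quat L Z ht _ _
      · apply Q.kap_mul_of_right L Z
        cases hs : Q.mod (Q.src α) <;> rw [hs] at hc
        · exact cplx_of_real hc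
        · exact hc
        · exact absurd hs hq

theorem eps_mul_arrowMap (α : E) (x : ℍ[ℝ]) :
    Q.eps L Z (Q.tgt α) * Q.arrowMap L Z α x = Q.arrowMap L Z α x := by
  by_cases hr : Q.IsRight α
  · rw [Q.arrowMap_right L Z hr, ← mul_assoc, eps_mul_core]
  · have ht : Q.mod (Q.tgt α) ≠ .real := fun ht => hr (Or.inl ht)
    by_cases hb : Q.mod (Q.tgt α) = .cplx ∧ Q.mod (Q.src α) = .cplx ∧ Q.bar α
    · rw [Q.arrowMap_bar L Z hb, Q.eps_of_ne L Z ht, ← mul_assoc, idem_mul_kap]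
    · rw [Q.arrowMap_left L Z hr hb, Q.eps_of_ne L Z ht, ← mul_assoc, idem_mul_kap]

variable {Q L} in
theorem arrowMap_mul_eps (hL : Q.IsLabelling L) (α : E) {x : ℍ[ℝ]} (hx : x ∈ Q.arrowModule α) :
    Q.arrowMap L Z α x * Q.eps L Z (Q.src α) = Q.arrowMap L Z α x := by
  have := arrowMap_mul_right Z hL α hx (one_mem _)
  rw [mul_one, kap_one, idem_mul_eps] at this
  exact this.symm

variable {Q L} in
/-- The homomorphism from `T(Q, M)` to the corner of `ℂ_{σ'} Q^s / ⟨S ∪ Z⟩`. -/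
theorem exists_toCorner [Finite E] (hL : Q.IsLabelling L) :
    ∃ φ : Q.TensorAlg →ₐ[ℝ] (Q.isIdempotentElem_epsSum L Z).Corner,
      (∀ v, ∀ x ∈ divSub (Q.mod v), (φ (Q.vq v x)).1 = Q.kap L Z v x * Q.eps L Z v) ∧
      ∀ α, ∀ x ∈ Q.arrowModule α, (φ (Q.arr α x)).1 = Q.arrowMap L Z α x := by
  have := Fintype.ofFinite E
  let he := Q.isIdempotentElem_epsSum L Z
  -- Cutting by `ε` on both sides lands in the corner without any hypothesis, and changes nothing on
  -- elements already cut by some `ε_v` and `ε_w`.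
  let proj : Q.SAlg L Z →ₗ[ℝ] he.Corner :=
    { toFun := fun b => he.toCorner (Q.epsSum L Z * b * Q.epsSum L Z)
        (by rw [← mul_assoc, ← mul_assoc, he.eq]) (by rw [mul_assoc, he.eq])
      map_add' := fun b c => Subtype.ext (by
        change _ * (b + c) * _ = _ * b * _ + _ * c * _
        rw [mul_add, add_mul])
      map_smul' := fun r b => Subtype.ext (by
        change _ * (r • b) * _ = r • (_ * b * _)
        rw [mul_smul_comm, smul_mul_assoc]) }
  have hproj : ∀ {v w b}, Q.eps L Z v * b = b → b * Q.eps L Z w = b → (proj b).1 = b := by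
    intro v w b h1 h2
    change _ * b * _ = b
    rw [Q.epsSum_mul L Z h1, Q.mul_epsSum L Z h2]
  -- The additional `ε_v` on the left makes `ρ v x` and `ρ v' y` orthogonal for all quaternions, not
  -- only for elements of the division algebras; on the latter it is absorbed.
  let ρ : V → ℍ[ℝ] →ₗ[ℝ] he.Corner := fun v =>
    proj ∘ₗ LinearMap.mulLeft ℝ (Q.eps L Z v) ∘ₗ LinearMap.mulRight ℝ (Q.eps L Z v) ∘ₗ Q.kap L Z v
  have hρ' : ∀ v x, (ρ v x).1 = Q.eps L Z v * (Q.kap L Z v x * Q.eps L Z v) := by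
    intro v x
    refine hproj (v := v) (w := v) ?_ ?_
    · rw [LinearMap.comp_apply, LinearMap.comp_apply, LinearMap.mulLeft_apply, ← mul_assoc,
        eps_mul_eps]
    · rw [LinearMap.comp_apply, LinearMap.comp_apply, LinearMap.mulLeft_apply,
        LinearMap.mulRight_apply, mul_assoc, mul_assoc, eps_mul_eps]
  have hρ : ∀ v, ∀ x ∈ divSub (Q.mod v), (ρ v x).1 = Q.kap L Z v x * Q.eps L Z v := by
    intro v x hx
    rw [hρ', Q.kap_mul_eps L Z hx, ← mul_assoc, eps_mul_eps]
  let g : E → ℍ[ℝ] →ₗ[ℝ] he.Corner := fun α => proj ∘ₗ Q.arrowMap L Z α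
  have hg : ∀ α, ∀ x ∈ Q.arrowModule α, (g α x).1 = Q.arrowMap L Z α x := fun α x hx =>
    hproj (Q.eps_mul_arrowMap L Z α x) (arrowMap_mul_eps Z hL α hx)
  have hone : ∑ v, ρ v 1 = 1 := by
    apply Subtype.ext
    rw [IsIdempotentElem.corner_val_sum]
    change _ = ∑ v, Q.eps L Z v
    refine Finset.sum_congr rfl fun v _ => ?_
    rw [hρ v 1 (one_mem _), kap_one, idem_mul_eps]
  have hmul : ∀ v, ∀ x ∈ divSub (Q.mod v), ∀ y ∈ divSub (Q.mod v), ρ v (x * y) = ρ v x * ρ v y := by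
    intro v x hx y hy
    apply Subtype.ext
    rw [IsIdempotentElem.corner_val_mul, hρ v x hx, hρ v y hy, hρ v _ (mul_mem hx hy),
      Q.kap_mul L Z hx, mul_assoc, mul_assoc, Q.kap_mul_eps L Z hy, ← mul_assoc (Q.eps L Z v),
      eps_mul_eps]
  have hne : ∀ v v', v ≠ v' → ∀ x y, ρ v x * ρ v' y = 0 := by
    intro v v' h x y
    apply Subtype.ext
    rw [IsIdempotentElem.corner_val_mul, hρ', hρ']
    change _ = (0 : Q.SAlg L Z)
    rw [mul_assoc, mul_assoc, ← mul_assoc (Q.eps L Z v) (Q.eps L Z v'),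
      Q.eps_mul_eps_of_ne L Z h, zero_mul, mul_zero, mul_zero]
  have hleft : ∀ α, ∀ c ∈ divSub (Q.mod (Q.tgt α)), ∀ x ∈ Q.arrowModule α,
      g α (c * x) = ρ (Q.tgt α) c * g α x := by
    intro α c hc x hx
    apply Subtype.ext
    rw [IsIdempotentElem.corner_val_mul, hg α x hx, hρ _ c hc, ← Q.arrowMap_mul_left L Z α hc]
    refine hg α _ ?_
    obtain ⟨d, rfl⟩ := hc
    exact simpleBimodule_left d hx
  have hright : ∀ α, ∀ x ∈ Q.arrowModule α, ∀ c ∈ divSub (Q.mod (Q.src α)),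
      g α (x * c) = g α x * ρ (Q.src α) c := by
    intro α x hx c hc
    apply Subtype.ext
    rw [IsIdempotentElem.corner_val_mul, hg α x hx, hρ _ c hc, ← arrowMap_mul_right Z hL α hx hc]
    refine hg α _ ?_
    obtain ⟨d, rfl⟩ := hc
    exact simpleBimodule_right d hx
  refine ⟨Q.lift ρ g hone hmul hne hleft hright, fun v x hx => ?_, fun α x hx => ?_⟩
  · rw [Q.lift_vq hone hmul hne hleft hright v hx, hρ v x hx]
  · rw [Q.lift_arr hone hmul hne hleft hright α hx, hg α x hx]

end ModulatedQuiver

/-! ## The relations at a vertex with `ℝ` or `ℍ` as entries of a product of matrices -/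

@[simp] theorem qj_mul_qj : qj * qj = -1 := by ext <;> simp
@[simp] theorem qk_mul_qk : qk * qk = -1 := by ext <;> simp
@[simp] theorem qj_mul_qk : qj * qk = ql := by ext <;> simp
@[simp] theorem qk_mul_qj : qk * qj = -ql := by ext <;> simp
@[simp] theorem qj_mul_ql : qj * ql = -qk := by ext <;> simp
@[simp] theorem ql_mul_qj : ql * qj = qk := by ext <;> simp
@[simp] theorem qk_mul_ql : qk * ql = qj := by ext <;> simp
@[simp] theorem ql_mul_qk : ql * qk = -qj := by ext <;> simp

namespace ModulatedQuiver

variable {V : Type u} {E : Type w} (Q : ModulatedQuiver V E)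

variable {R : Type*} [Ring R] [Algebra ℝ R] (F : Q.TensorAlg →ₐ[ℝ] R)

open scoped Classical in
/-- The matrix over a `T(Q, M)`-ring corresponding to an ordinary arrow `γ` of `Q^s`;
`γ' = γⁱ`. -/
noncomputable def hat (γ γ' : E) : Matrix (Fin 2) (Fin 2) R :=
  -- The entries are what `colV i * γ * rowU j` becomes in terms of the bimodules (`hat_val`). A
  -- vertex with `ℝ` uses both indices, any other vertex only the first. Between two `ℍ`, the
  -- formula solves `core γ = γ - sγs`, `i * core γⁱ = γ + sγs` for the ordinary arrow `γ`.
  match Q.mod (Q.tgt γ), Q.mod (Q.src γ) with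
  | .real, .real => !![F (Q.arr γ 1), - F (Q.arr γ' 1); F (Q.arr γ' 1), F (Q.arr γ 1)]
  | .real, _ => !![F (Q.arr γ 1), 0; - F (Q.arr γ qj), 0]
  | _, .real => !![F (Q.arr γ 1), F (Q.arr γ qj); 0, 0]
  | .quat, .quat => !![(2⁻¹ : ℝ) • (F (Q.arr γ 1) + F (Q.arr γ' qj)), 0; 0, 0]
  | .cplx, .cplx => !![F (Q.arr γ (if Q.bar γ then qk else 1)), 0; 0, 0]
  | _, _ => !![F (Q.arr γ 1), 0; 0, 0]

/-- The matrix over a `T(Q, M)`-ring corresponding to a special loop. -/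
noncomputable def loopHat (v : V) : Matrix (Fin 2) (Fin 2) R :=
  -- With `ℝ`, the loop is `1` on `ε_v` and `-1` on `e_v - ε_v`. With `ℍ` it is `k`, repeated on the
  -- second coordinate because `oneHat` fills both.
  match Q.mod v with
  | .real => !![F (Q.vq v 1), 0; 0, - F (Q.vq v 1)]
  | _ => !![F (Q.vq v qk), 0; 0, F (Q.vq v qk)]

section Hat

variable {γ γ' : E}

theorem hat_real_real (ht : Q.mod (Q.tgt γ) = .real) (hs : Q.mod (Q.src γ) = .real) :
    Q.hat F γ γ' = !![F (Q.arr γ 1), - F (Q.arr γ' 1); F (Q.arr γ' 1), F (Q.arr γ 1)] := by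
  unfold hat; rw [ht, hs]

theorem hat_real_ne (ht : Q.mod (Q.tgt γ) = .real) (hs : Q.mod (Q.src γ) ≠ .real) :
    Q.hat F γ γ' = !![F (Q.arr γ 1), 0; - F (Q.arr γ qj), 0] := by
  unfold hat; cases h : Q.mod (Q.src γ) <;> simp_all

theorem hat_ne_real (ht : Q.mod (Q.tgt γ) ≠ .real) (hs : Q.mod (Q.src γ) = .real) :
    Q.hat F γ γ' = !![F (Q.arr γ 1), F (Q.arr γ qj); 0, 0] := by
  unfold hat; cases h : Q.mod (Q.tgt γ) <;> simp_all

theorem hat_quat_quat (ht : Q.mod (Q.tgt γ) = .quat) (hs : Q.mod (Q.src γ) = .quat) :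
    Q.hat F γ γ' = !![(2⁻¹ : ℝ) • (F (Q.arr γ 1) + F (Q.arr γ' qj)), 0; 0, 0] := by
  unfold hat; rw [ht, hs]

open scoped Classical in
theorem hat_cplx_cplx (ht : Q.mod (Q.tgt γ) = .cplx) (hs : Q.mod (Q.src γ) = .cplx) :
    Q.hat F γ γ' = !![F (Q.arr γ (if Q.bar γ then qk else 1)), 0; 0, 0] := by
  unfold hat; rw [ht, hs]

theorem hat_cplx_quat (ht : Q.mod (Q.tgt γ) = .cplx) (hs : Q.mod (Q.src γ) = .quat) :
    Q.hat F γ γ' = !![F (Q.arr γ 1), 0; 0, 0] := by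
  unfold hat; rw [ht, hs]

theorem hat_quat_cplx (ht : Q.mod (Q.tgt γ) = .quat) (hs : Q.mod (Q.src γ) = .cplx) :
    Q.hat F γ γ' = !![F (Q.arr γ 1), 0; 0, 0] := by
  unfold hat; rw [ht, hs]

theorem loopHat_real {v : V} (h : Q.mod v = .real) :
    Q.loopHat F v = !![F (Q.vq v 1), 0; 0, - F (Q.vq v 1)] := by
  unfold loopHat; rw [h]

theorem loopHat_of_ne {v : V} (h : Q.mod v ≠ .real) :
    Q.loopHat F v = !![F (Q.vq v qk), 0; 0, F (Q.vq v qk)] := by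
  unfold loopHat; cases h' : Q.mod v <;> simp_all

theorem mem_divSub_of_ne_real {D : DivKind} (h : D ≠ .real) : qj ∈ divSub D := by
  cases D
  · exact absurd rfl h
  · rw [mem_divSub_cplx]; simp
  · exact mem_divSub_quat _

theorem one_mem_arrowModule (h : ¬ (Q.mod (Q.tgt γ) = .cplx ∧ Q.mod (Q.src γ) = .cplx)) :
    1 ∈ Q.arrowModule γ := by
  cases ht : Q.mod (Q.tgt γ) <;> cases hs : Q.mod (Q.src γ) <;>
    rw [Q.mem_arrowModule ht hs, mem_simpleBimodule] <;> simp_all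

theorem qj_mem_arrowModule (h : ¬ (Q.mod (Q.tgt γ) = .cplx ∧ Q.mod (Q.src γ) = .cplx))
    (h' : ¬ (Q.mod (Q.tgt γ) = .real ∧ Q.mod (Q.src γ) = .real)) : qj ∈ Q.arrowModule γ := by
  cases ht : Q.mod (Q.tgt γ) <;> cases hs : Q.mod (Q.src γ) <;>
    rw [Q.mem_arrowModule ht hs, mem_simpleBimodule] <;> simp_all

theorem mem_arrowModule_quat_left (h : Q.mod (Q.tgt γ) = .quat) (x : ℍ[ℝ]) :
    x ∈ Q.arrowModule γ := by
  cases hs : Q.mod (Q.src γ) <;> rw [Q.mem_arrowModule h hs, mem_simpleBimodule] <;> trivial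

theorem mem_arrowModule_quat_right (h : Q.mod (Q.src γ) = .quat) (x : ℍ[ℝ]) :
    x ∈ Q.arrowModule γ := by
  cases ht : Q.mod (Q.tgt γ) <;> rw [Q.mem_arrowModule ht h, mem_simpleBimodule] <;> trivial

end Hat

/-! ### Tensor products over `ℍ`. -/

section Tensor


/-- The map `y ↦ 1 ⊗ y` for two arrows which meet at a vertex with `ℍ`. -/
noncomputable def tensQuat (a b : E) (hb : Q.mod (Q.tgt b) = .quat) : ℍ[ℝ] →ₗ[ℝ] Q.TensorAlg where
  toFun y := Q.arr a 1 * Q.arr b y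
  map_add' x y := by
    rw [Q.arr_add (Q.mem_arrowModule_quat_left hb _) (Q.mem_arrowModule_quat_left hb _), mul_add]
  map_smul' r x := by
    rw [Q.arr_smul r (Q.mem_arrowModule_quat_left hb _), mul_smul_comm, RingHom.id_apply]

variable {a b : E} (ha : Q.mod (Q.src a) = .quat) (hb : Q.mod (Q.tgt b) = .quat)
  (hab : Q.src a = Q.tgt b)

include ha hab in
-- The element `x` can be moved through the tensor product over `ℍ`, so `x ⊗ y = 1 ⊗ xy`.
theorem arr_mul_arr_quat (x y : ℍ[ℝ]) : Q.arr a x * Q.arr b y = Q.tensQuat a b hb (x * y) := by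
  change _ = Q.arr a 1 * Q.arr b (x * y)
  rw [← Q.vq_mul_arr (by rw [hb]; exact mem_divSub_quat x) (Q.mem_arrowModule_quat_left hb y),
    ← mul_assoc, ← hab, Q.arr_mul_vq (Q.mem_arrowModule_quat_right ha 1)
      (by rw [ha]; exact mem_divSub_quat x), one_mul]

include ha hab in
theorem arr_mul_vq_mul_arr_quat (x y z : ℍ[ℝ]) :
    Q.arr a x * Q.vq (Q.src a) z * Q.arr b y = Q.tensQuat a b hb (x * z * y) := by
  rw [Q.arr_mul_vq (Q.mem_arrowModule_quat_right ha x) (by rw [ha]; exact mem_divSub_quat z),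
    Q.arr_mul_arr_quat ha hb hab]

include ha hab in
theorem vq_mul_tensQuat {c : ℍ[ℝ]} (hc : c ∈ divSub (Q.mod (Q.tgt a))) (y : ℍ[ℝ]) :
    Q.vq (Q.tgt a) c * Q.tensQuat a b hb y = Q.tensQuat a b hb (c * y) := by
  change _ * (Q.arr a 1 * Q.arr b y) = _
  rw [← mul_assoc, Q.vq_mul_arr hc (Q.mem_arrowModule_quat_right ha 1), mul_one,
    Q.arr_mul_arr_quat ha hb hab]

theorem tensQuat_mul_vq {c : ℍ[ℝ]} (hc : c ∈ divSub (Q.mod (Q.src b))) (y : ℍ[ℝ]) :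
    Q.tensQuat a b hb y * Q.vq (Q.src b) c = Q.tensQuat a b hb (y * c) := by
  change (Q.arr a 1 * Q.arr b y) * _ = Q.arr a 1 * Q.arr b (y * c)
  rw [mul_assoc, Q.arr_mul_vq (Q.mem_arrowModule_quat_left hb y) hc]

end Tensor

/-! ### The generators of `I_v^p` as vanishing matrix products. -/

section Relations

variable {a a' b b' : E}

theorem vq_mul_arr_one (ht : Q.mod (Q.tgt a) ≠ .real) (hs : Q.mod (Q.src a) ≠ .cplx) :
    F (Q.vq (Q.tgt a) qj) * F (Q.arr a 1) = F (Q.arr a qj) := by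
  rw [← map_mul, Q.vq_mul_arr (mem_divSub_of_ne_real ht) (Q.one_mem_arrowModule fun h => hs h.2),
    mul_one]

theorem vq_mul_arr_qj (ht : Q.mod (Q.tgt a) ≠ .real) (hs : Q.mod (Q.src a) ≠ .cplx) :
    F (Q.vq (Q.tgt a) qj) * F (Q.arr a qj) = - F (Q.arr a 1) := by
  have h1 : 1 ∈ Q.arrowModule a := Q.one_mem_arrowModule fun h => hs h.2
  rw [← map_mul, Q.vq_mul_arr (mem_divSub_of_ne_real ht) (Q.qj_mem_arrowModule (fun h => hs h.2)
    fun h => ht h.1), qj_mul_qj, Q.arr_neg h1]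
  exact map_neg F _

theorem arr_one_mul_vq (hs : Q.mod (Q.src a) ≠ .real) (ht : Q.mod (Q.tgt a) ≠ .cplx) :
    F (Q.arr a 1) * F (Q.vq (Q.src a) qj) = F (Q.arr a qj) := by
  rw [← map_mul, Q.arr_mul_vq (Q.one_mem_arrowModule fun h => ht h.1) (mem_divSub_of_ne_real hs),
    one_mul]

theorem arr_qj_mul_vq (hs : Q.mod (Q.src a) ≠ .real) (ht : Q.mod (Q.tgt a) ≠ .cplx) :
    F (Q.arr a qj) * F (Q.vq (Q.src a) qj) = - F (Q.arr a 1) := by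
  have h1 : 1 ∈ Q.arrowModule a := Q.one_mem_arrowModule fun h => ht h.1
  rw [← map_mul, Q.arr_mul_vq (Q.qj_mem_arrowModule (fun h => ht h.1) fun h => hs h.2)
    (mem_divSub_of_ne_real hs), qj_mul_qj, Q.arr_neg h1]
  exact map_neg F _

theorem map_vq_one_mul_arr {v : V} (h : Q.tgt a = v) (x : ℍ[ℝ]) :
    F (Q.vq v 1) * F (Q.arr a x) = F (Q.arr a x) := by
  rw [← h, ← map_mul, one_vq_mul_arr]

theorem map_arr_mul_vq_one {v : V} (h : Q.src a = v) (x : ℍ[ℝ]) :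
    F (Q.arr a x) * F (Q.vq v 1) = F (Q.arr a x) := by
  rw [← h, ← map_mul, arr_mul_one_vq]

/-- The generators of `I_v⁰` or `I_v¹`, for `v = s(a) = t(b)`. -/
noncomputable def gens (p : Fin 2) (a a' b b' : E) : Set Q.TensorAlg :=
  (if p = 0 then Q.gen0 else Q.gen1) a a' b b' (Q.mod (Q.src b)) (Q.mod (Q.src a))
    (Q.mod (Q.tgt a))

theorem map_sub' (x y : Q.TensorAlg) : F (x - y) = F x - F y := map_sub F x y

theorem map_neg' (x : Q.TensorAlg) : F (-x) = - F x := map_neg F x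

/-- If `M(u) = ℝ`, the four entries of the product are the two generators up to sign, each occurring
twice. Otherwise only one column remains; up to sign its second entry is the first one multiplied by
`j` on the right. -/
theorem map_gens_eq_zero_iff_real_real (hab : Q.src a = Q.tgt b) (ha' : Q.src a' = Q.src a)
    (hv : Q.mod (Q.src a) = .real) (hw : Q.mod (Q.tgt a) = .real)
    (p : Fin 2) :
    (∀ r ∈ Q.gens p a a' b b', F r = 0) ↔
    Q.hat F a a' * (if p = 0 then 1 else Q.loopHat F (Q.src a)) * Q.hat F b b' = 0 := by
  have hv' : Q.mod (Q.tgt b) = .real := hab ▸ hv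
  have h1 := Q.map_arr_mul_vq_one F (a := a) rfl
  have h2 := Q.map_arr_mul_vq_one F ha'
  rw [← Matrix.ext_iff]
  unfold gens
  rw [Q.hat_real_real F hw hv]
  by_cases hu : Q.mod (Q.src b) = .real
  · rw [Q.hat_real_real F hv' hu, hw, hu, hv]
    obtain rfl | rfl : p = 0 ∨ p = 1 := by omega
    · simp [gen0, tens, Fin.forall_fin_two, Matrix.mul_apply, Fin.sum_univ_two, map_sub',
        map_neg']
      grind
    · simp [gen1, tens, Fin.forall_fin_two, Q.loopHat_real F hv, h1, h2, Matrix.mul_apply,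
        Fin.sum_univ_two, map_sub']
      grind
  · have h3 := Q.arr_one_mul_vq F (a := b) hu (by simp [hv'])
    have h4 := Q.arr_qj_mul_vq F (a := b) hu (by simp [hv'])
    -- Right multiplication by `j ∈ M(u)`; it yields the second entry from the single generator.
    have h5 : ∀ x y : R, x * F (Q.arr b 1) + y * F (Q.arr b qj) = 0 →
        x * F (Q.arr b qj) - y * F (Q.arr b 1) = 0 := by
      intro x y h
      have := congrArg (· * F (Q.vq (Q.src b) qj)) h
      simpa only [add_mul, mul_assoc, h3, h4, mul_neg, zero_mul, ← sub_eq_add_neg] using this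
    have h6 := h5 (F (Q.arr a 1)) (F (Q.arr a' 1))
    have h7 := h5 (F (Q.arr a 1)) (-F (Q.arr a' 1))
    simp only [neg_mul] at h7
    rw [Q.hat_real_ne F hv' hu, hw, hv]
    obtain hu' | hu' : Q.mod (Q.src b) = .cplx ∨ Q.mod (Q.src b) = .quat := by
      cases h : Q.mod (Q.src b) <;> simp_all
    all_goals
      rw [hu']
      obtain rfl | rfl : p = 0 ∨ p = 1 := by omega
      · simp [gen0, tens, Fin.forall_fin_two]
        grind
      · simp [gen1, tens, Fin.forall_fin_two, Q.loopHat_real F hv, h1, h2, map_sub']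
        grind

/-- Only the first row remains. If `M(u) = ℝ`, its two entries differ by left multiplication by `j ∈
M(w)`; otherwise it has one entry, which is the generator. -/
theorem map_gens_eq_zero_iff_ne_real (hab : Q.src a = Q.tgt b)
    (hv : Q.mod (Q.src a) = .real) (hw : Q.mod (Q.tgt a) ≠ .real)
    (p : Fin 2) :
    (∀ r ∈ Q.gens p a a' b b', F r = 0) ↔
    Q.hat F a a' * (if p = 0 then 1 else Q.loopHat F (Q.src a)) * Q.hat F b b' = 0 := by
  have hv' : Q.mod (Q.tgt b) = .real := hab ▸ hv
  have h1 := Q.map_arr_mul_vq_one F (a := a) rfl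
  rw [← Matrix.ext_iff]
  unfold gens
  have h3 := Q.vq_mul_arr_one F (a := a) hw (by simp [hv])
  have h4 := Q.vq_mul_arr_qj F (a := a) hw (by simp [hv])
  have h5 : ∀ x y : R, F (Q.arr a 1) * x + F (Q.arr a qj) * y = 0 →
      F (Q.arr a qj) * x - F (Q.arr a 1) * y = 0 := by
    intro x y h
    have := congrArg (F (Q.vq (Q.tgt a) qj) * ·) h
    simpa only [mul_add, ← mul_assoc, h3, h4, neg_mul, mul_zero, ← sub_eq_add_neg] using this
  have h6 := h5 (F (Q.arr b 1)) (F (Q.arr b' 1))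
  have h7 := h5 (F (Q.arr b 1)) (-F (Q.arr b' 1))
  simp only [mul_neg] at h7
  have hw' : Q.mod (Q.tgt a) = .cplx ∨ Q.mod (Q.tgt a) = .quat := by
    cases h : Q.mod (Q.tgt a) <;> simp_all
  rw [Q.hat_ne_real F hw hv]
  by_cases hu : Q.mod (Q.src b) = .real
  · rw [Q.hat_real_real F hv' hu, hu, hv]
    obtain rfl | rfl : p = 0 ∨ p = 1 := by omega
    · rcases hw' with hw' | hw' <;> rw [hw'] <;> simp [gen0, tens, Fin.forall_fin_two] <;> grind
    · rcases hw' with hw' | hw' <;> rw [hw'] <;>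
        simp [gen1, tens, Fin.forall_fin_two, Q.loopHat_real F hv, h1, map_sub'] <;> grind
  · have hu' : Q.mod (Q.src b) = .cplx ∨ Q.mod (Q.src b) = .quat := by
      cases h : Q.mod (Q.src b) <;> simp_all
    rw [Q.hat_real_ne F hv' hu, hv]
    obtain rfl | rfl : p = 0 ∨ p = 1 := by omega
    · obtain hw' | hw' := hw' <;> obtain hu' | hu' := hu' <;> rw [hw', hu'] <;>
        simp [gen0, tens, Fin.forall_fin_two, sub_eq_add_neg]
    · obtain hw' | hw' := hw' <;> obtain hu' | hu' := hu' <;> rw [hw', hu'] <;>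
        simp [gen1, tens, Fin.forall_fin_two, Q.loopHat_real F hv, h1]

set_option maxHeartbeats 1000000 in
-- Since `x ⊗ y = 1 ⊗ xy` over `ℍ`, every entry is a combination of values of four linear maps on
-- `ℍ`, one for each pair from `{a, a'} × {b, b'}`. The entries not listed as generators are
-- `j`-multiples of listed ones, obtained from an end which is not `ℝ`. If both ends carry `ℝ`, no
-- such multiplication is available, and two generators are listed.
theorem map_gens_eq_zero_iff_quat (hab : Q.src a = Q.tgt b) (ha' : Q.src a' = Q.src a)
    (hb' : Q.tgt b' = Q.tgt b) (hv : Q.mod (Q.src a) = .quat) (p : Fin 2)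
    (ht' : Q.mod (Q.tgt a) = .quat → Q.tgt a' = Q.tgt a)
    (hs' : Q.mod (Q.src b) = .quat → Q.src b' = Q.src b) :
    (∀ r ∈ Q.gens p a a' b b', F r = 0) ↔
    Q.hat F a a' * (if p = 0 then 1 else Q.loopHat F (Q.src a)) * Q.hat F b b' = 0 := by
  have hv' : Q.mod (Q.tgt b) = .quat := hab ▸ hv
  have hva : Q.mod (Q.src a') = .quat := ha' ▸ hv
  have hvb : Q.mod (Q.tgt b') = .quat := hb' ▸ hv'
  -- For each pair of arrows: the map `f y = F(1 ⊗ y)`, with its behaviour under a middle factor and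
  -- under the two outer actions.
  have t : ∀ {c d : E}, Q.src c = Q.src a → Q.tgt d = Q.tgt b → ∃ f : ℍ[ℝ] →ₗ[ℝ] R,
      (∀ x y, F (Q.arr c x) * F (Q.arr d y) = f (x * y)) ∧
      (∀ x y z, F (Q.arr c x) * (F (Q.vq (Q.src a) z) * F (Q.arr d y)) = f (x * (z * y))) ∧
      (∀ z ∈ divSub (Q.mod (Q.tgt c)), ∀ y, F (Q.vq (Q.tgt c) z) * f y = f (z * y)) ∧
      (∀ z ∈ divSub (Q.mod (Q.src d)), ∀ y, f y * F (Q.vq (Q.src d) z) = f (y * z)) := by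
    intro c d hc hd
    have hvc : Q.mod (Q.src c) = .quat := hc ▸ hv
    have hvd : Q.mod (Q.tgt d) = .quat := hd ▸ hv'
    have hcd : Q.src c = Q.tgt d := by rw [hc, hd, hab]
    refine ⟨F.toLinearMap ∘ₗ Q.tensQuat c d hvd, fun x y => ?_, fun x y z => ?_, fun z hz y => ?_,
      fun z hz y => ?_⟩
    · rw [← map_mul, Q.arr_mul_arr_quat hvc hvd hcd]; rfl
    · rw [← hc, ← mul_assoc, ← map_mul, ← map_mul, Q.arr_mul_vq_mul_arr_quat hvc hvd hcd, mul_assoc]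
      rfl
    · rw [LinearMap.comp_apply, LinearMap.comp_apply, AlgHom.toLinearMap_apply, ← map_mul,
        Q.vq_mul_tensQuat hvc hvd hcd hz]
      rfl
    · rw [LinearMap.comp_apply, LinearMap.comp_apply, AlgHom.toLinearMap_apply, ← map_mul,
        Q.tensQuat_mul_vq hvd hz]
      rfl
  obtain ⟨t₁, m₁, n₁, l₁, r₁⟩ := t (c := a) (d := b) rfl rfl
  obtain ⟨t₂, m₂, n₂, l₂, r₂⟩ := t (c := a) (d := b') rfl hb'
  obtain ⟨t₃, m₃, n₃, l₃, r₃⟩ := t (c := a') (d := b) ha' rfl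
  obtain ⟨t₄, m₄, n₄, l₄, r₄⟩ := t (c := a') (d := b') ha' hb'
  have hq : Q.loopHat F (Q.src a) = _ := Q.loopHat_of_ne F (by rw [hv]; simp)
  have h2 : (2⁻¹ : ℝ) ≠ 0 := by norm_num
  have hR1 : Q.mod (Q.src b) = .cplx → ∀ q, t₁ q = 0 → t₁ (q * qj) = 0 := fun h q hq => by
    rw [← r₁ qj (mem_divSub_of_ne_real (by rw [h]; simp)), hq, zero_mul]
  have hL1 : Q.mod (Q.tgt a) = .cplx → ∀ q, t₁ q = 0 → t₁ (qj * q) = 0 := fun h q hq => by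
    rw [← l₁ qj (mem_divSub_of_ne_real (by rw [h]; simp)), hq, mul_zero]
  have hR2 : Q.mod (Q.src b) = .quat → ∀ q q', t₁ q + t₂ q' = 0 →
      t₁ (q * qj) + t₂ (q' * qj) = 0 := fun h q q' hq => by
    rw [hs' h] at r₂
    rw [← r₁ qj (mem_divSub_of_ne_real (by rw [h]; simp)),
      ← r₂ qj (mem_divSub_of_ne_real (by rw [h]; simp)), ← add_mul, hq, zero_mul]
  have hL2 : Q.mod (Q.tgt a) = .quat → ∀ q q', t₁ q + t₃ q' = 0 →
      t₁ (qj * q) + t₃ (qj * q') = 0 := fun h q q' hq => by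
    rw [ht' h] at l₃
    rw [← l₁ qj (mem_divSub_of_ne_real (by rw [h]; simp)),
      ← l₃ qj (mem_divSub_of_ne_real (by rw [h]; simp)), ← mul_add, hq, mul_zero]
  -- The `j`-multiples of the elements that occur: `1` and `j` for `p = 0`, `k` and `±l` for `p =
  -- 1`.
  have hR3 := fun h => hR1 h 1
  have hR4 := fun h => hR1 h qk
  have hL3 := fun h => hL1 h 1
  have hL4 := fun h => hL1 h qk
  have hR5 := fun h => hR2 h 1 qj
  have hR6 := fun h => hR2 h qk (-ql)
  have hL5 := fun h => hL2 h 1 qj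
  have hL6 := fun h => hL2 h qk ql
  simp only [one_mul, mul_one, neg_mul, qj_mul_qj, qj_mul_qk, qj_mul_ql, qk_mul_qj, ql_mul_qj,
    map_neg] at hR3 hR4 hL3 hL4 hR5 hR6 hL5 hL6
  clear hR1 hL1 hR2 hL2 t
  rw [← Matrix.ext_iff]
  unfold gens
  cases hw : Q.mod (Q.tgt a) <;> cases hu : Q.mod (Q.src b)
  all_goals
    first | rw [Q.hat_real_ne F hw (by rw [hv]; simp)] | rw [Q.hat_cplx_quat F hw hv] |
      rw [Q.hat_quat_quat F hw hv]
    first | rw [Q.hat_ne_real F (by rw [hv']; simp) hu] | rw [Q.hat_quat_cplx F hv' hu] |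
      rw [Q.hat_quat_quat F hv' hu]
    rw [hv]
    simp only [hu, hw, reduceCtorEq, false_implies,
      forall_const] at hR3 hR4 hL3 hL4 hR5 hR6 hL5 hL6
    obtain rfl | rfl : p = 0 ∨ p = 1 := by omega
    all_goals
      simp [gen0, gen1, tens, Fin.forall_fin_two, map_sub', map_neg', hq, mul_assoc, add_mul,
        mul_add, m₁, m₂, m₃, m₄, n₁, n₂, n₃, n₄]
    all_goals
      clear m₁ m₂ m₃ m₄ n₁ n₂ n₃ n₄ l₁ l₂ l₃ l₄ r₁ r₂ r₃ r₄
      try simp only [← smul_neg, ← smul_add, smul_eq_zero, h2, false_or]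
    all_goals grind

end Relations

end ModulatedQuiver

/-! ## Partners -/

namespace ModulatedQuiver

variable {V : Type u} {E : Type w} {Q : ModulatedQuiver V E} {L : Set E}

theorem IsPartner.src_eq {γ γ' : E} (h : Q.IsPartner L γ γ') : Q.src γ' = Q.src γ := by
  obtain ⟨_, _, _, h, _⟩ | ⟨_, rfl⟩ := h
  · exact h.symm
  · rfl

theorem IsPartner.tgt_eq {γ γ' : E} (h : Q.IsPartner L γ γ') : Q.tgt γ' = Q.tgt γ := by
  obtain ⟨_, _, _, _, h⟩ | ⟨_, rfl⟩ := h
  · exact h.symm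
  · rfl

theorem IsPartner.not_mem (hL : Q.IsLabelling L) {γ γ' : E} (h : Q.IsPartner L γ γ') : γ ∉ L := by
  obtain ⟨_, h, _⟩ | ⟨h, _⟩ := h
  · exact h
  · exact fun h' => h (hL.mod_eq γ h').1

theorem IsPartner.eq_of_not_mem {γ γ' δ : E} (h : Q.IsPartner L γ γ')
    (hδ : δ ∉ L) (h' : δ = γ ∨ δ = γ') : δ = γ := by
  obtain rfl | rfl := h'
  · rfl
  · obtain ⟨_, _, h, _⟩ | ⟨_, h⟩ := h
    · exact absurd h hδ
    · exact h

/-- The chosen arrow and `γ` are parallel and both outside `L`; of two different such arrows exactly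
one would lie in `L`. -/
theorem IsPartner.base_eq (hL : Q.IsLabelling L) {γ γ' : E} (h : Q.IsPartner L γ γ') :
    Q.base L γ' = γ := by
  obtain ⟨hm, hγ, hγ', hs, ht⟩ | ⟨hm, rfl⟩ := h
  · by_contra hne
    have := hL.one_of_two _ _ hne (by rw [src_base, hs]) (by rw [tgt_base, ht])
      (by rw [src_base, tgt_base, ← hs, ← ht, hm]) (by rw [src_base]; exact (hL.mod_eq _ hγ').2)
    rcases this with h | h
    · exact base_not_mem hL _ h.1
    · exact hγ h.1
  · exact base_of_not_mem fun h => hm (hL.mod_eq _ h).1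

theorem IsPartner.unique (hL : Q.IsLabelling L) {γ γ' γ'' : E} (h : Q.IsPartner L γ γ')
    (h' : Q.IsPartner L γ γ'') : γ' = γ'' := by
  have hs := h.src_eq
  have ht := h.tgt_eq
  have hs' := h'.src_eq
  have ht' := h'.tgt_eq
  obtain ⟨hm, hγ, hγ', -⟩ | ⟨hm, rfl⟩ := h
  · obtain ⟨-, -, hγ'', -⟩ | ⟨hm', rfl⟩ := h'
    · by_contra hne
      rcases hL.one_of_two _ _ hne (by rw [hs, hs']) (by rw [ht, ht']) (by rw [hs, ht, hm])
        (hL.mod_eq _ hγ').2 with h | h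
      · exact h.2 hγ''
      · exact h.2 hγ'
    · exact absurd hm hm'
  · obtain ⟨hm', -⟩ | ⟨hm', rfl⟩ := h'
    · exact absurd hm' hm
    · rfl

variable (Q L) in
open scoped Classical in
/-- The arrow `γⁱ`, or `γ` if there is no `γⁱ`. -/
noncomputable def other (γ : E) : E := if h : ∃ γ', Q.IsPartner L γ γ' then h.choose else γ

variable {I : TwoSidedIdeal Q.TensorAlg}

theorem IsSpecialType.speciallyGentle (hI : Q.IsSpecialType L I) {v : V} (hv : Q.mod v ≠ .cplx) :
    Q.SpeciallyGentle L I v := (hI.gentle v).resolve_left fun h => hv h.mod_eq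

theorem IsSpecialType.ordinarilyGentle (hI : Q.IsSpecialType L I) {v : V} (hv : Q.mod v = .cplx) :
    Q.OrdinarilyGentle I v := (hI.gentle v).resolve_right fun h => h.1 hv

theorem IsSpecialType.exists_isOut (hI : Q.IsSpecialType L I) {α : E}
    (hα : Q.mod (Q.src α) ≠ .cplx) : ∃ a a', Q.IsOut L (Q.src α) a a' := by
  have hmem : α ∈ Q.outArrows (Q.src α) := rfl
  obtain ⟨h, -⟩ | ⟨-, h | h⟩ | ⟨h, -⟩ := (hI.speciallyGentle hα).2
  · exact h
  · exact absurd hmem (by simp [h])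
  · exact h
  · exact absurd hmem (by simp [h])

theorem IsSpecialType.exists_isIn (hI : Q.IsSpecialType L I) {α : E}
    (hα : Q.mod (Q.tgt α) ≠ .cplx) : ∃ a a', Q.IsIn L (Q.tgt α) a a' := by
  have hmem : α ∈ Q.inArrows (Q.tgt α) := rfl
  obtain ⟨-, h, -⟩ | ⟨h, -⟩ | ⟨-, h | h⟩ := (hI.speciallyGentle hα).2
  · exact h
  · exact absurd hmem (by simp [h])
  · exact absurd hmem (by simp [h])
  · exact h

theorem IsOut.eq_of_not_mem {v : V} {a a' α : E} (h : Q.IsOut L v a a')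
    (hα : α ∉ L) (hv : Q.src α = v) : α = a := by
  have hmem : α ∈ Q.outArrows v := hv
  rw [h.2] at hmem
  exact h.1.eq_of_not_mem hα hmem

theorem IsIn.eq_of_not_mem {v : V} {a a' α : E} (h : Q.IsIn L v a a')
    (hα : α ∉ L) (hv : Q.tgt α = v) : α = a := by
  have hmem : α ∈ Q.inArrows v := hv
  rw [h.2] at hmem
  exact h.1.eq_of_not_mem hα hmem

theorem IsOut.src_eq {v : V} {a a' : E} (h : Q.IsOut L v a a') : Q.src a = v := by
  have : a ∈ Q.outArrows v := by rw [h.2]; simp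
  exact this

theorem IsIn.tgt_eq {v : V} {a a' : E} (h : Q.IsIn L v a a') : Q.tgt a = v := by
  have : a ∈ Q.inArrows v := by rw [h.2]; simp
  exact this

/-- If the source carries `ℂ`, the ends differ and the arrow is its own partner. Otherwise the
admissible form of `v⁺` at the source supplies the partner. -/
theorem IsSpecialType.isPartner_other (hI : Q.IsSpecialType L I) {α : E}
    (hα : α ∉ L) (h : ¬ (Q.mod (Q.src α) = .cplx ∧ Q.mod (Q.tgt α) = .cplx)) :
    Q.IsPartner L α (Q.other L α) := by
  have hex : ∃ γ', Q.IsPartner L α γ' := by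
    by_cases hs : Q.mod (Q.src α) = .cplx
    · have ht : Q.mod (Q.tgt α) ≠ .cplx := fun ht => h ⟨hs, ht⟩
      exact ⟨α, Or.inr ⟨by rw [hs]; exact ht.symm, rfl⟩⟩
    · obtain ⟨a, a', ha⟩ := hI.exists_isOut hs
      rw [ha.eq_of_not_mem hα rfl]
      exact ⟨a', ha.1⟩
  unfold other
  rw [dif_pos hex]
  exact hex.choose_spec

end ModulatedQuiver

/-! ## The image of the matrices in the corner -/

namespace ModulatedQuiver

variable {V : Type u} {E : Type w} (Q : ModulatedQuiver V E) (L : Set E)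
  [Fintype V] (Z : Set (List (Q.SArrow L)))

open scoped Classical in
/-- Elements with `∑ k, rowU v k * colV v k = e_v`. -/
noncomputable def rowU (v : V) : Fin 2 → Q.SAlg L Z :=
  ![Q.eps L Z v, if Q.mod v = .real then Q.scal L Z Complex.I * Q.eps L Z v else 0]

open scoped Classical in
/-- Elements with `∑ k, rowU v k * colV v k = e_v`. -/
noncomputable def colV (v : V) : Fin 2 → Q.SAlg L Z :=
  ![Q.eps L Z v, if Q.mod v = .real then -(Q.eps L Z v * Q.scal L Z Complex.I) else 0]

theorem rowU_zero (v : V) : Q.rowU L Z v 0 = Q.eps L Z v := rfl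
theorem colV_zero (v : V) : Q.colV L Z v 0 = Q.eps L Z v := rfl

variable {Q} in
theorem rowU_one_real {v : V} (h : Q.mod v = .real) :
    Q.rowU L Z v 1 = Q.scal L Z Complex.I * Q.eps L Z v := if_pos h
variable {Q} in
theorem colV_one_real {v : V} (h : Q.mod v = .real) :
    Q.colV L Z v 1 = -(Q.eps L Z v * Q.scal L Z Complex.I) := if_pos h
variable {Q} in
theorem rowU_one_ne {v : V} (h : Q.mod v ≠ .real) : Q.rowU L Z v 1 = 0 := if_neg h
variable {Q} in
theorem colV_one_ne {v : V} (h : Q.mod v ≠ .real) : Q.colV L Z v 1 = 0 := if_neg h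

variable {Q} in
-- The loop anticommutes with `i`, so conjugation by `i` turns `(e_v + s_v)/2` into `(e_v - s_v)/2`;
-- writing `i` on both sides gives the negative. This is the reason why `ε` is full.
theorem scal_I_mul_eps_mul {v : V} (h : Q.mod v = .real) :
    Q.scal L Z Complex.I * Q.eps L Z v * (Q.eps L Z v * Q.scal L Z Complex.I) =
      (2⁻¹ : ℝ) • (Q.loop L Z v - Q.idem L Z v) := by
  have h1 : Q.scal L Z Complex.I * Q.scal L Z Complex.I = -1 := by
    rw [← map_mul, Complex.I_mul_I, map_neg, map_one]
  have h2 : Q.loop L Z v * Q.scal L Z Complex.I = - (Q.scal L Z Complex.I * Q.loop L Z v) := by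
    rw [loop_mul_scal, Complex.conj_I, map_neg, neg_mul]
  rw [mul_assoc, ← mul_assoc (Q.eps L Z v), eps_mul_eps, Q.eps_real L Z h, smul_mul_assoc,
    mul_smul_comm, add_mul, idem_mul_scal, h2, mul_add, mul_neg, ← mul_assoc, ← mul_assoc, h1]
  congr 1
  noncomm_ring

theorem sum_rowU_mul_colV (v : V) : ∑ k, Q.rowU L Z v k * Q.colV L Z v k = Q.idem L Z v := by
  rw [Fin.sum_univ_two, rowU_zero, colV_zero, eps_mul_eps]
  by_cases h : Q.mod v = .real
  · rw [rowU_one_real L Z h, colV_one_real L Z h, mul_neg, scal_I_mul_eps_mul L Z h,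
      Q.eps_real L Z h]
    module
  · rw [rowU_one_ne L Z h, zero_mul, add_zero, Q.eps_of_ne L Z h]

variable {Q L Z} in
-- With `ℝ` this is `s_v = ε_v - (e_v - ε_v)`; with `ℍ` it reads off the image of `k`, which is
-- `s_v`.
theorem sum_rowU_mul_loopHat {F : Q.TensorAlg →ₐ[ℝ] (Q.isIdempotentElem_epsSum L Z).Corner}
    (hF : ∀ v, ∀ x ∈ divSub (Q.mod v), (F (Q.vq v x)).1 = Q.kap L Z v x * Q.eps L Z v) {v : V}
    (hv : Q.mod v ≠ .cplx) :
    ∑ k, ∑ l, Q.rowU L Z v k * (Q.loopHat F v k l).1 * Q.colV L Z v l = Q.loop L Z v := by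
  by_cases h : Q.mod v = .real
  · have h1 : (F (Q.vq v 1)).1 = Q.eps L Z v := by
      rw [hF v 1 (one_mem _), kap_one, idem_mul_eps]
    have h2 : ((- F (Q.vq v 1) : (Q.isIdempotentElem_epsSum L Z).Corner)).1 = - Q.eps L Z v := by
      rw [← h1]; rfl
    have h3 : ((0 : (Q.isIdempotentElem_epsSum L Z).Corner)).1 = 0 := rfl
    rw [Q.loopHat_real F h]
    simp only [Fin.sum_univ_two, Matrix.of_apply, Matrix.cons_val', Matrix.cons_val_zero,
      Matrix.cons_val_one, Matrix.cons_val_fin_one, h1, h2, h3, mul_zero, zero_mul, add_zero,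
      zero_add, mul_neg, neg_mul]
    rw [rowU_zero, colV_zero, rowU_one_real L Z h, colV_one_real L Z h, mul_neg, neg_neg,
      mul_assoc (Q.scal L Z Complex.I), eps_mul_eps, eps_mul_eps,
      scal_I_mul_eps_mul L Z h, Q.eps_real L Z h]
    module
  · have hq : Q.mod v = .quat := by cases hh : Q.mod v <;> simp_all
    have h1 : (F (Q.vq v qk)).1 = Q.loop L Z v := by
      rw [hF v qk (by rw [hq]; exact mem_divSub_quat _), Q.eps_of_ne L Z h, kap_mul_idem, kap_apply]
      have : fstC qk = 0 := Complex.ext rfl rfl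
      have h' : sndC qk = 1 := Complex.ext rfl rfl
      rw [this, h', map_zero, map_one, zero_mul, one_mul, zero_add]
    rw [Q.loopHat_of_ne F h]
    simp only [Fin.sum_univ_two, rowU_one_ne L Z h, colV_one_ne L Z h, mul_zero, zero_mul, add_zero,
      Matrix.of_apply, Matrix.cons_val', Matrix.cons_val_zero, Matrix.cons_val_fin_one, h1]
    rw [rowU_zero, colV_zero, Q.eps_of_ne L Z h, idem_mul_loop, loop_mul_idem]

variable {Q L} in
theorem IsPartner.ord_eq (hL : Q.IsLabelling L) {a a' : E} (h : Q.IsPartner L a a') :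
    Q.ord L Z a' = Q.ord L Z a := by
  have : Q.base L a' = Q.base L a := by rw [h.base_eq hL, base_of_not_mem (h.not_mem hL)]
  unfold ord
  generalize Q.base L a' = x at *
  subst this
  rfl

variable {Q L Z} in
open scoped Classical in
-- Over the corner, `hat` is the matrix of the ordinary arrow with respect to `e_v = ∑ rowU v k *
-- colV v k`. The vanishing of matrix products thus becomes the vanishing of paths, and the matrix
-- entries of arrows lie in the image of `T(Q, M)`.
theorem hat_val (hL : Q.IsLabelling L)
    {F : Q.TensorAlg →ₐ[ℝ] (Q.isIdempotentElem_epsSum L Z).Corner}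
    (hF : ∀ α, ∀ x ∈ Q.arrowModule α, (F (Q.arr α x)).1 = Q.arrowMap L Z α x) {a a' : E}
    (haL : a ∉ L) (ha : ¬ (Q.mod (Q.src a) = .cplx ∧ Q.mod (Q.tgt a) = .cplx) → Q.IsPartner L a a')
    (i j : Fin 2) : (Q.hat F a a' i j).1 =
      Q.colV L Z (Q.tgt a) i * Q.ord L Z a * Q.rowU L Z (Q.src a) j := by
  have hn : ∀ x : (Q.isIdempotentElem_epsSum L Z).Corner, (-x).1 = -x.1 := fun _ => rfl
  have h0 : (0 : (Q.isIdempotentElem_epsSum L Z).Corner).1 = 0 := rfl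
  have hI : Q.kap L Z (Q.tgt a) qj = Q.scal L Z Complex.I * Q.idem L Z (Q.tgt a) := by
    rw [Q.kap_of_cplx L Z _ (by rw [mem_divSub_cplx]; simp)]
    rfl
  by_cases hC : Q.mod (Q.src a) = .cplx ∧ Q.mod (Q.tgt a) = .cplx
  · have hs : Q.mod (Q.src a) ≠ .real := by simp [hC]
    have ht : Q.mod (Q.tgt a) ≠ .real := by simp [hC]
    have hmem : (if Q.bar a then qk else 1) ∈ Q.arrowModule a := by
      rw [Q.mem_arrowModule hC.2 hC.1, mem_simpleBimodule]
      split_ifs with h <;> simp [h]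
    have hval : Q.arrowMap L Z a (if Q.bar a then qk else 1) = Q.ord L Z a := by
      split_ifs with h
      · rw [Q.arrowMap_bar L Z ⟨hC.2, hC.1, h⟩, mul_neg, qk_mul_qk, neg_neg, kap_one, idem_mul_core,
          Q.core_eq_ord L Z (Or.inl hC.1) hs ht]
      · rw [Q.arrowMap_left L Z (by simp [IsRight, hC]) (fun h' => h h'.2.2), kap_one, idem_mul_core,
          Q.core_eq_ord L Z (Or.inl hC.1) hs ht]
    rw [Q.hat_cplx_cplx F hC.2 hC.1]
    have hval' := hF a _ hmem
    rw [hval] at hval'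
    revert i j
    simp only [Fin.forall_fin_two, rowU_one_ne L Z hs, colV_one_ne L Z ht, mul_zero, zero_mul,
      Matrix.of_apply, Matrix.cons_val', Matrix.cons_val_zero, Matrix.cons_val_one,
      Matrix.cons_val_fin_one, hval', h0, rowU_zero, colV_zero, Q.eps_of_ne L Z hs,
      Q.eps_of_ne L Z ht, idem_mul_ord, ord_mul_idem, and_self]
  have hp := ha hC
  have hb : ¬ (Q.mod (Q.tgt a) = .cplx ∧ Q.mod (Q.src a) = .cplx ∧ Q.bar a) :=
    fun h => hC ⟨h.2.1, h.1⟩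
  have hb' : ¬ (Q.mod (Q.tgt a') = .cplx ∧ Q.mod (Q.src a') = .cplx ∧ Q.bar a') := by
    rw [hp.src_eq, hp.tgt_eq]
    exact fun h => hC ⟨h.2.1, h.1⟩
  have h1 : 1 ∈ Q.arrowModule a := Q.one_mem_arrowModule fun h => hC ⟨h.2, h.1⟩
  have h1' : 1 ∈ Q.arrowModule a' := Q.one_mem_arrowModule (by
    rw [hp.src_eq, hp.tgt_eq]; exact fun h => hC ⟨h.2, h.1⟩)
  have hF1 : (F (Q.arr a 1)).1 = Q.core L Z a := by
    rw [hF a 1 h1]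
    by_cases hr : Q.IsRight a
    · rw [Q.arrowMap_right L Z hr, kap_one, core_mul_idem]
    · rw [Q.arrowMap_left L Z hr hb, kap_one, idem_mul_core]
  have hcomm := Q.ord_mul_scal L Z hC
  by_cases ht : Q.mod (Q.tgt a) = .real
  · by_cases hs : Q.mod (Q.src a) = .real
    · obtain ⟨-, -, hL', -⟩ | ⟨h, -⟩ := hp
      swap
      · exact absurd (hs.trans ht.symm) h
      have hF2 : (F (Q.arr a' 1)).1 = -(Q.eps L Z (Q.tgt a) * (Q.scal L Z Complex.I * Q.ord L Z a) *
          Q.eps L Z (Q.src a)) := by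
        have hs' : Q.mod (Q.src a') = .real := by rw [(ha hC).src_eq, hs]
        have ht' : Q.mod (Q.tgt a') = .real := by rw [(ha hC).tgt_eq, ht]
        rw [hF a' 1 h1', Q.arrowMap_right L Z (Or.inl ht'), kap_one, core_mul_idem,
          Q.core_real' L Z ht' hs' hL', (ha hC).tgt_eq, (ha hC).src_eq,
          (ha hC).ord_eq Z hL]
      rw [Q.core_real L Z ht hs haL] at hF1
      rw [Q.hat_real_real F ht hs]
      revert i j
      have h2 : Q.scal L Z Complex.I * Q.scal L Z Complex.I = -1 := by
        rw [← map_mul, Complex.I_mul_I, map_neg, map_one]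
      simp only [Fin.forall_fin_two, rowU_one_real L Z hs, colV_one_real L Z ht, rowU_zero,
        colV_zero, Matrix.of_apply, Matrix.cons_val', Matrix.cons_val_zero, Matrix.cons_val_one,
        Matrix.cons_val_fin_one, hF1, hF2, hn, neg_neg, mul_assoc, neg_mul, true_and]
      simp only [← mul_assoc, hcomm]
      simp only [mul_assoc, true_and]
      rw [← mul_assoc (Q.scal L Z Complex.I), h2]
      simp
    · have hF2 : (F (Q.arr a qj)).1 =
          Q.eps L Z (Q.tgt a) * (Q.scal L Z Complex.I * Q.ord L Z a) * Q.eps L Z (Q.src a) := by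
        rw [hF a qj (Q.qj_mem_arrowModule (fun h => hC ⟨h.2, h.1⟩) fun h => hs h.2),
          Q.arrowMap_right L Z (Or.inl ht), Q.core_of_ne L Z (fun h => absurd (h ▸ ht) hs),
          Q.kap_of_cplx L Z _ (by rw [mem_divSub_cplx]; simp), Q.eps_of_ne L Z hs,
          mul_assoc (_ * _), ← mul_assoc (Q.idem L Z _), idem_mul_scal, mul_assoc (Q.scal L Z _),
          idem_mul_idem, ← mul_assoc, mul_assoc (Q.eps L Z _), hcomm]
        rfl
      rw [Q.core_of_ne L Z (fun h => absurd (h ▸ ht) hs)] at hF1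
      rw [Q.hat_real_ne F ht hs]
      revert i j
      simp only [Fin.forall_fin_two, rowU_one_ne L Z hs, colV_one_real L Z ht, rowU_zero,
        colV_zero, Matrix.of_apply, Matrix.cons_val', Matrix.cons_val_zero, Matrix.cons_val_one,
        Matrix.cons_val_fin_one, hF1, hF2, hn, h0, mul_zero, mul_assoc, neg_mul, and_self]
  have hr : ¬ (Q.mod (Q.src a) = .real ∧ Q.IsRight a) := by
    rintro ⟨h, h' | h'⟩
    · exact ht h'
    · rw [h] at h'; simp at h'
  by_cases hs : Q.mod (Q.src a) = .real
  · have hF2 : (F (Q.arr a qj)).1 =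
          Q.eps L Z (Q.tgt a) * (Q.scal L Z Complex.I * Q.ord L Z a) * Q.eps L Z (Q.src a) := by
      rw [hF a qj (Q.qj_mem_arrowModule (fun h => hC ⟨h.2, h.1⟩) fun h => ht h.1),
        Q.arrowMap_left L Z (fun h => hr ⟨hs, h⟩) hb,
        Q.core_of_ne L Z (fun h => absurd (h ▸ hs) ht), hI, Q.eps_of_ne L Z ht, ← idem_mul_scal,
        idem_mul_ord, mul_assoc, ← mul_assoc]
      simp only [mul_assoc]
    rw [Q.core_of_ne L Z (fun h => absurd (h ▸ hs) ht)] at hF1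
    rw [Q.hat_ne_real F ht hs]
    revert i j
    simp only [Fin.forall_fin_two, rowU_one_real L Z hs, colV_one_ne L Z ht, rowU_zero,
      colV_zero, Matrix.of_apply, Matrix.cons_val', Matrix.cons_val_zero, Matrix.cons_val_one,
      Matrix.cons_val_fin_one, hF1, hF2, h0, zero_mul, and_self, and_true, true_and]
    rw [← hcomm]
    simp only [mul_assoc]
  by_cases hq : Q.mod (Q.tgt a) = .quat ∧ Q.mod (Q.src a) = .quat
  · obtain ⟨htq, hsq⟩ := hq
    obtain ⟨-, -, hL', -⟩ | ⟨h, -⟩ := hp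
    swap
    · exact absurd (hsq.trans htq.symm) h
    have hF2 : (F (Q.arr a' qj)).1 = Q.scal L Z Complex.I * -(Q.scal L Z Complex.I *
        (Q.ord L Z a + Q.loop L Z (Q.tgt a) * Q.ord L Z a * Q.loop L Z (Q.src a))) := by
      have hs' : Q.mod (Q.src a') = .quat := by rw [(ha hC).src_eq, hsq]
      have ht' : Q.mod (Q.tgt a') = .quat := by rw [(ha hC).tgt_eq, htq]
      rw [hF a' qj (Q.mem_arrowModule_quat_left ht' _), Q.arrowMap_left L Z
        (by simp [IsRight, hs', ht']) hb', (ha hC).tgt_eq, hI, mul_assoc, ← (ha hC).tgt_eq,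
        idem_mul_core, Q.core_quat' L Z ht' hs' hL', (ha hC).tgt_eq, (ha hC).src_eq,
        (ha hC).ord_eq Z hL]
    have h2 : Q.scal L Z Complex.I * Q.scal L Z Complex.I = -1 := by
      rw [← map_mul, Complex.I_mul_I, map_neg, map_one]
    rw [Q.core_quat L Z htq hsq haL] at hF1
    rw [Q.hat_quat_quat F htq hsq]
    -- The average of `α - sαs` and `α + sαs`; the coefficient `qj` cancels the factor `-i` in the
    -- core of `γⁱ`.
    have hval : ((2⁻¹ : ℝ) • (F (Q.arr a 1) + F (Q.arr a' qj))).1 = Q.ord L Z a := by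
      rw [IsIdempotentElem.corner_val_smul, IsIdempotentElem.corner_val_add, hF1, hF2, mul_neg,
        ← mul_assoc, h2, neg_one_mul, neg_neg]
      module
    revert i j
    simp only [Fin.forall_fin_two, rowU_one_ne L Z hs, colV_one_ne L Z ht, mul_zero, zero_mul,
      Matrix.of_apply, Matrix.cons_val', Matrix.cons_val_zero, Matrix.cons_val_one,
      Matrix.cons_val_fin_one, hval, h0, rowU_zero, colV_zero, Q.eps_of_ne L Z hs,
      Q.eps_of_ne L Z ht, idem_mul_ord, ord_mul_idem, and_self]
  · have hh : Q.hat F a a' = !![F (Q.arr a 1), 0; 0, 0] := by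
      cases ht' : Q.mod (Q.tgt a) <;> cases hs' : Q.mod (Q.src a) <;> simp_all
      · exact Q.hat_cplx_quat F ht' hs'
      · exact Q.hat_quat_cplx F ht' hs'
    rw [Q.core_of_ne L Z (fun h => by
      cases ht' : Q.mod (Q.tgt a) <;> cases hs' : Q.mod (Q.src a) <;> simp_all)] at hF1
    rw [hh]
    revert i j
    simp only [Fin.forall_fin_two, rowU_one_ne L Z hs, colV_one_ne L Z ht, mul_zero, zero_mul,
      Matrix.of_apply, Matrix.cons_val', Matrix.cons_val_zero, Matrix.cons_val_one,
      Matrix.cons_val_fin_one, hF1, h0, rowU_zero, colV_zero, and_self]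

end ModulatedQuiver

/-! ## The homomorphism to the corner respects the relations -/

namespace ModulatedQuiver

variable {V : Type u} {E : Type w} {Q : ModulatedQuiver V E} {L : Set E}

variable (Q) in
-- Used twice: for the projection to `T(Q, M)/I`, so that the matrices satisfy `Z'`, and for the
-- homomorphism to the corner, so that it kills `I`.
theorem map_gens_eq_zero_iff {R : Type*} [Ring R] [Algebra ℝ R] (F : Q.TensorAlg →ₐ[ℝ] R)
    {a a' b b' : E} (hab : Q.src a = Q.tgt b) (hv : Q.mod (Q.src a) ≠ .cplx)
    (ha : Q.IsPartner L a a') (hb : Q.IsPartner L b b') (p : Fin 2) :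
    (∀ r ∈ Q.gens p a a' b b', F r = 0) ↔
      Q.hat F a a' * (if p = 0 then 1 else Q.loopHat F (Q.src a)) * Q.hat F b b' = 0 := by
  by_cases h : Q.mod (Q.src a) = .real
  · by_cases h' : Q.mod (Q.tgt a) = .real
    · exact Q.map_gens_eq_zero_iff_real_real F hab ha.src_eq h h' p
    · exact Q.map_gens_eq_zero_iff_ne_real F hab h h' p
  · exact Q.map_gens_eq_zero_iff_quat F hab ha.src_eq hb.tgt_eq
      (by cases hh : Q.mod (Q.src a) <;> simp_all) p (fun _ => ha.tgt_eq) fun _ => hb.src_eq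

theorem mem_pathSpace_induction {α β : E} {p : Q.TensorAlg → Prop}
    (h : ∀ x ∈ Q.arrowModule α, ∀ y ∈ Q.arrowModule β, p (Q.arr α x * Q.arr β y))
    (h' : ∀ x y, p x → p y → p (x + y)) {x : Q.TensorAlg} (hx : x ∈ Q.pathSpace α β) : p x := by
  refine Submodule.mul_induction_on hx ?_ h'
  rintro _ ⟨⟨x, hx⟩, rfl⟩ _ ⟨⟨y, hy⟩, rfl⟩
  have := h x hx y hy
  rwa [Q.arr_of_mem hx, Q.arr_of_mem hy] at this

variable (Q) in
theorem bimoduleSpan_le {W : Submodule ℝ Q.TensorAlg} {w u : V} {R : Set Q.TensorAlg}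
    (h : ∀ (c : DivRing (Q.mod w)) (d : DivRing (Q.mod u)), ∀ r ∈ R,
      Q.vtx w c * r * Q.vtx u d ∈ W) : Q.bimoduleSpan w u R ≤ W := by
  refine Submodule.span_le.mpr ?_
  rintro _ ⟨c, r, hr, d, rfl⟩
  exact h c d r hr

/-- The labelling determines `a`, `a'`, `b`, `b'` from `v`, so the supremum has a single term. -/
theorem special_eq (hL : Q.IsLabelling L) (p : Fin 2) {v : V} {a a' b b' : E}
    (ha : Q.IsOut L v a a') (hb : Q.IsIn L v b b') :
    Q.special L p v = Q.bimoduleSpan (Q.tgt a) (Q.src b) (Q.gens p a a' b b') := by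
  apply le_antisymm
  · refine iSup_le fun c => iSup_le fun c' => iSup_le fun d => iSup_le fun d' => iSup_le fun hc =>
      iSup_le fun hd => ?_
    obtain rfl := ha.eq_of_not_mem (hc.1.not_mem hL) hc.src_eq
    obtain rfl := hb.eq_of_not_mem (hd.1.not_mem hL) hd.tgt_eq
    obtain rfl := ha.1.unique hL hc.1
    obtain rfl := hb.1.unique hL hd.1
    unfold gens
    rw [hc.src_eq]
  · refine le_iSup_of_le a <| le_iSup_of_le a' <| le_iSup_of_le b <| le_iSup_of_le b' <|
      le_iSup_of_le ha <| le_iSup_of_le hb ?_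
    unfold gens
    rw [ha.src_eq]

variable (Q) in
-- Reduces linear statements about generators to pure tensors, so that the case list is traversed
-- only once.
theorem gens_subset {p : Fin 2} {a a' b b' : E} {W : Submodule ℝ Q.TensorAlg}
    (h : ∀ x y, Q.tens x a y b ∈ W) (h' : ∀ x y, Q.tens x a y b' ∈ W)
    (h'' : ∀ x y, Q.tens x a' y b ∈ W) (h''' : ∀ x y, Q.tens x a' y b' ∈ W) :
    Q.gens p a a' b b' ⊆ W := by
  intro r hr
  unfold gens at hr
  obtain rfl | rfl : p = 0 ∨ p = 1 := by omega
  · rw [if_pos rfl] at hr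
    revert hr
    cases Q.mod (Q.src b) <;> cases Q.mod (Q.src a) <;> cases Q.mod (Q.tgt a) <;>
      simp only [gen0, Set.mem_insert_iff, Set.mem_singleton_iff, Set.mem_empty_iff_false,
        false_implies] <;> intro hr <;>
      (first | rw [hr] | (rcases hr with hr | hr <;> rw [hr])) <;>
      apply_rules [Submodule.add_mem, Submodule.sub_mem, Submodule.neg_mem]
  · rw [if_neg (by simp)] at hr
    revert hr
    cases Q.mod (Q.src b) <;> cases Q.mod (Q.src a) <;> cases Q.mod (Q.tgt a) <;>
      simp only [gen1, Set.mem_insert_iff, Set.mem_singleton_iff, Set.mem_empty_iff_false,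
        false_implies] <;> intro hr <;>
      (first | rw [hr] | (rcases hr with hr | hr <;> rw [hr])) <;>
      apply_rules [Submodule.add_mem, Submodule.sub_mem, Submodule.neg_mem]

/-- Each generator is `1 * r * 1` for the units of `M(w)` and `M(u)`: both arrows leaving `v` end at
`w` and both arrows entering `v` start at `u`. -/
theorem gens_subset_special (hL : Q.IsLabelling L) (p : Fin 2) {v : V} {a a' b b' : E}
    (ha : Q.IsOut L v a a') (hb : Q.IsIn L v b b') :
    Q.gens p a a' b b' ⊆ Q.special L p v := by
  intro r hr
  have h1 : ∀ c c' x y d d', Q.tgt c' = Q.tgt c → Q.src d' = Q.src d →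
      Q.vq (Q.tgt c) 1 * Q.tens x c' y d' * Q.vq (Q.src d) 1 = Q.tens x c' y d' := by
    intro c c' x y d d' hc hd
    rw [← hc, ← hd]
    unfold tens
    rw [← mul_assoc, one_vq_mul_arr, mul_assoc, arr_mul_one_vq]
  have key : r ∈ LinearMap.eqLocus LinearMap.id (LinearMap.mulRight ℝ (Q.vq (Q.src b) 1) ∘ₗ
      LinearMap.mulLeft ℝ (Q.vq (Q.tgt a) 1)) := by
    refine Q.gens_subset (fun x y => ?_) (fun x y => ?_) (fun x y => ?_) (fun x y => ?_) hr
    · exact (h1 a a x y b b rfl rfl).symm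
    · exact (h1 a a x y b b' rfl hb.1.src_eq).symm
    · exact (h1 a a' x y b b ha.1.tgt_eq rfl).symm
    · exact (h1 a a' x y b b' ha.1.tgt_eq hb.1.src_eq).symm
  rw [special_eq hL p ha hb]
  refine Submodule.subset_span ⟨1, r, hr, 1, ?_⟩
  rw [← Q.vq_toQuat, ← Q.vq_toQuat, map_one (toQuat _), map_one (toQuat _)]
  exact key

theorem localIdeal_of_inArrows_eq_empty (I : TwoSidedIdeal Q.TensorAlg) {v : V}
    (h : Q.inArrows v = ∅) : Q.localIdeal I v = ⊥ := by
  unfold localIdeal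
  simp [h]

theorem localIdeal_of_outArrows_eq_empty (I : TwoSidedIdeal Q.TensorAlg) {v : V}
    (h : Q.outArrows v = ∅) : Q.localIdeal I v = ⊥ := by
  unfold localIdeal
  simp [h]

theorem not_mem_of_cplx (hL : Q.IsLabelling L) {α : E}
    (h : Q.mod (Q.src α) = .cplx ∨ Q.mod (Q.tgt α) = .cplx) : α ∉ L := fun hα => by
  have := hL.mod_eq α hα
  rw [← this.1, or_self] at h
  exact this.2 h

/-- To show that an algebra homomorphism kills an ideal of special type, it is enough to consider
the paths through the vertices with `ℂ` and the generators of the `I_v^p`. -/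
theorem IsSpecialType.map_eq_zero (hL : Q.IsLabelling L) {I : TwoSidedIdeal Q.TensorAlg}
    (hI : Q.IsSpecialType L I) {R : Type*} [Ring R] [Algebra ℝ R] (F : Q.TensorAlg →ₐ[ℝ] R)
    (hC : ∀ α β, Q.src α = Q.tgt β → Q.mod (Q.src α) = .cplx →
      Q.pathSpace α β ≤ Q.localIdeal I (Q.src α) → ∀ x ∈ Q.pathSpace α β, F x = 0)
    (hS : ∀ v a a' b b', Q.IsOut L v a a' → Q.IsIn L v b b' → Q.mod v ≠ .cplx →
      ∀ p : Fin 2, Q.localIdeal I v = Q.special L p v → ∀ r ∈ Q.gens p a a' b b', F r = 0)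
    {x : Q.TensorAlg} (hx : x ∈ I) : F x = 0 := by
  rw [hI.generated] at hx
  refine TwoSidedIdeal.eq_zero_of_mem_span F.toRingHom (fun y hy => ?_) hx
  obtain ⟨v, hy⟩ := Set.mem_iUnion.mp hy
  suffices h : Q.localIdeal I v ≤ LinearMap.ker F.toLinearMap from h hy
  by_cases hv : Q.mod v = .cplx
  · have hg := hI.ordinarilyGentle hv
    rw [hg.localIdeal_eq]
    refine iSup_le fun α => iSup_le fun hα => iSup_le fun β => iSup_le fun hβ => iSup_le fun h => ?_
    have hα' : Q.src α = v := hα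
    have hβ' : Q.tgt β = v := hβ
    refine fun x hx => hC α β (by rw [hα', hβ']) (by rw [hα', hv]) ?_ x hx
    refine le_inf ?_ h
    rw [hα']
    exact le_iSup₂_of_le α hα (le_iSup₂_of_le β hβ le_rfl)
  · obtain ⟨⟨a, a', ha⟩, ⟨b, b', hb⟩, h⟩ | ⟨h, -⟩ | ⟨h, -⟩ := (hI.speciallyGentle hv).2
    · obtain ⟨p, hp⟩ : ∃ p : Fin 2, Q.localIdeal I v = Q.special L p v := by
        rcases h with h | h
        · exact ⟨0, h.1⟩
        · exact ⟨1, h.1⟩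
      rw [hp, special_eq hL p ha hb]
      refine Q.bimoduleSpan_le fun c d r hr => ?_
      change F (_ * r * _) = 0
      rw [map_mul, map_mul, hS v a a' b b' ha hb hv p hp r hr, mul_zero, zero_mul]
    · rw [localIdeal_of_inArrows_eq_empty I h]
      exact bot_le
    · rw [localIdeal_of_outArrows_eq_empty I h]
      exact bot_le

variable [Fintype V] {Z : Set (List (Q.SArrow L))}

/-- A homomorphism to the corner of `ℂ_{σ'} Q^s / ⟨S ∪ Z⟩`, given on generators by `kap` and
`arrowMap`. -/
structure IsToCorner (F : Q.TensorAlg →ₐ[ℝ] (Q.isIdempotentElem_epsSum L Z).Corner) : Prop where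
  vq : ∀ v, ∀ x ∈ divSub (Q.mod v), (F (Q.vq v x)).1 = Q.kap L Z v x * Q.eps L Z v
  arr : ∀ α, ∀ x ∈ Q.arrowModule α, (F (Q.arr α x)).1 = Q.arrowMap L Z α x

variable {F : Q.TensorAlg →ₐ[ℝ] (Q.isIdempotentElem_epsSum L Z).Corner}

/-- Nothing is lost by passing to entries, because multiplying by `rowU` and `colV` and summing
restores `e_{t(a)}` on the left and `e_{s(b)}` on the right. -/
theorem mul_ord_mul_eq_zero_iff (a b : E) (y : Q.SAlg L Z) :
    (∀ i j, Q.colV L Z (Q.tgt a) i * (Q.ord L Z a * y * Q.ord L Z b) *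
      Q.rowU L Z (Q.src b) j = 0) ↔ Q.ord L Z a * y * Q.ord L Z b = 0 := by
  refine ⟨fun h => ?_, fun h i j => by rw [h, mul_zero, zero_mul]⟩
  have h1 : ∀ j, Q.ord L Z a * y * Q.ord L Z b * Q.rowU L Z (Q.src b) j = 0 := fun j => by
    rw [← Q.idem_mul_ord L Z a, ← sum_rowU_mul_colV, Finset.sum_mul, Finset.sum_mul,
      Finset.sum_mul, Finset.sum_mul]
    refine Finset.sum_eq_zero fun k _ => ?_
    have := congrArg (Q.rowU L Z (Q.tgt a) k * ·) (h k j)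
    simpa only [mul_assoc, mul_zero] using this
  rw [← Q.ord_mul_idem L Z b, ← sum_rowU_mul_colV, Finset.mul_sum, Finset.mul_sum]
  refine Finset.sum_eq_zero fun k _ => ?_
  have := congrArg (· * Q.colV L Z (Q.src b) k) (h1 k)
  simpa only [mul_assoc, zero_mul] using this

/-- In the matrix product the inner sums `∑ rowU * colV` collapse to `e_v`, or to `s_v` if the loop
matrix stands between. The entries are therefore those of `a s_v^p b`. -/
theorem IsToCorner.map_gens_eq_zero_iff (hL : Q.IsLabelling L) (hF : IsToCorner F) {a a' b b' : E}
    (hab : Q.src a = Q.tgt b) (hv : Q.mod (Q.src a) ≠ .cplx) (ha : Q.IsPartner L a a')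
    (hb : Q.IsPartner L b b') (p : Fin 2) :
    (∀ r ∈ Q.gens p a a' b b', F r = 0) ↔
      Q.ord L Z a * (if p = 0 then 1 else Q.loop L Z (Q.src a)) * Q.ord L Z b = 0 := by
  rw [Q.map_gens_eq_zero_iff F hab hv ha hb p, ← mul_ord_mul_eq_zero_iff, ← Matrix.ext_iff]
  refine forall_congr' fun i => forall_congr' fun j => ?_
  have hA := fun i k => hat_val hL hF.arr (ha.not_mem hL) (fun _ => ha) i k
  have hB := fun l j => hat_val hL hF.arr (hb.not_mem hL) (fun _ => hb) l j
  refine Subtype.ext_iff.trans (Eq.congr ?_ rfl)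
  by_cases hp : p = 0
  · rw [if_pos hp, if_pos hp, mul_one, Matrix.mul_apply, IsIdempotentElem.corner_val_sum]
    simp only [IsIdempotentElem.corner_val_mul, hA, hB]
    rw [mul_one]
    conv_rhs => rw [← Q.ord_mul_idem L Z a, ← sum_rowU_mul_colV]
    simp only [Finset.mul_sum, Finset.sum_mul, mul_assoc, ← hab]
  · rw [if_neg hp, if_neg hp, mul_assoc, Matrix.mul_apply, IsIdempotentElem.corner_val_sum,
      ← sum_rowU_mul_loopHat hF.vq hv]
    simp only [IsIdempotentElem.corner_val_mul, hA, hB, Matrix.mul_apply,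
      IsIdempotentElem.corner_val_sum]
    simp only [Finset.mul_sum, Finset.sum_mul, mul_assoc, ← hab]

/-- At a source with `ℂ` the scalars can be moved to the left of the arrow. Together with its
counterpart for targets, this lets the one relation `α β = 0` kill all of `M(αβ)`. -/
theorem exists_arrowMap_eq_mul_ord {α : E} (hs : Q.mod (Q.src α) = .cplx) {x : ℍ[ℝ]}
    (hx : x ∈ Q.arrowModule α) : ∃ y, Q.arrowMap L Z α x = y * Q.ord L Z α := by
  have hs' : Q.mod (Q.src α) ≠ .real := by simp [hs]
  have hcore : Q.core L Z α = Q.eps L Z (Q.tgt α) * Q.ord L Z α := by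
    rw [Q.core_of_ne L Z (fun _ => hs), Q.eps_of_ne L Z hs', mul_assoc, ord_mul_idem]
  by_cases hr : Q.IsRight α
  · obtain ht | ⟨-, h⟩ := hr
    · have hx' : x ∈ divSub .cplx := by
        rw [Q.mem_arrowModule ht hs, mem_simpleBimodule] at hx
        rw [mem_divSub_cplx]
        exact hx
      refine ⟨Q.eps L Z (Q.tgt α) * Q.scal L Z (fstC x), ?_⟩
      rw [Q.arrowMap_right L Z (Or.inl ht), Q.kap_of_cplx L Z _ hx', ← idem_mul_scal, ← mul_assoc,
        core_mul_idem, hcore, mul_assoc, Q.ord_mul_scal L Z (by simp [ht]), mul_assoc]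
    · rw [hs] at h; simp at h
  · by_cases hb : Q.mod (Q.tgt α) = .cplx ∧ Q.mod (Q.src α) = .cplx ∧ Q.bar α
    · exact ⟨_, by rw [Q.arrowMap_bar L Z hb, hcore, ← mul_assoc]⟩
    · exact ⟨_, by rw [Q.arrowMap_left L Z hr hb, hcore, ← mul_assoc]⟩

theorem exists_arrowMap_eq_ord_mul {α : E} (hα : α ∉ L) (ht : Q.mod (Q.tgt α) = .cplx) {x : ℍ[ℝ]}
    (hx : x ∈ Q.arrowModule α) : ∃ y, Q.arrowMap L Z α x = Q.ord L Z α * y := by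
  have ht' : Q.mod (Q.tgt α) ≠ .real := by simp [ht]
  have hcore : Q.core L Z α = Q.ord L Z α * Q.eps L Z (Q.src α) := by
    rw [Q.core_of_ne L Z (fun h => by rw [← h, ht]), Q.eps_of_ne L Z ht', idem_mul_ord]
  have hscal : ∀ c, ∃ d, Q.scal L Z c * Q.ord L Z α = Q.ord L Z α * Q.scal L Z d := fun c => by
    by_cases hC : Q.mod (Q.src α) = .cplx ∧ Q.mod (Q.tgt α) = .cplx
    · by_cases hb : Q.bar α
      · refine ⟨starRingEnd ℂ c, ?_⟩
        rw [Q.ord_mul_scal_cplx L Z hα hC, if_pos hb, Complex.conj_conj]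
      · refine ⟨c, ?_⟩
        rw [Q.ord_mul_scal_cplx L Z hα hC, if_neg hb]
    · exact ⟨c, (Q.ord_mul_scal L Z hC c).symm⟩
  have hkap : ∀ y ∈ divSub .cplx, ∃ z, Q.kap L Z (Q.tgt α) y * Q.core L Z α =
      Q.ord L Z α * z := fun y hy => by
    obtain ⟨d, hd⟩ := hscal (fstC y)
    refine ⟨Q.scal L Z d * Q.eps L Z (Q.src α), ?_⟩
    rw [Q.kap_of_cplx L Z _ hy, mul_assoc, idem_mul_core, hcore, ← mul_assoc, hd, mul_assoc]
  by_cases hr : Q.IsRight α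
  · exact ⟨_, by rw [Q.arrowMap_right L Z hr, hcore, mul_assoc]⟩
  · by_cases hb : Q.mod (Q.tgt α) = .cplx ∧ Q.mod (Q.src α) = .cplx ∧ Q.bar α
    · rw [Q.arrowMap_bar L Z hb]
      refine hkap _ ?_
      rw [Q.mem_arrowModule ht hb.2.1, mem_simpleBimodule] at hx
      rw [mem_divSub_cplx]
      simp [hx.2 hb.2.2]
    · rw [Q.arrowMap_left L Z hr hb]
      refine hkap _ ?_
      cases hs : Q.mod (Q.src α)
      · rw [Q.mem_arrowModule ht hs, mem_simpleBimodule] at hx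
        rw [mem_divSub_cplx]
        exact hx
      · rw [Q.mem_arrowModule ht hs, mem_simpleBimodule] at hx
        rw [mem_divSub_cplx]
        exact hx.1 fun h => hb ⟨ht, hs, h⟩
      · exact absurd (Or.inr ⟨ht, hs⟩) hr

theorem IsToCorner.map_pathSpace (hF : IsToCorner F) {α β : E} (hβ : β ∉ L)
    (hv : Q.mod (Q.src α) = .cplx) (hαβ : Q.src α = Q.tgt β)
    (h0 : Q.ord L Z α * Q.ord L Z β = 0) {x : Q.TensorAlg} (hx : x ∈ Q.pathSpace α β) :
    F x = 0 := by
  refine mem_pathSpace_induction (p := fun x => F x = 0) (fun x hx y hy => ?_) (fun x y hx hy => ?_) hx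
  · obtain ⟨c, hc⟩ := exists_arrowMap_eq_mul_ord (Z := Z) hv hx
    obtain ⟨d, hd⟩ := exists_arrowMap_eq_ord_mul (Z := Z) hβ (hαβ ▸ hv) hy
    apply Subtype.ext
    rw [map_mul, IsIdempotentElem.corner_val_mul, hF.arr α x hx, hF.arr β y hy, hc, hd, mul_assoc,
      ← mul_assoc (Q.ord L Z α), h0, zero_mul, mul_zero]
    rfl
  · rw [map_add, hx, hy, add_zero]

theorem ord_mul_ord_eq_zero {α β : E} (hα : α ∉ L) (hβ : β ∉ L)
    (h : [Sum.inl ⟨α, hα⟩, Sum.inl ⟨β, hβ⟩] ∈ Z) : Q.ord L Z α * Q.ord L Z β = 0 := by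
  rw [Q.ord_of_not_mem hα, Q.ord_of_not_mem hβ]
  simpa using (Q.sQuiver L).prod_arw_eq_zero (Q.twist' L) Z h

theorem ord_mul_loop_mul_ord_eq_zero {α β : E} (hα : α ∉ L) (hβ : β ∉ L) {v : V}
    (hv : Q.mod v ≠ .cplx) (h : [Sum.inl ⟨α, hα⟩, Sum.inr ⟨v, hv⟩, Sum.inl ⟨β, hβ⟩] ∈ Z) :
    Q.ord L Z α * Q.loop L Z v * Q.ord L Z β = 0 := by
  rw [Q.ord_of_not_mem hα, Q.ord_of_not_mem hβ, Q.loop_of_ne L Z hv]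
  simpa [mul_assoc] using (Q.sQuiver L).prod_arw_eq_zero (Q.twist' L) Z h

theorem IsToCorner.map_eq_zero (hL : Q.IsLabelling L) {I : TwoSidedIdeal Q.TensorAlg}
    (hI : Q.IsSpecialType L I)
    {F : Q.TensorAlg →ₐ[ℝ] (Q.isIdempotentElem_epsSum L (Q.zeroSet' L I)).Corner}
    (hF : IsToCorner F) {x : Q.TensorAlg} (hx : x ∈ I) : F x = 0 := by
  refine hI.map_eq_zero hL F (fun α β hαβ hv hle x hx => ?_)
    (fun v a a' b b' ha hb hv p hp => ?_) hx
  · have hα := not_mem_of_cplx hL (Or.inl hv)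
    have hβ := not_mem_of_cplx hL (α := β) (Or.inr (hαβ ▸ hv))
    refine hF.map_pathSpace hβ hv hαβ (ord_mul_ord_eq_zero hα hβ (Or.inr ?_)) hx
    exact ⟨⟨α, hα⟩, ⟨β, hβ⟩, hαβ, hv, hle, rfl⟩
  · have haL := ha.1.not_mem hL
    have hbL := hb.1.not_mem hL
    have hab : Q.src a = Q.tgt b := by rw [ha.src_eq, hb.tgt_eq]
    have hv' : Q.mod (Q.src a) ≠ .cplx := by rwa [ha.src_eq]
    rw [hF.map_gens_eq_zero_iff hL hab hv' ha.1 hb.1 p]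
    rw [← ha.src_eq] at hp
    obtain rfl | rfl : p = 0 ∨ p = 1 := by omega
    · rw [if_pos rfl, mul_one]
      exact ord_mul_ord_eq_zero haL hbL
        (Or.inl ⟨⟨a, haL⟩, ⟨b, hbL⟩, hab, hv', Or.inl ⟨hp, rfl⟩⟩)
    · rw [if_neg (by simp)]
      exact ord_mul_loop_mul_ord_eq_zero haL hbL hv'
        (Or.inl ⟨⟨a, haL⟩, ⟨b, hbL⟩, hab, hv', Or.inr ⟨hp, rfl⟩⟩)

end ModulatedQuiver

/-! ## Matrices over a `T(Q, M)`-ring which satisfy the relations of `ℂ_{σ'} Q^s / ⟨S ∪ Z'⟩` -/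

namespace ModulatedQuiver

variable {V : Type u} {E : Type w} (Q : ModulatedQuiver V E) {R : Type*} [Ring R] [Algebra ℝ R]
  (F : Q.TensorAlg →ₐ[ℝ] R)

/-- The matrix corresponding to an idempotent. -/
noncomputable def oneHat (v : V) : Matrix (Fin 2) (Fin 2) R :=
  !![F (Q.vq v 1), 0; 0, F (Q.vq v 1)]

/-- The matrix corresponding to `i e_v`. -/
noncomputable def imHat (v : V) : Matrix (Fin 2) (Fin 2) R :=
  match Q.mod v with
  -- The rotation by which `i` acts on `ℂ = ℝ²`.
  | .real => !![0, - F (Q.vq v 1); F (Q.vq v 1), 0]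
  | _ => !![F (Q.vq v qj), 0; 0, F (Q.vq v qj)]

theorem imHat_real {v : V} (h : Q.mod v = .real) :
    Q.imHat F v = !![0, - F (Q.vq v 1); F (Q.vq v 1), 0] := by
  unfold imHat; rw [h]

theorem imHat_of_ne {v : V} (h : Q.mod v ≠ .real) :
    Q.imHat F v = !![F (Q.vq v qj), 0; 0, F (Q.vq v qj)] := by
  unfold imHat; cases h' : Q.mod v <;> simp_all

theorem map_vq_mul {v : V} {x y : ℍ[ℝ]} (hx : x ∈ divSub (Q.mod v)) (hy : y ∈ divSub (Q.mod v)) :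
    F (Q.vq v x) * F (Q.vq v y) = F (Q.vq v (x * y)) := by
  rw [← map_mul, Q.vq_mul_vq hx hy]

theorem map_vq_mul_of_ne {v v' : V} (h : v ≠ v') (x y : ℍ[ℝ]) :
    F (Q.vq v x) * F (Q.vq v' y) = 0 := by
  rw [← map_mul, Q.vq_mul_vq_of_ne h, map_zero]

theorem oneHat_mul_oneHat (v : V) : Q.oneHat F v * Q.oneHat F v = Q.oneHat F v := by
  simp [oneHat, Q.map_vq_mul F (one_mem_divSub _) (one_mem_divSub _)]

theorem oneHat_mul_oneHat_of_ne {v v' : V} (h : v ≠ v') : Q.oneHat F v * Q.oneHat F v' = 0 := by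
  simp [oneHat, Q.map_vq_mul_of_ne F h]
  exact (Matrix.ext_iff.mp (by simp [Fin.forall_fin_two]))

theorem sum_oneHat [Fintype V] : ∑ v, Q.oneHat F v = 1 := by
  have h : ∑ v, F (Q.vq v 1) = 1 := by rw [← map_sum, sum_vq_one, map_one]
  ext i j
  rw [Matrix.sum_apply]
  fin_cases i <;> fin_cases j <;> simp [oneHat, h]

theorem oneHat_mul_imHat (v : V) : Q.oneHat F v * Q.imHat F v = Q.imHat F v := by
  by_cases h : Q.mod v = .real
  · simp [oneHat, Q.imHat_real F h, Q.map_vq_mul F (one_mem_divSub _) (one_mem_divSub _)]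
  · simp [oneHat, Q.imHat_of_ne F h, Q.map_vq_mul F (one_mem_divSub _) (mem_divSub_of_ne_real h)]

theorem imHat_mul_oneHat (v : V) : Q.imHat F v * Q.oneHat F v = Q.imHat F v := by
  by_cases h : Q.mod v = .real
  · simp [oneHat, Q.imHat_real F h, Q.map_vq_mul F (one_mem_divSub _) (one_mem_divSub _)]
  · simp [oneHat, Q.imHat_of_ne F h, Q.map_vq_mul F (mem_divSub_of_ne_real h) (one_mem_divSub _)]

theorem imHat_mul_imHat (v : V) : Q.imHat F v * Q.imHat F v = - Q.oneHat F v := by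
  by_cases h : Q.mod v = .real
  · simp [oneHat, Q.imHat_real F h, Q.map_vq_mul F (one_mem_divSub _) (one_mem_divSub _)]
  · simp [oneHat, Q.imHat_of_ne F h, Q.map_vq_mul F (mem_divSub_of_ne_real h)
      (mem_divSub_of_ne_real h)]

variable {v : V} (hv : Q.mod v ≠ .cplx)

include hv in
theorem qk_mem_of_ne_real (h : Q.mod v ≠ .real) (x : ℍ[ℝ]) : x ∈ divSub (Q.mod v) := by
  cases h' : Q.mod v
  · exact absurd h' h
  · exact absurd h' hv
  · exact mem_divSub_quat _

include hv

theorem oneHat_mul_loopHat : Q.oneHat F v * Q.loopHat F v = Q.loopHat F v := by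
  by_cases h : Q.mod v = .real
  · simp [oneHat, Q.loopHat_real F h, Q.map_vq_mul F (one_mem_divSub _) (one_mem_divSub _)]
  · simp [oneHat, Q.loopHat_of_ne F h, Q.map_vq_mul F (one_mem_divSub _)
      (Q.qk_mem_of_ne_real hv h _)]

theorem loopHat_mul_oneHat : Q.loopHat F v * Q.oneHat F v = Q.loopHat F v := by
  by_cases h : Q.mod v = .real
  · simp [oneHat, Q.loopHat_real F h, Q.map_vq_mul F (one_mem_divSub _) (one_mem_divSub _)]
  · simp [oneHat, Q.loopHat_of_ne F h, Q.map_vq_mul F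
      (Q.qk_mem_of_ne_real hv h _) (one_mem_divSub _)]

theorem loopHat_mul_imHat : Q.loopHat F v * Q.imHat F v = -(Q.imHat F v * Q.loopHat F v) := by
  by_cases h : Q.mod v = .real
  · simp [Q.imHat_real F h, Q.loopHat_real F h, Q.map_vq_mul F (one_mem_divSub _)
      (one_mem_divSub _)]
  · simp [Q.imHat_of_ne F h, Q.loopHat_of_ne F h, Q.map_vq_mul F
      (Q.qk_mem_of_ne_real hv h _) (Q.qk_mem_of_ne_real hv h _)]

omit hv

theorem loopHat_mul_loopHat_real (h : Q.mod v = .real) :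
    Q.loopHat F v * Q.loopHat F v = Q.oneHat F v := by
  simp [oneHat, Q.loopHat_real F h, Q.map_vq_mul F (one_mem_divSub _) (one_mem_divSub _)]

theorem loopHat_mul_loopHat_quat (h : Q.mod v = .quat) :
    Q.loopHat F v * Q.loopHat F v = - Q.oneHat F v := by
  simp [oneHat, Q.loopHat_of_ne F (v := v) (by simp [h]), Q.map_vq_mul F
    (Q.qk_mem_of_ne_real (v := v) (by simp [h]) (by simp [h]) _)
    (Q.qk_mem_of_ne_real (v := v) (by simp [h]) (by simp [h]) _)]

/-! ### Compatibility of the arrow matrices with idempotents and `i`. -/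

section Arrow

variable {γ γ' : E}

theorem oneHat_mul_hat (h : Q.tgt γ' = Q.tgt γ) :
    Q.oneHat F (Q.tgt γ) * Q.hat F γ γ' = Q.hat F γ γ' := by
  have h1 := Q.map_vq_one_mul_arr F (a := γ) rfl
  have h2 := Q.map_vq_one_mul_arr F h
  unfold oneHat
  cases ht : Q.mod (Q.tgt γ) <;> cases hs : Q.mod (Q.src γ)
  all_goals
    first | rw [Q.hat_real_real F ht hs] | rw [Q.hat_real_ne F ht (by rw [hs]; simp)] |
      rw [Q.hat_ne_real F (by rw [ht]; simp) hs] | rw [Q.hat_cplx_cplx F ht hs] |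
      rw [Q.hat_cplx_quat F ht hs] | rw [Q.hat_quat_cplx F ht hs] | rw [Q.hat_quat_quat F ht hs]
    simp [h1, h2, mul_add]

theorem hat_mul_oneHat (h : Q.src γ' = Q.src γ) :
    Q.hat F γ γ' * Q.oneHat F (Q.src γ) = Q.hat F γ γ' := by
  have h1 := Q.map_arr_mul_vq_one F (a := γ) rfl
  have h2 := Q.map_arr_mul_vq_one F h
  have h0 : (0 : Fin 2 → R) = ![0, 0] := by ext i; fin_cases i <;> rfl
  unfold oneHat
  cases ht : Q.mod (Q.tgt γ) <;> cases hs : Q.mod (Q.src γ)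
  all_goals
    first | rw [Q.hat_real_real F ht hs] | rw [Q.hat_real_ne F ht (by rw [hs]; simp)] |
      rw [Q.hat_ne_real F (by rw [ht]; simp) hs] | rw [Q.hat_cplx_cplx F ht hs] |
      rw [Q.hat_cplx_quat F ht hs] | rw [Q.hat_quat_cplx F ht hs] | rw [Q.hat_quat_quat F ht hs]
    simp [h1, h2, add_mul, h0]

open scoped Classical in
-- This is `σ'` on matrices: an arrow matrix commutes with `i` unless the bimodule is the conjugate
-- of `ℂ`, where `k j = -j k` gives the sign.
theorem hat_mul_imHat (hs' : Q.src γ' = Q.src γ) (ht' : Q.tgt γ' = Q.tgt γ) :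
    Q.hat F γ γ' * Q.imHat F (Q.src γ) =
      if Q.mod (Q.src γ) = .cplx ∧ Q.mod (Q.tgt γ) = .cplx ∧ Q.bar γ then
        -(Q.imHat F (Q.tgt γ) * Q.hat F γ γ') else Q.imHat F (Q.tgt γ) * Q.hat F γ γ' := by
  by_cases ht : Q.mod (Q.tgt γ) = .real
  · rw [if_neg (by simp [ht]), Q.imHat_real F ht]
    have h1 := Q.map_vq_one_mul_arr F (a := γ) rfl
    have h2 := Q.map_vq_one_mul_arr F ht'
    by_cases hs : Q.mod (Q.src γ) = .real
    · have h3 := Q.map_arr_mul_vq_one F (a := γ) rfl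
      have h4 := Q.map_arr_mul_vq_one F hs'
      rw [Q.imHat_real F hs, Q.hat_real_real F ht hs]
      simp [h1, h2, h3, h4]
    · rw [Q.imHat_of_ne F hs, Q.hat_real_ne F ht hs]
      simp [h1, Q.arr_one_mul_vq F hs (by simp [ht]), Q.arr_qj_mul_vq F hs (by simp [ht])]
  · rw [Q.imHat_of_ne F ht]
    by_cases hs : Q.mod (Q.src γ) = .real
    · rw [if_neg (by simp [hs]), Q.imHat_real F hs, Q.hat_ne_real F ht hs]
      have h3 := Q.map_arr_mul_vq_one F (a := γ) rfl
      have h0 : (0 : Fin 2 → R) = ![0, 0] := by ext i; fin_cases i <;> rfl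
      simp [h3, Q.vq_mul_arr_one F ht (by simp [hs]), Q.vq_mul_arr_qj F ht (by simp [hs]), h0]
    · rw [Q.imHat_of_ne F hs]
      have h0 : (0 : Fin 2 → R) = ![0, 0] := by ext i; fin_cases i <;> rfl
      have hl : ∀ x ∈ Q.arrowModule γ, F (Q.vq (Q.tgt γ) qj) * F (Q.arr γ x) =
          F (Q.arr γ (qj * x)) := fun x hx => by
        rw [← map_mul, Q.vq_mul_arr (mem_divSub_of_ne_real ht) hx]
      have hr : ∀ x ∈ Q.arrowModule γ, F (Q.arr γ x) * F (Q.vq (Q.src γ) qj) =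
          F (Q.arr γ (x * qj)) := fun x hx => by
        rw [← map_mul, Q.arr_mul_vq hx (mem_divSub_of_ne_real hs)]
      cases htc : Q.mod (Q.tgt γ) <;> cases hsc : Q.mod (Q.src γ)
      any_goals contradiction
      · rw [Q.hat_cplx_cplx F htc hsc]
        by_cases hb : Q.bar γ
        · have hk : qk ∈ Q.arrowModule γ := by
            rw [Q.mem_arrowModule htc hsc, mem_simpleBimodule]; simp [hb]
          have hl' : ql ∈ Q.arrowModule γ := by
            rw [Q.mem_arrowModule htc hsc, mem_simpleBimodule]; simp [hb]
          simp [hb, hl _ hk, hr _ hk, Q.arr_neg hl', map_neg', h0]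
        · have h1 : 1 ∈ Q.arrowModule γ := by
            rw [Q.mem_arrowModule htc hsc, mem_simpleBimodule]; simp [hb]
          simp [hb, hl _ h1, hr _ h1, h0]
      · rw [Q.hat_cplx_quat F htc hsc]
        have h1 := Q.mem_arrowModule_quat_right hsc 1
        simp [hl _ h1, hr _ h1, h0]
      · rw [Q.hat_quat_cplx F htc hsc]
        have h1 := Q.mem_arrowModule_quat_left htc 1
        simp [hl _ h1, hr _ h1, h0]
      · rw [Q.hat_quat_quat F htc hsc]
        simp [add_mul, mul_add, Q.vq_mul_arr_one F (a := γ) ht (by simp [hsc]),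
          Q.arr_one_mul_vq F (a := γ) hs (by simp [htc]), h0]
        rw [← hs', ← ht'] at *
        simp [Q.vq_mul_arr_qj F (a := γ') ht (by simp [hsc]),
          Q.arr_qj_mul_vq F (a := γ') hs (by simp [htc])]

end Arrow

/-! ### The scalars `ℂ` as matrices. -/

section Scalars

/-- The matrix corresponding to `c e_v`. -/
noncomputable def scalBlock (v : V) : ℂ →ₗ[ℝ] Matrix (Fin 2) (Fin 2) R :=
  LinearMap.toSpanSingleton ℝ _ (Q.oneHat F v) ∘ₗ Complex.reLm +
    LinearMap.toSpanSingleton ℝ _ (Q.imHat F v) ∘ₗ Complex.imLm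

theorem scalBlock_apply (v : V) (c : ℂ) :
    Q.scalBlock F v c = c.re • Q.oneHat F v + c.im • Q.imHat F v := rfl

theorem scalBlock_one (v : V) : Q.scalBlock F v 1 = Q.oneHat F v := by simp [scalBlock_apply]

theorem scalBlock_mul_oneHat (v : V) (c : ℂ) :
    Q.scalBlock F v c * Q.oneHat F v = Q.scalBlock F v c := by
  rw [scalBlock_apply, add_mul, smul_mul_assoc, smul_mul_assoc, oneHat_mul_oneHat,
    imHat_mul_oneHat]

theorem oneHat_mul_scalBlock (v : V) (c : ℂ) :
    Q.oneHat F v * Q.scalBlock F v c = Q.scalBlock F v c := by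
  rw [scalBlock_apply, mul_add, mul_smul_comm, mul_smul_comm, oneHat_mul_oneHat,
    oneHat_mul_imHat]

theorem scalBlock_mul (v : V) (c d : ℂ) :
    Q.scalBlock F v c * Q.scalBlock F v d = Q.scalBlock F v (c * d) := by
  simp only [scalBlock_apply, add_mul, mul_add, smul_mul_smul_comm, oneHat_mul_oneHat,
    imHat_mul_oneHat, oneHat_mul_imHat, imHat_mul_imHat, Complex.mul_re, Complex.mul_im]
  module

theorem scalBlock_mul_of_ne {v v' : V} (h : v ≠ v') (c d : ℂ) :
    Q.scalBlock F v c * Q.scalBlock F v' d = 0 := by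
  rw [← scalBlock_mul_oneHat, ← Q.oneHat_mul_scalBlock F v', mul_assoc, ← mul_assoc (Q.oneHat F v),
    Q.oneHat_mul_oneHat_of_ne F h, zero_mul, mul_zero]

/-- The matrices corresponding to the scalars. -/
noncomputable def scalHat [Fintype V] : ℂ →ₐ[ℝ] Matrix (Fin 2) (Fin 2) R :=
  AlgHom.ofLinearMap (∑ v, Q.scalBlock F v)
    (by simp only [LinearMap.sum_apply, scalBlock_one, sum_oneHat]) (by
    intro c d
    simp only [LinearMap.sum_apply]
    rw [Finset.sum_mul]
    refine Finset.sum_congr rfl fun v _ => ?_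
    rw [Finset.mul_sum, Finset.sum_eq_single v, scalBlock_mul]
    · exact fun v' _ h => Q.scalBlock_mul_of_ne F h.symm c d
    · simp)

variable [Fintype V]

theorem scalHat_apply (c : ℂ) : Q.scalHat F c = ∑ v, Q.scalBlock F v c := by
  rw [← LinearMap.sum_apply]; rfl

theorem oneHat_mul_scalHat (v : V) (c : ℂ) :
    Q.oneHat F v * Q.scalHat F c = Q.scalBlock F v c := by
  rw [scalHat_apply, Finset.mul_sum, Finset.sum_eq_single v, oneHat_mul_scalBlock]
  · intro v' _ h
    rw [← scalBlock_one, Q.scalBlock_mul_of_ne F h.symm]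
  · simp

theorem scalHat_mul_oneHat (v : V) (c : ℂ) :
    Q.scalHat F c * Q.oneHat F v = Q.scalBlock F v c := by
  rw [scalHat_apply, Finset.sum_mul, Finset.sum_eq_single v, scalBlock_mul_oneHat]
  · intro v' _ h
    rw [← scalBlock_one, Q.scalBlock_mul_of_ne F h]
  · simp

theorem hat_mul_scalHat (L : Set E) (α : Q.OrdArrow L) {γ' : E} (hs : Q.src γ' = Q.src α.1)
    (ht : Q.tgt γ' = Q.tgt α.1) (c : ℂ) : Q.hat F α.1 γ' * Q.scalHat F c =
      Q.scalHat F (Q.twist' L (.inl α) c) * Q.hat F α.1 γ' := by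
  have h1 : Q.hat F α.1 γ' * Q.scalHat F c =
      Q.hat F α.1 γ' * Q.scalBlock F (Q.src α.1) c := by
    rw [← oneHat_mul_scalHat, ← mul_assoc, Q.hat_mul_oneHat F hs]
  have h2 : ∀ d, Q.scalHat F d * Q.hat F α.1 γ' =
      Q.scalBlock F (Q.tgt α.1) d * Q.hat F α.1 γ' := fun d => by
    rw [← scalHat_mul_oneHat, mul_assoc, Q.oneHat_mul_hat F ht]
  rw [h1, h2, scalBlock_apply, scalBlock_apply, mul_add, mul_smul_comm, mul_smul_comm,
    Q.hat_mul_oneHat F hs, Q.hat_mul_imHat F hs ht, add_mul, smul_mul_assoc, smul_mul_assoc,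
    Q.oneHat_mul_hat F ht]
  unfold twist'
  by_cases h : Q.mod (Q.src α.1) = .cplx ∧ Q.mod (Q.tgt α.1) = .cplx ∧ Q.bar α.1
  · simp [h]
  · simp [if_neg h]

theorem loopHat_mul_scalHat {v : V} (hv : Q.mod v ≠ .cplx) (c : ℂ) :
    Q.loopHat F v * Q.scalHat F c = Q.scalHat F (Complex.conjAe c) * Q.loopHat F v := by
  have h1 : Q.loopHat F v * Q.scalHat F c = Q.loopHat F v * Q.scalBlock F v c := by
    rw [← oneHat_mul_scalHat, ← mul_assoc, Q.loopHat_mul_oneHat F hv]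
  have h2 : ∀ d, Q.scalHat F d * Q.loopHat F v = Q.scalBlock F v d * Q.loopHat F v := fun d => by
    rw [← scalHat_mul_oneHat, mul_assoc, Q.oneHat_mul_loopHat F hv]
  rw [h1, h2, scalBlock_apply, scalBlock_apply, mul_add, mul_smul_comm, mul_smul_comm,
    Q.loopHat_mul_oneHat F hv, Q.loopHat_mul_imHat F hv, add_mul, smul_mul_assoc,
    smul_mul_assoc, Q.oneHat_mul_loopHat F hv]
  simp

end Scalars

/-- Where the kinds at the ends of an arrow differ or are `ℂ`, its matrix has entries in the image
of its bimodule. -/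
theorem hat_apply_eq {γ γ' : E} (h : Q.mod (Q.src γ) = .cplx ∨ Q.mod (Q.tgt γ) = .cplx)
    (i j : Fin 2) : ∃ x ∈ Q.arrowModule γ, Q.hat F γ γ' i j = F (Q.arr γ x) := by
  have h0 : ∃ x ∈ Q.arrowModule γ, (0 : R) = F (Q.arr γ x) :=
    ⟨0, zero_mem _, by rw [Q.arr_zero, map_zero]⟩
  have hm : ∀ x, F (Q.arr γ x) ≠ 0 → x ∈ Q.arrowModule γ := fun x hx => by
    by_contra hn
    exact hx (by rw [Q.arr_of_not_mem hn, map_zero])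
  have h1 : ∀ x, ∃ y ∈ Q.arrowModule γ, F (Q.arr γ x) = F (Q.arr γ y) := fun x => by
    by_cases hx : x ∈ Q.arrowModule γ
    · exact ⟨x, hx, rfl⟩
    · rw [Q.arr_of_not_mem hx, map_zero]
      exact h0
  have h2 : ∀ x, ∃ y ∈ Q.arrowModule γ, - F (Q.arr γ x) = F (Q.arr γ y) := fun x => by
    obtain ⟨y, hy, hxy⟩ := h1 x
    exact ⟨-y, neg_mem hy, by rw [Q.arr_neg hy, map_neg', hxy]⟩
  revert i j
  cases ht : Q.mod (Q.tgt γ) <;> cases hs : Q.mod (Q.src γ)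
  any_goals simp [ht, hs] at h
  all_goals
    first | rw [Q.hat_real_ne F ht (by rw [hs]; simp)] |
      rw [Q.hat_ne_real F (by rw [ht]; simp) hs] | rw [Q.hat_cplx_cplx F ht hs] |
      rw [Q.hat_cplx_quat F ht hs] | rw [Q.hat_quat_cplx F ht hs]
    rw [Fin.forall_fin_two, Fin.forall_fin_two, Fin.forall_fin_two]
    exact ⟨⟨h1 _, by first | exact h0 | exact h1 _⟩, by first | exact h0 | exact h2 _, h0⟩

variable {Q} {F} in
/-- A homomorphism from `T(Q, M)` which kills an ideal of special type gives rise to a matrix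
representation of `ℂ_{σ'} Q^s / ⟨S ∪ Z'⟩`. -/
theorem exists_toMatrix [Fintype V] {L : Set E} (hL : Q.IsLabelling L)
    {I : TwoSidedIdeal Q.TensorAlg} (hI : Q.IsSpecialType L I) (hF : ∀ x ∈ I, F x = 0) :
    ∃ G : Q.SAlg L (Q.zeroSet' L I) →ₐ[ℝ] Matrix (Fin 2) (Fin 2) R,
      (∀ c, G (Q.scal L _ c) = Q.scalHat F c) ∧ (∀ v, G (Q.idem L _ v) = Q.oneHat F v) ∧
      (∀ v, Q.mod v ≠ .cplx → G (Q.loop L _ v) = Q.loopHat F v) ∧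
      ∀ α ∉ L, G (Q.ord L _ α) = Q.hat F α (Q.other L α) := by
  have hs : ∀ α, Q.src (Q.other L α) = Q.src α := fun α => by
    unfold other
    split_ifs with h
    · exact h.choose_spec.src_eq
    · rfl
  have ht : ∀ α, Q.tgt (Q.other L α) = Q.tgt α := fun α => by
    unfold other
    split_ifs with h
    · exact h.choose_spec.tgt_eq
    · rfl
  obtain ⟨G, h1, h2, h3⟩ := (Q.sQuiver L).exists_lift (σ := Q.twist' L) (Z := Q.zeroSet' L I)
    (f := Q.scalHat F) (e := Q.oneHat F)
    (a := Sum.elim (fun α => Q.hat F α.1 (Q.other L α.1)) fun i => Q.loopHat F i.1)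
    (Q.oneHat_mul_oneHat F) (fun _ _ h => Q.oneHat_mul_oneHat_of_ne F h) (Q.sum_oneHat F)
    (by
      rintro (α | i)
      · exact Q.oneHat_mul_hat F (ht α.1)
      · exact Q.oneHat_mul_loopHat F i.2)
    (by
      rintro (α | i)
      · exact Q.hat_mul_oneHat F (hs α.1)
      · exact Q.loopHat_mul_oneHat F i.2)
    (fun v c => by rw [oneHat_mul_scalHat, scalHat_mul_oneHat])
    (by
      rintro (α | i) c
      · exact Q.hat_mul_scalHat F L α (hs α.1) (ht α.1) c
      · exact Q.loopHat_mul_scalHat F i.2 c)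
    (by rintro _ ⟨i, rfl, hi⟩; exact Q.loopHat_mul_loopHat_real F hi)
    (by rintro _ ⟨i, rfl, hi⟩; exact Q.loopHat_mul_loopHat_quat F hi)
    (by
      -- At a vertex without `ℂ` the two arrows are those of the admissible forms; the generators of
      -- `I_v^p` lie in `I` and are killed by `F`, so the matrix product vanishes.
      have key : ∀ α β : Q.OrdArrow L, Q.src α.1 = Q.tgt β.1 → Q.mod (Q.src α.1) ≠ .cplx →
          ∀ p : Fin 2, Q.localIdeal I (Q.src α.1) = Q.special L p (Q.src α.1) →
          Q.hat F α.1 (Q.other L α.1) * (if p = 0 then 1 else Q.loopHat F (Q.src α.1)) *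
            Q.hat F β.1 (Q.other L β.1) = 0 := by
        intro α β hαβ hv p hp
        obtain ⟨a, a', ha⟩ := hI.exists_isOut hv
        obtain ⟨b, b', hb⟩ := hI.exists_isIn (α := β.1) (hαβ ▸ hv)
        have hα := ha.eq_of_not_mem α.2 rfl
        have hβ := hb.eq_of_not_mem β.2 rfl
        rw [← hα] at ha
        rw [← hβ, ← hαβ] at hb
        have hα' : Q.other L α.1 = a' := (hI.isPartner_other α.2 fun h => hv h.1).unique hL ha.1
        have hβ' : Q.other L β.1 = b' :=
          (hI.isPartner_other β.2 fun h => hv (hαβ ▸ h.2)).unique hL hb.1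
        rw [hα', hβ']
        refine (Q.map_gens_eq_zero_iff F hαβ hv ha.1 hb.1 p).mp fun r hr => hF r ?_
        have := gens_subset_special hL p ha hb hr
        rw [← hp] at this
        exact this.2
      rintro _ (⟨α, β, hαβ, hv, ⟨hp, rfl⟩ | ⟨hp, rfl⟩⟩ | ⟨α, β, hαβ, hv, hp, rfl⟩)
      · simpa using key α β hαβ hv 0 hp
      · simpa [mul_assoc] using key α β hαβ hv 1 hp
      · simp only [List.map_cons, List.map_nil, List.prod_cons, List.prod_nil, mul_one, Sum.elim_inl]
        ext i j
        rw [Matrix.mul_apply]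
        refine Finset.sum_eq_zero fun k _ => ?_
        obtain ⟨x, hx, hx'⟩ := Q.hat_apply_eq F (γ' := Q.other L α.1) (Or.inl hv) i k
        obtain ⟨y, hy, hy'⟩ := Q.hat_apply_eq F (γ' := Q.other L β.1) (Or.inr (hαβ ▸ hv)) k j
        rw [hx', hy', ← map_mul]
        -- At a vertex with `ℂ` each summand of each entry comes from an element of `M(αβ)`, which
        -- is contained in `I`.
        refine hF _ (hp ?_).2
        rw [Q.arr_of_mem hx, Q.arr_of_mem hy]
        exact Submodule.mul_mem_mul ⟨⟨x, hx⟩, rfl⟩ ⟨⟨y, hy⟩, rfl⟩)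
  refine ⟨G, h1, h2, fun v hv => ?_, fun α hα => ?_⟩
  · rw [Q.loop_of_ne L _ hv, h3]
    rfl
  · rw [Q.ord_of_not_mem hα, h3]
    rfl

end ModulatedQuiver

/-! ## The Morita equivalence -/

namespace ModulatedQuiver

variable {V : Type u} {E : Type w} {Q : ModulatedQuiver V E} {R : Type*} [Ring R] [Algebra ℝ R]
  {F : Q.TensorAlg →ₐ[ℝ] R}

/-- The property of an element of `T(Q, M)` to be recovered from its matrix. -/
def Recovers (F : Q.TensorAlg →ₐ[ℝ] R) (M : Matrix (Fin 2) (Fin 2) R) (t : Q.TensorAlg) : Prop :=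
  M 0 0 = F t ∧ M 0 1 = 0

/-- The vanishing upper right entry is what makes the upper left entry multiplicative. -/
theorem Recovers.mul {M N : Matrix (Fin 2) (Fin 2) R} {s t : Q.TensorAlg} (hM : Recovers F M s)
    (hN : Recovers F N t) : Recovers F (M * N) (s * t) := by
  constructor
  · rw [Matrix.mul_apply, Fin.sum_univ_two, hM.1, hM.2, hN.1, zero_mul, add_zero, map_mul]
  · rw [Matrix.mul_apply, Fin.sum_univ_two, hM.2, hN.2, zero_mul, mul_zero, add_zero]

theorem Recovers.add {M N : Matrix (Fin 2) (Fin 2) R} {s t : Q.TensorAlg} (hM : Recovers F M s)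
    (hN : Recovers F N t) : Recovers F (M + N) (s + t) := by
  constructor
  · rw [Matrix.add_apply, hM.1, hN.1, map_add]
  · rw [Matrix.add_apply, hM.2, hN.2, add_zero]

open scoped Classical in
/-- A generator of the bimodule of an arrow. -/
noncomputable def unit (Q : ModulatedQuiver V E) (α : E) : ℍ[ℝ] :=
  if Q.mod (Q.tgt α) = .cplx ∧ Q.mod (Q.src α) = .cplx ∧ Q.bar α then qk else 1

variable [Fintype V] {L : Set E} {Z : Set (List (Q.SArrow L))}

/-- A matrix representation of `ℂ_{σ'} Q^s / ⟨S ∪ Z⟩`, given on generators by the matrices with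
hat. -/
structure IsToMatrix (F : Q.TensorAlg →ₐ[ℝ] R)
    (G : Q.SAlg L Z →ₐ[ℝ] Matrix (Fin 2) (Fin 2) R) : Prop where
  scal : ∀ c, G (Q.scal L _ c) = Q.scalHat F c
  idem : ∀ v, G (Q.idem L _ v) = Q.oneHat F v
  loop : ∀ v, Q.mod v ≠ .cplx → G (Q.loop L _ v) = Q.loopHat F v
  ord : ∀ α ∉ L, G (Q.ord L _ α) = Q.hat F α (Q.other L α)

variable {G : Q.SAlg L Z →ₐ[ℝ] Matrix (Fin 2) (Fin 2) R}

theorem IsToMatrix.map_kap_of_cplx (hG : IsToMatrix F G) (v : V) {x : ℍ[ℝ]} (hx : x ∈ divSub .cplx) :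
    G (Q.kap L Z v x) = x.re • Q.oneHat F v + x.imI • Q.imHat F v := by
  rw [Q.kap_of_cplx L Z v hx, map_mul, hG.scal, hG.idem, scalHat_mul_oneHat]
  rfl

theorem IsToMatrix.map_eps (hG : IsToMatrix F G) (v : V) :
    (Q.mod v = .real → G (Q.eps L Z v) = !![F (Q.vq v 1), 0; 0, 0]) ∧
      (Q.mod v ≠ .real → G (Q.eps L Z v) = Q.oneHat F v) := by
  refine ⟨fun h => ?_, fun h => ?_⟩
  · rw [Q.eps_real L Z h, map_smul, map_add, hG.idem, hG.loop v (by simp [h]), Q.loopHat_real F h,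
      oneHat]
    simp [← two_smul ℝ, smul_smul]
  · rw [Q.eps_of_ne L Z h, hG.idem]

theorem IsToMatrix.recovers_vq (hG : IsToMatrix F G) (v : V) {x : ℍ[ℝ]}
    (hx : x ∈ divSub (Q.mod v)) :
    Recovers F (G (Q.kap L Z v x * Q.eps L Z v)) (Q.vq v x) := by
  have h11 := Q.map_vq_mul F (v := v) (one_mem_divSub _) (one_mem_divSub _)
  by_cases h : Q.mod v = .real
  · rw [h] at hx
    have hx' : x = x.re • 1 := by
      rw [mem_divSub_real] at hx
      ext <;> simp [hx]
    rw [map_mul, (hG.map_eps v).1 h, hG.map_kap_of_cplx v (cplx_of_real hx), oneHat,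
      Q.imHat_real F h, (mem_divSub_real.mp hx).1]
    have : F (Q.vq v x) = x.re • F (Q.vq v 1) := by
      conv_lhs => rw [hx', map_smul, map_smul]
    constructor <;> simp [h11, this]
  · have hjx := Q.map_vq_mul F (v := v) (mem_divSub_of_ne_real h) (one_mem_divSub _)
    rw [Q.eps_of_ne L Z h, kap_mul_idem]
    by_cases hc : Q.mod v = .cplx
    · rw [hc] at hx
      rw [hG.map_kap_of_cplx v hx, oneHat, Q.imHat_of_ne F h]
      have hx' : x = x.re • 1 + x.imI • qj := by
        rw [mem_divSub_cplx] at hx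
        ext <;> simp [hx]
      have : F (Q.vq v x) = x.re • F (Q.vq v 1) + x.imI • F (Q.vq v qj) := by
        conv_lhs => rw [hx', map_add, map_smul, map_smul, map_add, map_smul, map_smul]
      constructor <;> simp [this]
    · have hm := Q.qk_mem_of_ne_real hc h
      rw [kap_apply, map_add, map_mul, map_mul, hG.scal, hG.scal, hG.idem, hG.loop v hc,
        scalHat_mul_oneHat, ← Q.oneHat_mul_loopHat F hc, ← mul_assoc, scalHat_mul_oneHat,
        scalBlock_apply, scalBlock_apply, oneHat, Q.imHat_of_ne F h, Q.loopHat_of_ne F h]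
      have hx' : x = x.re • 1 + x.imI • qj + (x.imJ • qk + x.imK • ql) := by
        ext <;> simp
      have : F (Q.vq v x) = x.re • F (Q.vq v 1) + x.imI • F (Q.vq v qj) +
          (x.imJ • F (Q.vq v qk) + x.imK • F (Q.vq v ql)) := by
        conv_lhs => rw [hx']
        simp only [map_add, map_smul]
      constructor <;> simp [this, add_mul, Q.map_vq_mul F (hm _) (hm _), fstC, sndC]

theorem IsToMatrix.recovers_core (hL : Q.IsLabelling L) {I : TwoSidedIdeal Q.TensorAlg}
    (hI : Q.IsSpecialType L I) (hG : IsToMatrix F G) (α : E) :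
    Recovers F (G (Q.core L Z α)) (Q.arr α (Q.unit α)) := by
  have hpart : α ∈ L → ∃ γ ∉ L, Q.IsPartner L γ α ∧ Q.other L γ = α := fun hα => by
    obtain ⟨γ, hγ, hs, ht⟩ := hL.partner α hα
    have hm := hL.mod_eq α hα
    have hp : Q.IsPartner L γ α := Or.inl ⟨by rw [hs, ht, hm.1], hγ, hα, hs, ht⟩
    exact ⟨γ, hγ, hp, (hI.isPartner_other hγ fun h => hm.2 (hs ▸ h.1)).unique hL hp⟩
  by_cases hq : Q.mod (Q.tgt α) = .quat ∧ Q.mod (Q.src α) = .quat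
  · obtain ⟨ht, hs⟩ := hq
    have hu : Q.unit α = 1 := if_neg fun h => by simp [ht] at h
    have htr : Q.mod (Q.tgt α) ≠ .real := by simp [ht]
    have hsr : Q.mod (Q.src α) ≠ .real := by simp [hs]
    have hkk : ∀ β, Q.tgt β = Q.tgt α → Q.src β = Q.src α → ∀ x,
        F (Q.vq (Q.tgt α) qk) * F (Q.arr β x) * F (Q.vq (Q.src α) qk) =
          F (Q.arr β (qk * x * qk)) := fun β hβ hβ' x => by
      rw [← map_mul, ← map_mul, ← hβ, ← hβ', Q.vq_mul_arr (by rw [hβ, ht]; exact mem_divSub_quat _)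
        (Q.mem_arrowModule_quat_left (hβ ▸ ht) _), Q.arr_mul_vq
        (Q.mem_arrowModule_quat_left (hβ ▸ ht) _) (by rw [hβ', hs]; exact mem_divSub_quat _)]
    have hneg : ∀ β, Q.tgt β = Q.tgt α → ∀ x, F (Q.arr β (-x)) = - F (Q.arr β x) :=
      fun β hβ x => by rw [Q.arr_neg (Q.mem_arrowModule_quat_left (hβ ▸ ht) _), map_neg']
    -- Because `k 1 k = -1` while `k j k = j`, subtracting the term with the two loops keeps only
    -- `γ`, and adding it keeps only `γⁱ`.
    have h1 : qk * 1 * qk = -1 := by simp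
    have hj : qk * qj * qk = qj := by simp
    rw [hu]
    by_cases hα : α ∈ L
    · obtain ⟨γ, hγ, hp, ho⟩ := hpart hα
      have hGo : G (Q.ord L Z α) = !![(2⁻¹ : ℝ) • (F (Q.arr γ 1) + F (Q.arr α qj)), 0; 0, 0] := by
        rw [hp.ord_eq Z hL, hG.ord γ hγ, ho, Q.hat_quat_quat F (hp.tgt_eq ▸ ht) (hp.src_eq ▸ hs)]
      have hj' := Q.vq_mul_arr_qj F (a := α) htr (by simp [hs])
      rw [Q.core_quat' L Z ht hs hα, ← Q.idem_mul_ord L Z α, ← mul_assoc (Q.loop L Z _),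
        loop_mul_idem, ← Q.idem_mul_loop L Z (Q.tgt α), mul_assoc (Q.idem L Z _),
        mul_assoc (Q.idem L Z _), ← mul_add, map_neg, map_mul, map_mul, hG.scal, hG.idem,
        ← mul_assoc, scalHat_mul_oneHat, map_add, map_mul, map_mul, hG.loop _ (by simp [ht]),
        hG.loop _ (by simp [hs]), hGo, scalBlock_apply, Q.imHat_of_ne F htr,
        Q.loopHat_of_ne F htr, Q.loopHat_of_ne F hsr]
      constructor
      · simp [mul_add, add_mul, hkk γ hp.tgt_eq.symm hp.src_eq.symm, hkk α rfl rfl,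
          hneg γ hp.tgt_eq.symm, hj', ← smul_add, ← two_smul ℝ]
        module
      · simp
    · have hp := hI.isPartner_other hα fun h => by simp [hs] at h
      rw [Q.core_quat L Z ht hs hα, map_sub, map_mul, map_mul, hG.ord α hα,
        hG.loop _ (by simp [ht]), hG.loop _ (by simp [hs]), Q.hat_quat_quat F ht hs,
        Q.loopHat_of_ne F htr, Q.loopHat_of_ne F hsr]
      constructor
      · simp [mul_add, add_mul, hkk _ hp.tgt_eq hp.src_eq, hkk α rfl rfl, hneg α rfl]
        module
      · simp
  have h1t := Q.map_vq_one_mul_arr F (a := α) rfl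
  have h1s := Q.map_arr_mul_vq_one F (a := α) rfl
  by_cases hr : Q.mod (Q.tgt α) = .real ∧ Q.mod (Q.src α) = .real
  · obtain ⟨ht, hs⟩ := hr
    have hu : Q.unit α = 1 := if_neg fun h => by simp [ht] at h
    rw [hu]
    by_cases hα : α ∈ L
    · obtain ⟨γ, hγ, hp, ho⟩ := hpart hα
      have hGo : G (Q.ord L Z α) =
          !![F (Q.arr γ 1), - F (Q.arr α 1); F (Q.arr α 1), F (Q.arr γ 1)] := by
        rw [hp.ord_eq Z hL, hG.ord γ hγ, ho, Q.hat_real_real F (hp.tgt_eq ▸ ht) (hp.src_eq ▸ hs)]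
      rw [Q.core_real' L Z ht hs hα, ← Q.idem_mul_ord L Z α, ← mul_assoc (Q.scal L Z _), map_neg,
        map_mul, map_mul, map_mul, map_mul, hG.scal, hG.idem, scalHat_mul_oneHat, scalBlock_apply,
        (hG.map_eps _).1 ht, (hG.map_eps _).1 hs, hGo, Q.imHat_real F ht]
      constructor <;> simp [h1t, h1s]
    · rw [Q.core_real L Z ht hs hα, map_mul, map_mul, hG.ord α hα, (hG.map_eps _).1 ht,
        (hG.map_eps _).1 hs, Q.hat_real_real F ht hs]
      constructor <;> simp [h1t, h1s]
  have hα : α ∉ L := fun hα => by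
    have := hL.mod_eq α hα
    cases h : Q.mod (Q.src α)
    · exact hr ⟨this.1 ▸ h, h⟩
    · exact this.2 h
    · exact hq ⟨this.1 ▸ h, h⟩
  have hne : Q.mod (Q.tgt α) = Q.mod (Q.src α) → Q.mod (Q.src α) = .cplx := fun h => by
    cases h' : Q.mod (Q.src α)
    · exact absurd ⟨h.trans h', h'⟩ hr
    · rfl
    · exact absurd ⟨h.trans h', h'⟩ hq
  rw [Q.core_of_ne L Z hne, map_mul, map_mul, hG.ord α hα]
  by_cases ht : Q.mod (Q.tgt α) = .real
  · have hs : Q.mod (Q.src α) ≠ .real := fun hs => hr ⟨ht, hs⟩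
    have hu : Q.unit α = 1 := if_neg fun h => by simp [ht] at h
    rw [hu, (hG.map_eps _).1 ht, (hG.map_eps _).2 hs, Q.hat_real_ne F ht hs, oneHat]
    constructor <;> simp [h1t, h1s]
  · rw [(hG.map_eps _).2 ht]
    by_cases hs : Q.mod (Q.src α) = .real
    · have hu : Q.unit α = 1 := if_neg fun h => by simp [hs] at h
      rw [hu, (hG.map_eps _).1 hs, Q.hat_ne_real F ht hs, oneHat]
      constructor <;> simp [h1t, h1s]
    · have hH : Q.hat F α (Q.other L α) = !![F (Q.arr α (Q.unit α)), 0; 0, 0] := by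
        unfold unit
        cases ht' : Q.mod (Q.tgt α) <;> cases hs' : Q.mod (Q.src α)
        any_goals contradiction
        · by_cases hb : Q.bar α <;> simp [Q.hat_cplx_cplx F ht' hs', hb]
        · simp [Q.hat_cplx_quat F ht' hs']
        · simp [Q.hat_quat_cplx F ht' hs']
        · exact absurd ⟨ht', hs'⟩ hq
      rw [(hG.map_eps _).2 hs, hH, oneHat, oneHat]
      constructor <;> simp [h1t, h1s]

theorem IsToMatrix.recovers_arr (hL : Q.IsLabelling L) {I : TwoSidedIdeal Q.TensorAlg}
    (hI : Q.IsSpecialType L I) (hG : IsToMatrix F G) (α : E) {x : ℍ[ℝ]}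
    (hx : x ∈ Q.arrowModule α) :
    Recovers F (G (Q.arrowMap L Z α x)) (Q.arr α x) := by
  have hc := hG.recovers_core hL hI α
  have hu : ∀ h : ¬ (Q.mod (Q.tgt α) = .cplx ∧ Q.mod (Q.src α) = .cplx ∧ Q.bar α),
      Q.unit α = 1 ∧ 1 ∈ Q.arrowModule α := fun h => by
    refine ⟨if_neg h, ?_⟩
    cases ht : Q.mod (Q.tgt α) <;> cases hs : Q.mod (Q.src α) <;>
      rw [Q.mem_arrowModule ht hs, mem_simpleBimodule] <;> simp_all
  by_cases hr : Q.IsRight α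
  · obtain ⟨hu1, hm⟩ := hu fun h => by
      obtain h' | h' := hr
      · rw [h.1] at h'; simp at h'
      · rw [h.2.1] at h'; simp at h'
    have hx' : x ∈ divSub (Q.mod (Q.src α)) := by
      obtain h' | ⟨-, h'⟩ := hr
      · cases hs : Q.mod (Q.src α)
        · rw [Q.mem_arrowModule h' hs] at hx
          exact mem_divSub_real.mpr hx
        · rw [Q.mem_arrowModule h' hs] at hx
          exact mem_divSub_cplx.mpr hx
        · exact mem_divSub_quat x
      · rw [h']
        exact mem_divSub_quat x
    have h2 : Q.arr α x = Q.arr α 1 * Q.vq (Q.src α) x := by rw [Q.arr_mul_vq hm hx', one_mul]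
    rw [hu1] at hc
    rw [Q.arrowMap_right L Z hr, ← Q.core_mul_eps, mul_assoc, ← Q.kap_mul_eps L Z hx', map_mul, h2]
    exact hc.mul (hG.recovers_vq _ hx')
  · by_cases hb : Q.mod (Q.tgt α) = .cplx ∧ Q.mod (Q.src α) = .cplx ∧ Q.bar α
    · have hu1 : Q.unit α = qk := if_pos hb
      have hk : qk ∈ Q.arrowModule α := by
        rw [Q.mem_arrowModule hb.1 hb.2.1, mem_simpleBimodule]; simp [hb.2.2]
      have hx' : x * -qk ∈ divSub (Q.mod (Q.tgt α)) := by
        rw [Q.mem_arrowModule hb.1 hb.2.1, mem_simpleBimodule] at hx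
        rw [hb.1, mem_divSub_cplx]
        simp [hx.2 hb.2.2]
      have h2 : Q.arr α x = Q.vq (Q.tgt α) (x * -qk) * Q.arr α qk := by
        rw [Q.vq_mul_arr hx' hk, mul_assoc]
        simp
      rw [hu1] at hc
      rw [Q.arrowMap_bar L Z hb, ← Q.eps_mul_core, ← mul_assoc, map_mul, h2]
      exact (hG.recovers_vq _ hx').mul hc
    · obtain ⟨hu1, hm⟩ := hu hb
      have hx' : x ∈ divSub (Q.mod (Q.tgt α)) := by
        cases ht : Q.mod (Q.tgt α)
        · exact absurd (Or.inl ht) hr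
        · rw [mem_divSub_cplx]
          cases hs : Q.mod (Q.src α)
          · rw [Q.mem_arrowModule ht hs, mem_simpleBimodule] at hx
            exact hx
          · rw [Q.mem_arrowModule ht hs, mem_simpleBimodule] at hx
            exact hx.1 fun h => hb ⟨ht, hs, h⟩
          · exact absurd (Or.inr ⟨ht, hs⟩) hr
        · exact mem_divSub_quat x
      have h2 : Q.arr α x = Q.vq (Q.tgt α) x * Q.arr α 1 := by rw [Q.vq_mul_arr hx' hm, mul_one]
      rw [hu1] at hc
      rw [Q.arrowMap_left L Z hr hb, ← Q.eps_mul_core, ← mul_assoc, map_mul, h2]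
      exact (hG.recovers_vq _ hx').mul hc

theorem IsToMatrix.recovers [Finite E] (hL : Q.IsLabelling L) {I : TwoSidedIdeal Q.TensorAlg}
    (hI : Q.IsSpecialType L I) (hG : IsToMatrix F G)
    {φ : Q.TensorAlg →ₐ[ℝ] (Q.isIdempotentElem_epsSum L Z).Corner} (hφ : IsToCorner φ)
    (t : Q.TensorAlg) : Recovers F (G (φ t).1) t := by
  induction t using Q.tensorAlg_induction with
  | hvq v x hx => rw [hφ.vq v x hx]; exact hG.recovers_vq v hx
  | harr α x hx => rw [hφ.arr α x hx]; exact hG.recovers_arr hL hI α hx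
  | hzero =>
    rw [map_zero, IsIdempotentElem.corner_val_zero, map_zero]
    exact ⟨(map_zero F).symm, rfl⟩
  | hmul s t hs ht =>
    rw [map_mul, IsIdempotentElem.corner_val_mul, map_mul]
    exact hs.mul ht
  | hadd s t hs ht =>
    rw [map_add, IsIdempotentElem.corner_val_add, map_add]
    exact hs.add ht

/-! ### Surjectivity onto the corner. -/

section Surjective

variable {φ : Q.TensorAlg →ₐ[ℝ] (Q.isIdempotentElem_epsSum L Z).Corner}

/-- The elements of `ℂ_{σ'} Q^s / ⟨S ∪ Z⟩` in the image of `T(Q, M)`. -/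
def InRange (φ : Q.TensorAlg →ₐ[ℝ] (Q.isIdempotentElem_epsSum L Z).Corner)
    (x : Q.SAlg L Z) : Prop := ∃ t, (φ t).1 = x

theorem InRange.add {x y : Q.SAlg L Z} (hx : InRange φ x) (hy : InRange φ y) :
    InRange φ (x + y) := by
  obtain ⟨s, rfl⟩ := hx
  obtain ⟨t, rfl⟩ := hy
  exact ⟨s + t, by rw [map_add]; rfl⟩

theorem InRange.mul {x y : Q.SAlg L Z} (hx : InRange φ x) (hy : InRange φ y) :
    InRange φ (x * y) := by
  obtain ⟨s, rfl⟩ := hx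
  obtain ⟨t, rfl⟩ := hy
  exact ⟨s * t, by rw [map_mul]; rfl⟩

theorem InRange.smul (r : ℝ) {x : Q.SAlg L Z} (hx : InRange φ x) : InRange φ (r • x) := by
  obtain ⟨s, rfl⟩ := hx
  exact ⟨r • s, by rw [map_smul]; rfl⟩

theorem InRange.zero : InRange φ 0 := ⟨0, by rw [map_zero]; rfl⟩

theorem InRange.sum {ι : Type*} {s : Finset ι} {f : ι → Q.SAlg L Z}
    (h : ∀ i ∈ s, InRange φ (f i)) : InRange φ (∑ i ∈ s, f i) :=
  Finset.sum_induction f (InRange φ) (fun _ _ => InRange.add) InRange.zero h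

theorem colV_mul_idem (v : V) (i : Fin 2) :
    Q.colV L Z v i * Q.idem L Z v = Q.colV L Z v i := by
  revert i
  rw [Fin.forall_fin_two]
  refine ⟨eps_mul_idem Q L Z v, ?_⟩
  by_cases h : Q.mod v = .real
  · rw [colV_one_real L Z h, neg_mul, mul_assoc, ← idem_mul_scal, ← mul_assoc, eps_mul_idem]
  · rw [colV_one_ne L Z h, zero_mul]

theorem idem_mul_rowU (v : V) (i : Fin 2) :
    Q.idem L Z v * Q.rowU L Z v i = Q.rowU L Z v i := by
  revert i
  rw [Fin.forall_fin_two]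
  refine ⟨idem_mul_eps Q L Z v, ?_⟩
  by_cases h : Q.mod v = .real
  · rw [rowU_one_real L Z h, ← mul_assoc, idem_mul_scal, mul_assoc, idem_mul_eps]
  · rw [rowU_one_ne L Z h, mul_zero]

theorem rowU_mul_eps (v : V) (i : Fin 2) :
    Q.rowU L Z v i * Q.eps L Z v = Q.rowU L Z v i := by
  revert i
  rw [Fin.forall_fin_two]
  refine ⟨eps_mul_eps Q L Z v, ?_⟩
  by_cases h : Q.mod v = .real
  · rw [rowU_one_real L Z h, mul_assoc, eps_mul_eps]
  · rw [rowU_one_ne L Z h, zero_mul]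

/-- Since `s_v ε_v = ε_v`, the product is `(c + c̄)/2` times `ε_v`: at a vertex with `ℝ` the scalars
contribute only `ℝ` to the corner. -/
theorem eps_mul_scal_mul_eps {v : V} (h : Q.mod v = .real) (c : ℂ) :
    Q.eps L Z v * Q.scal L Z c * Q.eps L Z v = c.re • Q.eps L Z v := by
  have hs : Q.loop L Z v * Q.eps L Z v = Q.eps L Z v := by
    rw [Q.eps_real L Z h, mul_smul_comm, mul_add, loop_mul_idem, Q.loop_mul_loop_real L Z h,
      add_comm]
  have h2 : (c.re : ℂ) = (2⁻¹ : ℝ) • (c + starRingEnd ℂ c) := by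
    rw [Complex.add_conj, Complex.real_smul]
    push_cast
    ring
  conv_lhs => rw [Q.eps_real L Z h, smul_mul_assoc, add_mul, idem_mul_scal, loop_mul_scal,
    smul_mul_assoc, add_mul, mul_assoc, mul_assoc, ← Q.eps_real L Z h, idem_mul_eps, hs, ← add_mul,
    ← map_add, ← smul_mul_assoc, ← map_smul, ← h2, scal_real]

theorem IsToCorner.inRange_scal (hφ : IsToCorner φ) (c : ℂ) (v w : V) (i j : Fin 2) :
    InRange φ (Q.colV L Z w i * Q.scal L Z c * Q.rowU L Z v j) := by
  by_cases hvw : w = v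
  swap
  · rw [← colV_mul_idem, ← idem_mul_rowU, mul_assoc (Q.colV L Z w i), idem_mul_scal,
      mul_assoc, mul_assoc (Q.scal L Z c), ← mul_assoc (Q.idem L Z w),
      Q.idem_mul_idem_of_ne L Z hvw, zero_mul, mul_zero, mul_zero]
    exact InRange.zero
  subst hvw
  by_cases h : Q.mod w = .real
  · have key : ∀ d, InRange φ (Q.eps L Z w * Q.scal L Z d * Q.eps L Z w) := fun d => by
      rw [eps_mul_scal_mul_eps h]
      refine InRange.smul _ ⟨Q.vq w 1, ?_⟩
      rw [hφ.vq w 1 (one_mem _), kap_one, idem_mul_eps]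
    revert i j
    simp only [Fin.forall_fin_two, rowU_zero, colV_zero, rowU_one_real L Z h, colV_one_real L Z h]
    refine ⟨⟨key c, ?_⟩, ?_, ?_⟩
    · rw [← mul_assoc, mul_assoc (Q.eps L Z w), ← map_mul]
      exact key _
    · rw [neg_mul, neg_mul, ← neg_one_smul ℝ, mul_assoc (Q.eps L Z w), ← map_mul]
      exact (key _).smul _
    · rw [neg_mul, neg_mul, ← neg_one_smul ℝ, mul_assoc (Q.eps L Z w), ← map_mul, ← mul_assoc,
        mul_assoc (Q.eps L Z w), ← map_mul]
      exact (key _).smul _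
  · revert i j
    simp only [Fin.forall_fin_two, rowU_zero, colV_zero, rowU_one_ne L Z h, colV_one_ne L Z h,
      mul_zero, zero_mul, InRange.zero, and_true]
    have hc : c.re • (1 : ℍ[ℝ]) + c.im • qj ∈ divSub .cplx := by rw [mem_divSub_cplx]; simp
    have hf : fstC (c.re • (1 : ℍ[ℝ]) + c.im • qj) = c := by apply Complex.ext <;> simp [fstC]
    refine ⟨Q.vq w (c.re • (1 : ℍ[ℝ]) + c.im • qj), ?_⟩
    rw [hφ.vq w _ ?_, Q.kap_of_cplx L Z w hc, Q.eps_of_ne L Z h, idem_mul_scal, hf]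
    · cases h' : Q.mod w
      · exact absurd h' h
      · exact hc
      · exact mem_divSub_quat _

theorem sum_idem_eq_one : ∑ v, Q.idem L Z v = 1 := (Q.sQuiver L).sum_ide _ _

/-- Inserting `1 = ∑ rowU * colV` shows that elements all of whose matrix entries lie in the image
are closed under products. -/
theorem mul_eq_sum (x y : Q.SAlg L Z) :
    x * y = ∑ u, ∑ k, x * Q.rowU L Z u k * (Q.colV L Z u k * y) := by
  conv_lhs => rw [← mul_one x, ← sum_idem_eq_one, Finset.mul_sum, Finset.sum_mul]
  refine Finset.sum_congr rfl fun u _ => ?_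
  rw [← sum_rowU_mul_colV, Finset.mul_sum, Finset.sum_mul]
  simp only [mul_assoc]

theorem inRange_hat (γ γ' : E) (i j : Fin 2) : InRange φ (Q.hat φ γ γ' i j).1 := by
  have h1 : ∀ t, InRange φ (φ t).1 := fun t => ⟨t, rfl⟩
  have h2 : ∀ t, InRange φ (-(φ t)).1 := fun t => ⟨-t, by rw [map_neg']⟩
  have h3 : ∀ s t, InRange φ ((2⁻¹ : ℝ) • (φ s + φ t)).1 := fun s t =>
    ⟨(2⁻¹ : ℝ) • (s + t), by rw [map_smul, map_add]⟩
  have h0 : InRange φ (0 : (Q.isIdempotentElem_epsSum L Z).Corner).1 := InRange.zero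
  revert i j
  cases ht : Q.mod (Q.tgt γ) <;> cases hs : Q.mod (Q.src γ)
  all_goals
    first | rw [Q.hat_real_real φ ht hs] | rw [Q.hat_real_ne φ ht (by rw [hs]; simp)] |
      rw [Q.hat_ne_real φ (by rw [ht]; simp) hs] | rw [Q.hat_cplx_cplx φ ht hs] |
      rw [Q.hat_cplx_quat φ ht hs] | rw [Q.hat_quat_cplx φ ht hs] | rw [Q.hat_quat_quat φ ht hs]
    rw [Fin.forall_fin_two, Fin.forall_fin_two, Fin.forall_fin_two]
    refine ⟨⟨?_, ?_⟩, ?_, ?_⟩ <;>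
      first | exact h0 | exact h1 _ | exact h2 _ | exact h3 _ _

theorem inRange_loopHat (v : V) (i j : Fin 2) : InRange φ (Q.loopHat φ v i j).1 := by
  have h1 : ∀ t, InRange φ (φ t).1 := fun t => ⟨t, rfl⟩
  have h2 : ∀ t, InRange φ (-(φ t)).1 := fun t => ⟨-t, by rw [map_neg']⟩
  have h0 : InRange φ (0 : (Q.isIdempotentElem_epsSum L Z).Corner).1 := InRange.zero
  revert i j
  by_cases h : Q.mod v = .real
  · rw [Q.loopHat_real φ h, Fin.forall_fin_two, Fin.forall_fin_two, Fin.forall_fin_two]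
    exact ⟨⟨h1 _, h0⟩, h0, h2 _⟩
  · rw [Q.loopHat_of_ne φ h, Fin.forall_fin_two, Fin.forall_fin_two, Fin.forall_fin_two]
    exact ⟨⟨h1 _, h0⟩, h0, h1 _⟩

theorem IsToCorner.inRange_mul (hφ : IsToCorner φ) (v w : V) (i j : Fin 2) :
    InRange φ (Q.colV L Z w i * Q.rowU L Z v j) := by
  have := hφ.inRange_scal 1 v w i j
  rwa [map_one, mul_one] at this

theorem colV_mul_eq_zero {v w : V} (h : w ≠ v) {x : Q.SAlg L Z} (hx : Q.idem L Z v * x = x)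
    (i : Fin 2) : Q.colV L Z w i * x = 0 := by
  rw [← colV_mul_idem, ← hx, mul_assoc, ← mul_assoc (Q.idem L Z w),
    Q.idem_mul_idem_of_ne L Z h, zero_mul, mul_zero]

theorem mul_rowU_eq_zero {v w : V} (h : w ≠ v) {x : Q.SAlg L Z} (hx : x * Q.idem L Z w = x)
    (i : Fin 2) : x * Q.rowU L Z v i = 0 := by
  rw [← idem_mul_rowU, ← hx, mul_assoc, ← mul_assoc (Q.idem L Z w),
    Q.idem_mul_idem_of_ne L Z h, zero_mul, mul_zero]

/-- All entries for all pairs of vertices are treated together, since an entry of a product involves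
entries through every intermediate vertex. For arrows and loops the entries are those of `hat` and
`loopHat`. -/
theorem IsToCorner.inRange (hL : Q.IsLabelling L) {I : TwoSidedIdeal Q.TensorAlg}
    (hI : Q.IsSpecialType L I) (hφ : IsToCorner φ) (x : Q.SAlg L Z) (v w : V) (i j : Fin 2) :
    InRange φ (Q.colV L Z w i * x * Q.rowU L Z v j) := by
  induction x using (Q.sQuiver L).clannish_induction generalizing v w i j with
  | hsc c => exact hφ.inRange_scal c v w i j
  | hide u =>
    by_cases h : w = u
    · subst h
      rw [colV_mul_idem]
      exact hφ.inRange_mul v w i j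
    · rw [colV_mul_eq_zero h (Q.idem_mul_idem L Z u), zero_mul]
      exact InRange.zero
  | harw α =>
    obtain α | u := α
    · rw [← Q.ord_of_not_mem α.2]
      by_cases hw : w = Q.tgt α.1
      · by_cases hv : Q.src α.1 = v
        · subst hw hv
          rw [← hat_val hL hφ.arr α.2 (fun h => hI.isPartner_other α.2 h)]
          exact inRange_hat _ _ _ _
        · rw [mul_assoc, mul_rowU_eq_zero hv (Q.ord_mul_idem L Z α.1), mul_zero]
          exact InRange.zero
      · rw [colV_mul_eq_zero hw (Q.idem_mul_ord L Z α.1), zero_mul]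
        exact InRange.zero
    · rw [← Q.loop_of_ne L Z u.2, ← sum_rowU_mul_loopHat hφ.vq u.2, Finset.mul_sum, Finset.sum_mul]
      refine InRange.sum fun k _ => ?_
      rw [Finset.mul_sum, Finset.sum_mul]
      refine InRange.sum fun l _ => ?_
      have := ((hφ.inRange_mul u.1 w i k).mul (inRange_loopHat u.1 k l)).mul
        (hφ.inRange_mul v u.1 l j)
      simpa only [mul_assoc] using this
  | hmul s t hs ht =>
    rw [mul_eq_sum s t, Finset.mul_sum, Finset.sum_mul]
    refine InRange.sum fun u _ => ?_
    rw [Finset.mul_sum, Finset.sum_mul]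
    refine InRange.sum fun k _ => ?_
    have := (hs u w i k).mul (ht v u k j)
    simpa only [mul_assoc] using this
  | hadd s t hs ht =>
    rw [mul_add, add_mul]
    exact (hs v w i j).add (ht v w i j)

theorem IsToCorner.surjective (hL : Q.IsLabelling L) {I : TwoSidedIdeal Q.TensorAlg}
    (hI : Q.IsSpecialType L I) (hφ : IsToCorner φ) : Function.Surjective φ := by
  intro b
  suffices h : InRange φ b.1 by
    obtain ⟨t, ht⟩ := h
    exact ⟨t, Subtype.ext ht⟩
  have key : ∀ x, InRange φ (Q.epsSum L Z * x * Q.epsSum L Z) := fun x => by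
    rw [epsSum, Finset.sum_mul, Finset.sum_mul]
    refine InRange.sum fun w _ => ?_
    rw [Finset.mul_sum]
    exact InRange.sum fun v _ => hφ.inRange hL hI x v w 0 0
  have := key b.1
  rwa [(Q.isIdempotentElem_epsSum L Z).mul_corner, (Q.isIdempotentElem_epsSum L Z).corner_mul]
    at this

end Surjective

/-- The algebra `T(Q, M)/I` is Morita equivalent to `ℂ_{σ'} Q^s / ⟨S ∪ Z'⟩`. -/
theorem isMoritaEquivalent [Finite E] (hL : Q.IsLabelling L) {I : TwoSidedIdeal Q.TensorAlg}
    (hI : Q.IsSpecialType L I) :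
    IsMoritaEquivalent ℝ (Q.QuotientAlg I) (Q.SAlg L (Q.zeroSet' L I)) := by
  obtain ⟨φ, h1, h2⟩ := Q.exists_toCorner (L := L) (Q.zeroSet' L I) hL
  have hφ : IsToCorner φ := ⟨h1, h2⟩
  obtain ⟨G, g1, g2, g3, g4⟩ := exists_toMatrix (F := TwoSidedIdeal.quotientMk ℝ I) hL hI
    fun x hx => (TwoSidedIdeal.quotientMk_eq_zero I).mpr hx
  have hG : IsToMatrix (TwoSidedIdeal.quotientMk ℝ I) G := ⟨g1, g2, g3, g4⟩
  let Φ := I.quotientLift φ fun x hx => hφ.map_eq_zero hL hI hx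
  -- The upper left entry of the matrix of `φ t` is the class of `t` modulo `I`.
  have hinj : Function.Injective Φ := by
    rw [injective_iff_map_eq_zero]
    intro x hx
    obtain ⟨t, rfl⟩ := TwoSidedIdeal.quotientMk_surjective (k := ℝ) I x
    have ht : φ t = 0 := hx
    rw [← (hG.recovers hL hI hφ t).1, ht, IsIdempotentElem.corner_val_zero, map_zero]
    rfl
  have hsurj : Function.Surjective Φ := fun b => by
    obtain ⟨t, ht⟩ := hφ.surjective hL hI b
    exact ⟨TwoSidedIdeal.quotientMk ℝ I t, ht⟩
  refine IsMoritaEquivalent.trans ℝ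
    (IsMoritaEquivalent.of_algEquiv ℝ (AlgEquiv.ofBijective Φ ⟨hinj, hsurj⟩)) ?_
  -- Fullness of `ε`: all products `rowU * ε * colV` add up to `1`, as `ε` is absorbed by `rowU`.
  refine IsIdempotentElem.isMoritaEquivalent_corner _ (K := V × Fin 2)
    (u := fun p => Q.rowU L _ p.1 p.2) (v := fun p => Q.colV L _ p.1 p.2) ?_
  rw [Fintype.sum_prod_type, ← sum_idem_eq_one]
  refine Finset.sum_congr rfl fun v _ => ?_
  rw [← sum_rowU_mul_colV]
  refine Finset.sum_congr rfl fun k _ => ?_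
  rw [Q.mul_epsSum L _ (rowU_mul_eps v k)]

end ModulatedQuiver

/-! ## The exponent at a vertex -/

namespace ModulatedQuiver

/-! ### Semilinear maps with `a b = 0` and `a s b ≠ 0`. -/

section Layers

/-- The projection to the first coordinate. -/
noncomputable def firstProj : Module.End ℝ (ℂ × ℂ) := (LinearMap.fst ℝ ℂ ℂ).prod 0

/-- The projection to the second coordinate. -/
noncomputable def secondProj : Module.End ℝ (ℂ × ℂ) := LinearMap.prod 0 (LinearMap.snd ℝ ℂ ℂ)

/-- The semilinear map `(x, y) ↦ (r ȳ, x̄)`. -/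
noncomputable def conjSwap (r : ℝ) : Module.End ℝ (ℂ × ℂ) :=
  (r • Complex.conjAe.toLinearMap ∘ₗ LinearMap.snd ℝ ℂ ℂ).prod
    (Complex.conjAe.toLinearMap ∘ₗ LinearMap.fst ℝ ℂ ℂ)

theorem secondProj_mul_firstProj : secondProj * firstProj = 0 :=
  LinearMap.ext fun x => by simp [firstProj, secondProj, Module.End.mul_apply]

/-- The swap carries the first coordinate to the second, so it separates the path `a s b` from the
vanishing path `a b`, with `b` and `a` acting as the two projections. It is antilinear with square
`r`, hence fits a special loop if `r = ±1`. -/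
theorem secondProj_mul_conjSwap_mul_firstProj (r : ℝ) :
    secondProj * conjSwap r * firstProj ≠ 0 := fun h => by
  have := LinearMap.congr_fun h (1, 0)
  simp [firstProj, secondProj, conjSwap, Module.End.mul_apply] at this

theorem conjSwap_mul_conjSwap (r : ℝ) : conjSwap r * conjSwap r = r • 1 :=
  LinearMap.ext fun x => by
    simp [conjSwap, Module.End.mul_apply, Prod.ext_iff]

theorem conjSwap_mul_lsmul (r : ℝ) (c : ℂ) :
    conjSwap r * Algebra.lsmul ℝ ℝ (ℂ × ℂ) c =
      Algebra.lsmul ℝ ℝ (ℂ × ℂ) (starRingEnd ℂ c) * conjSwap r :=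
  LinearMap.ext fun x => by
    simp [conjSwap, Module.End.mul_apply]
    ring

theorem firstProj_mul_lsmul (c : ℂ) :
    firstProj * Algebra.lsmul ℝ ℝ (ℂ × ℂ) c = Algebra.lsmul ℝ ℝ (ℂ × ℂ) c * firstProj :=
  LinearMap.ext fun x => by simp [firstProj, Module.End.mul_apply]

theorem secondProj_mul_lsmul (c : ℂ) :
    secondProj * Algebra.lsmul ℝ ℝ (ℂ × ℂ) c = Algebra.lsmul ℝ ℝ (ℂ × ℂ) c * secondProj :=
  LinearMap.ext fun x => by simp [secondProj, Module.End.mul_apply]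

end Layers

variable {V : Type u} {E : Type w} {Q : ModulatedQuiver V E} {L : Set E}

/-! ### A representation detecting the path `a s_v b`. -/

section Representation

open scoped Classical in
/-- The matrix of an arrow in a representation with three layers, between which `b` and `a` act. -/
noncomputable def layerArrow (a b α : E) : Matrix (Fin 3) (Fin 3) (Module.End ℝ (ℂ × ℂ)) :=
  !![0, 0, 0; if α = b then firstProj else 0, 0, 0; 0, if α = a then secondProj else 0, 0]

/-- Two arrows can only lead from the bottom layer to the top one, by `secondProj * firstProj = 0`;
so every path of two ordinary arrows acts as zero. -/
theorem layerArrow_mul_layerArrow (a b α β : E) : layerArrow a b α * layerArrow a b β = 0 := by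
  refine Matrix.ext fun i j => ?_
  fin_cases i <;> fin_cases j <;>
    simp [layerArrow, Matrix.mul_apply, Fin.sum_univ_three, secondProj_mul_firstProj]

/-- In `ℂ_{σ'} Q^s / ⟨S ∪ Z⟩` the path `a s_v b` is not zero unless there is a reason in `Z`. -/
theorem ord_mul_loop_mul_ord_ne_zero [Fintype V] {Z : Set (List (Q.SArrow L))} {a b : E}
    (ha : a ∉ L) (hb : b ∉ L) (hab : Q.src a = Q.tgt b) (hv : Q.mod (Q.src a) ≠ .cplx)
    (hZ : ∀ l ∈ Z, (∃ α β, l = [Sum.inl α, Sum.inl β]) ∨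
      ∃ α i β, l = [Sum.inl α, Sum.inr i, Sum.inl β] ∧ α.1 ≠ a) :
    Q.ord L Z a * Q.loop L Z (Q.src a) * Q.ord L Z b ≠ 0 := by
  classical
  -- The layers stay separate even where these vertices, or the arrows `a` and `b`, coincide.
  let layer : Fin 3 → V := ![Q.src b, Q.src a, Q.tgt a]
  let ε : V → ℝ := fun v => if Q.mod v = .real then 1 else -1
  obtain ⟨G, -, -, h3⟩ := (Q.sQuiver L).exists_lift (σ := Q.twist' L) (Z := Z)
    (f := (Matrix.diagonalAlgHom ℝ).comp
      ((Pi.constAlgHom ℝ (Fin 3) _).comp (Algebra.lsmul ℝ ℝ (ℂ × ℂ))))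
    (e := fun v => Matrix.diagonal fun i => if layer i = v then 1 else 0)
    (a := Sum.elim (fun α => layerArrow a b α.1)
      fun i => Matrix.diagonal fun j => if layer j = i.1 then conjSwap (ε i.1) else 0)
    (by simp) (by
      intro v v' h
      rw [Matrix.diagonal_mul_diagonal, ← Matrix.diagonal_zero]
      congr 1
      funext i
      by_cases hi : layer i = v
      · simp [hi, h]
      · simp [hi])
    (by
      rw [← Matrix.diagonal_one]
      refine Matrix.ext fun i j => ?_
      rw [Matrix.sum_apply]
      by_cases h : i = j
      · subst h
        simp
      · simp [h])
    (by
      rintro (α | i)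
      · refine Matrix.ext fun i j => ?_
        rw [Matrix.diagonal_mul]
        fin_cases i <;> fin_cases j <;> simp [layerArrow, layer, sQuiver] <;>
          (split_ifs <;> simp_all)
      · simp only [sQuiver, Sum.elim_inr, Matrix.diagonal_mul_diagonal]
        congr 1
        funext j
        by_cases h : layer j = i.1 <;> simp [h])
    (by
      rintro (α | i)
      · refine Matrix.ext fun i j => ?_
        rw [Matrix.mul_diagonal]
        fin_cases i <;> fin_cases j <;> simp [layerArrow, layer, sQuiver] <;>
          (intro h1 h2; simp_all)
      · simp only [sQuiver, Sum.elim_inr, Matrix.diagonal_mul_diagonal]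
        congr 1
        funext j
        by_cases h : layer j = i.1 <;> simp [h])
    (fun v c => by
      refine Matrix.ext fun i j => ?_
      by_cases h : i = j
      · subst h
        by_cases h' : layer i = v <;> simp [h']
      · simp [h])
    (by
      rintro (α | i) c
      · have hα : α.1 = a ∨ α.1 = b → Q.twist' L (Sum.inl α) c = c := by
          intro h
          refine DFunLike.congr_fun (if_neg fun hc => ?_ : Q.twist' L (Sum.inl α) = 1) c
          rcases h with h | h
          · exact hv (h ▸ hc.1)
          · exact hv (hab ▸ h ▸ hc.2.1)
        refine Matrix.ext fun i j => ?_
        simp only [AlgHom.comp_apply, Matrix.diagonalAlgHom_apply, Matrix.mul_diagonal,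
          Matrix.diagonal_mul, Sum.elim_inl]
        fin_cases i <;> fin_cases j <;> simp [layerArrow] <;>
          (split_ifs with h <;> simp [hα, h, firstProj_mul_lsmul, secondProj_mul_lsmul])
      · simp only [AlgHom.comp_apply, Matrix.diagonalAlgHom_apply, Sum.elim_inr,
          Matrix.diagonal_mul_diagonal]
        congr 1
        funext j
        by_cases h : layer j = i.1
        · simpa [h] using! conjSwap_mul_lsmul _ c
        · simp [h])
    (by
      rintro _ ⟨i, rfl, hi⟩
      simp only [sQuiver, Sum.elim_inr, Matrix.diagonal_mul_diagonal]
      congr 1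
      funext j
      by_cases h : layer j = i.1 <;> simp [h, ε, hi, conjSwap_mul_conjSwap])
    (by
      rintro _ ⟨i, rfl, hi⟩
      simp only [sQuiver, Sum.elim_inr, Matrix.diagonal_mul_diagonal]
      refine Eq.trans ?_ (Matrix.diagonal_neg _).symm
      congr 1
      funext j
      by_cases h : layer j = i.1
      · have hε : ε i.1 = -1 := by simp [ε, hi]
        simp only [h, if_true, hε, conjSwap_mul_conjSwap]
        exact neg_one_smul ℝ (1 : Module.End ℝ (ℂ × ℂ))
      · simp [h])
    (by
      intro l hl
      -- For a path with a loop, reaching the top layer would require its leftmost factor to be `a`,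
      -- which is excluded.
      obtain ⟨α, β, rfl⟩ | ⟨α, i, β, rfl, h⟩ := hZ l hl
      · simp [layerArrow_mul_layerArrow]
      · simp only [List.map_cons, List.map_nil, List.prod_cons, List.prod_nil, mul_one,
          Sum.elim_inl, Sum.elim_inr]
        refine Matrix.ext fun i j => ?_
        fin_cases i <;> fin_cases j <;>
          simp [layerArrow, h, Matrix.mul_apply, Fin.sum_univ_three, Matrix.diagonal_apply])
  intro h
  have := congrArg (fun x => G x 2 0) h
  rw [Q.ord_of_not_mem ha, Q.ord_of_not_mem hb, Q.loop_of_ne L Z hv] at this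
  simp only [map_mul, h3, map_zero] at this
  simp [layerArrow, Matrix.mul_apply, Fin.sum_univ_three, layer, Matrix.vecMul_diagonal] at this
  exact secondProj_mul_conjSwap_mul_firstProj _ this

end Representation

theorem IsSpecialType.xor_special {I : TwoSidedIdeal Q.TensorAlg}
    (hI : Q.IsSpecialType L I) {α β : E} {v : V} (hv : Q.mod v ≠ .cplx)
    (hα : Q.src α = v) (hβ : Q.tgt β = v) :
    Xor (Q.localIdeal I v = Q.special L 0 v) (Q.localIdeal I v = Q.special L 1 v) := by
  have hα' : α ∈ Q.outArrows v := hα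
  have hβ' : β ∈ Q.inArrows v := hβ
  obtain ⟨-, -, h⟩ | ⟨h, -⟩ | ⟨h, -⟩ := (hI.speciallyGentle hv).2
  · exact h
  · simp [h] at hβ'
  · simp [h] at hα'

/-- The definition of `exponent` tests the inclusion `I_v^1 ⊆ I`, whereas special gentleness
excludes only the equality `I_v = I_v^1`. If the inclusion held, the homomorphism to the corner
would kill the generators of `I_v^1` and give `a s_v b = 0`, contradicting the layered
representation. -/
theorem exponent_eq_zero [Fintype V] [Finite E] (hL : Q.IsLabelling L) {I : TwoSidedIdeal Q.TensorAlg}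
    (hI : Q.IsSpecialType L I) {a b : E} {v : V} (hv : Q.mod v ≠ .cplx)
    (ha : Q.src a = v) (hb : Q.tgt b = v) (h : Q.localIdeal I v = Q.special L 0 v) :
    Q.exponent L I v = 0 := by
  have hxor := hI.xor_special hv ha hb
  refine if_neg fun h1 => ?_
  obtain ⟨F, hF1, hF2⟩ := Q.exists_toCorner (Q.zeroSet' L I) hL
  have hF : IsToCorner F := ⟨hF1, hF2⟩
  obtain ⟨a, a', ha⟩ : ∃ a a', Q.IsOut L v a a' := ha ▸ hI.exists_isOut (ha ▸ hv)
  obtain ⟨b, b', hb⟩ : ∃ b b', Q.IsIn L v b b' := hb ▸ hI.exists_isIn (hb ▸ hv)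
  have haL := ha.1.not_mem hL
  have hbL := hb.1.not_mem hL
  obtain rfl := ha.src_eq
  have hab := hb.tgt_eq.symm
  have := (hF.map_gens_eq_zero_iff hL hab hv ha.1 hb.1 1).mp fun r hr =>
    hF.map_eq_zero hL hI (h1 (gens_subset_special hL 1 ha hb hr))
  rw [if_neg (by simp)] at this
  refine ord_mul_loop_mul_ord_ne_zero haL hbL hab hv ?_ this
  rintro _ (⟨α, β, -, -, ⟨-, rfl⟩ | ⟨hp, rfl⟩⟩ | ⟨α, β, -, -, -, rfl⟩)
  · exact Or.inl ⟨α, β, rfl⟩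
  -- A relation `a s_v β` in `Z'` would require `I_v = I_v^1`, excluded by the exclusive alternative
  -- at `v`.
  · refine Or.inr ⟨α, _, β, rfl, fun hα => ?_⟩
    rw [hα] at hp
    simp [Xor, h, hp ▸ h] at hxor
  · exact Or.inl ⟨α, β, rfl⟩

theorem exponent_eq_one {I : TwoSidedIdeal Q.TensorAlg} {v : V}
    (h : Q.localIdeal I v = Q.special L 1 v) : Q.exponent L I v = 1 :=
  if_pos (h ▸ inf_le_right)

end ModulatedQuiver

/-! ## The two choices of twists -/

namespace ModulatedQuiver

variable {V : Type u} {E : Type w} {Q : ModulatedQuiver V E} {L : Set E}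

/-! ### The ends of maximal special paths. -/

section SpecialPaths

/-- Every ordinary arrow starting at a vertex with `ℂ` but not ending at one is the last arrow of a
maximal special path. -/
theorem exists_isMaximalSpecialPath [Finite E] {α : Q.OrdArrow L} (h : Q.mod (Q.src α.1) = .cplx) :
    ∃ l, Q.IsMaximalSpecialPath L l ∧ ¬ Q.IsOrientedCycle L l ∧ l.getLast? = some α := by
  let P : ℕ → Prop := fun n => ∃ l, Q.IsSpecialPath L l ∧ l.getLast? = some α ∧ l.length = n
  have := Fintype.ofFinite (Q.OrdArrow L)
  have hbound : ∀ l, Q.IsSpecialPath L l → l.length ≤ Fintype.card (Q.OrdArrow L) :=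
    fun l hl => hl.nodup.length_le_card
  have hone : Q.IsSpecialPath L [α] := ⟨by simp, by simp, by simp⟩
  classical
  -- A longest special path with last factor `α` is taken; distinctness of the arrows bounds the
  -- length.
  obtain ⟨l, hl, hlast, hlen⟩ : P (Nat.findGreatest P (Fintype.card (Q.OrdArrow L))) :=
    Nat.findGreatest_spec (m := 1) (hbound [α] hone) ⟨[α], hone, by simp, rfl⟩
  refine ⟨l, ⟨hl, ?_⟩, ?_, hlast⟩
  · rintro l' hl' ⟨s, t, rfl⟩
    -- Nothing can follow `α`, because its source carries `ℂ`; by the choice of length nothing can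
    -- precede `l`.
    have ht : t = [] := by
      rcases t with _ | ⟨β, t⟩
      · rfl
      · exfalso
        have := List.isChain_append.mp hl'.chain
        refine (this.2.2 α ?_ β (by simp)).2 h
        simp [List.getLast?_append, hlast]
    subst ht
    rw [List.append_nil] at hl' ⊢
    have hle : (s ++ l).length ≤ l.length := by
      rw [hlen]
      exact Nat.le_findGreatest (hbound _ hl') ⟨s ++ l, hl', by simp [List.getLast?_append, hlast], rfl⟩
    have : s = [] := by
      rw [List.length_append] at hle
      exact List.length_eq_zero_iff.mp (by omega)
    rw [this, List.nil_append]
  · rintro ⟨β, -, γ, hγ, -, h'⟩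
    rw [hlast] at hγ
    obtain rfl := Option.some.inj hγ
    exact h' h

/-- No ordinary arrow ends at the source of a maximal special path which is not an oriented cycle,
if the division algebra at this source is not `ℂ`. -/
theorem IsMaximalSpecialPath.not_tgt_eq {I : TwoSidedIdeal Q.TensorAlg} (hI : Q.IsSpecialType L I)
    {l : List (Q.OrdArrow L)} (hl : Q.IsMaximalSpecialPath L l) (hc : ¬ Q.IsOrientedCycle L l)
    {α β : Q.OrdArrow L} (hα : l.getLast? = some α) (hv : Q.mod (Q.src α.1) ≠ .cplx)
    (hβ : Q.src α.1 = Q.tgt β.1) : False := by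
  -- If `β` were the first factor, `l` would be an oriented cycle. Otherwise the factor just before
  -- `β` starts where `α` does, so it is `α`, which would then be repeated at the end of `l`.
  have hnot : β ∉ l := by
    intro hmem
    obtain ⟨s, t, rfl⟩ := List.append_of_mem hmem
    rcases List.eq_nil_or_concat s with rfl | ⟨s, γ, rfl⟩
    · exact hc ⟨β, by simp, α, hα, hβ, hv⟩
    · have hch := hl.1.chain
      have hnd := hl.1.nodup
      simp only [List.concat_eq_append, List.append_assoc, List.singleton_append] at hch hnd hα
      have hγ := (List.isChain_cons_cons.mp (List.isChain_append.mp hch).2.1).1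
      obtain ⟨a, a', ha⟩ := hI.exists_isOut hv
      have hγα : γ = α := Subtype.ext ((ha.eq_of_not_mem γ.2 (hγ.1.trans hβ.symm)).trans
        (ha.eq_of_not_mem α.2 rfl).symm)
      subst hγα
      have hmem : γ ∈ β :: t := by
        rw [List.getLast?_append_of_ne_nil _ (by simp), List.getLast?_cons_cons] at hα
        exact List.mem_of_getLast? hα
      exact (List.nodup_cons.mp (List.nodup_append.mp hnd).2.1).1 hmem
  have hl' : Q.IsSpecialPath L (l ++ [β]) := by
    refine ⟨by simp, ?_, ?_⟩
    · rw [List.nodup_append]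
      exact ⟨hl.1.nodup, by simp, by rintro a ha b hb rfl; simp_all⟩
    · rw [List.isChain_append]
      refine ⟨hl.1.chain, by simp, ?_⟩
      rintro x hx y hy
      rw [hα] at hx
      obtain rfl := Option.some.inj hx
      simp at hy
      subst hy
      exact ⟨hβ, hv⟩
  have := congrArg List.length (hl.2 _ hl' ⟨[], [β], by simp⟩)
  simp at this

end SpecialPaths

end ModulatedQuiver

namespace ModulatedQuiver

variable {V : Type u} {E : Type w} {Q : ModulatedQuiver V E} {L : Set E}

/-! ### Changing twists by multiplication with special loops. -/

section Shift

/-- The sign in the relation of the special loop at a vertex. -/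
noncomputable def loopSign (Q : ModulatedQuiver V E) (v : V) : ℝ :=
  open scoped Classical in if Q.mod v = .real then 1 else -1

theorem loopSign_mul_self (v : V) : Q.loopSign v * Q.loopSign v = 1 := by
  unfold loopSign
  split_ifs <;> norm_num

variable [Fintype V]

theorem arw_inr_mul_self (τ : Q.SArrow L → (ℂ ≃ₐ[ℝ] ℂ)) (W : Set (List (Q.SArrow L)))
    (i : {i : V // Q.mod i ≠ .cplx}) :
    (Q.sQuiver L).arw τ W (.inr i) * (Q.sQuiver L).arw τ W (.inr i) =
      Q.loopSign i.1 • (Q.sQuiver L).ide τ W i.1 := by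
  unfold loopSign
  split_ifs with h
  · rw [one_smul]
    exact (Q.sQuiver L).loop_mul_self_real τ W ⟨i, rfl, h⟩
  · rw [neg_one_smul]
    refine (Q.sQuiver L).loop_mul_self_quat τ W ⟨i, rfl, ?_⟩
    have := i.2
    cases hi : Q.mod i.1 <;> simp_all

open scoped Classical in
/-- The arrows of `Q^s`, some of them multiplied by multiples of special loops. -/
noncomputable def shiftArrow (τ : Q.SArrow L → (ℂ ≃ₐ[ℝ] ℂ)) (W : Set (List (Q.SArrow L)))
    (p : Q.OrdArrow L → Prop) (r : V → ℝ) : Q.SArrow L → (Q.sQuiver L).ClannishAlg τ W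
  | .inr i => (Q.sQuiver L).arw τ W (.inr i)
  | .inl α =>
      if h : p α ∧ Q.mod (Q.src α.1) ≠ .cplx then
        r (Q.src α.1) • ((Q.sQuiver L).arw τ W (.inl α) *
          (Q.sQuiver L).arw τ W (.inr ⟨Q.src α.1, h.2⟩))
      else (Q.sQuiver L).arw τ W (.inl α)

variable {σ τ : Q.SArrow L → (ℂ ≃ₐ[ℝ] ℂ)} {Z W : Set (List (Q.SArrow L))}
  {p : Q.OrdArrow L → Prop} {r : V → ℝ}

theorem shiftArrow_of_not {α : Q.OrdArrow L} (h : ¬ p α) :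
    shiftArrow τ W p r (.inl α) = (Q.sQuiver L).arw τ W (.inl α) := dif_neg fun h' => h h'.1

theorem shiftArrow_of {α : Q.OrdArrow L} (h : p α) (h' : Q.mod (Q.src α.1) ≠ .cplx) :
    shiftArrow τ W p r (.inl α) = r (Q.src α.1) • ((Q.sQuiver L).arw τ W (.inl α) *
      (Q.sQuiver L).arw τ W (.inr ⟨Q.src α.1, h'⟩)) := dif_pos ⟨h, h'⟩

/-- The loop enters as a right factor, so shifting the rightmost arrow preserves the vanishing of a
path. -/
theorem shiftArrow_eq_mul (α : Q.OrdArrow L) : ∃ x,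
    shiftArrow τ W p r (.inl α) = (Q.sQuiver L).arw τ W (.inl α) * x := by
  by_cases h : p α ∧ Q.mod (Q.src α.1) ≠ .cplx
  · exact ⟨r (Q.src α.1) • (Q.sQuiver L).arw τ W (.inr ⟨Q.src α.1, h.2⟩), by
      rw [shiftArrow_of h.1 h.2, mul_smul_comm]⟩
  · exact ⟨1, by rw [mul_one]; exact dif_neg h⟩

/-- Twists can be changed by multiplying arrows by special loops. -/
theorem exists_shiftHom (hp : ∀ α, p α → Q.mod (Q.src α.1) ≠ .cplx)
    (hσ : ∀ i, σ (.inr i) = Complex.conjAe) (hτ : ∀ i, τ (.inr i) = Complex.conjAe)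
    (hσp : ∀ α, p α → ∀ c, σ (.inl α) c = τ (.inl α) (starRingEnd ℂ c))
    (hσn : ∀ α, ¬ p α → σ (.inl α) = τ (.inl α))
    (hZ : ∀ l ∈ Z, (l.map (shiftArrow τ W p r)).prod = 0) :
    ∃ F : (Q.sQuiver L).ClannishAlg σ Z →ₐ[ℝ] (Q.sQuiver L).ClannishAlg τ W,
      (∀ c, F ((Q.sQuiver L).sc σ Z c) = (Q.sQuiver L).sc τ W c) ∧
      (∀ v, F ((Q.sQuiver L).ide σ Z v) = (Q.sQuiver L).ide τ W v) ∧
      ∀ α, F ((Q.sQuiver L).arw σ Z α) = shiftArrow τ W p r α := by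
  refine (Q.sQuiver L).exists_lift (f := (Q.sQuiver L).sc τ W) (e := (Q.sQuiver L).ide τ W)
    (a := shiftArrow τ W p r) ((Q.sQuiver L).ide_mul_self τ W) (fun v v' h =>
    (Q.sQuiver L).ide_mul_ne τ W h) ((Q.sQuiver L).sum_ide τ W) ?_ ?_
    ((Q.sQuiver L).ide_mul_sc τ W) ?_ ?_ ?_ hZ
  · rintro (α | i)
    · obtain ⟨x, hx⟩ := shiftArrow_eq_mul (τ := τ) (W := W) (p := p) (r := r) α
      rw [hx, ← mul_assoc, (Q.sQuiver L).ide_mul_arw]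
    · exact (Q.sQuiver L).ide_mul_arw τ W _
  · rintro (α | i)
    · by_cases h : p α
      · rw [shiftArrow_of h (hp α h), smul_mul_assoc, mul_assoc]
        congr 2
        exact (Q.sQuiver L).arw_mul_ide τ W (.inr ⟨Q.src α.1, hp α h⟩)
      · rw [shiftArrow_of_not h, (Q.sQuiver L).arw_mul_ide]
    · exact (Q.sQuiver L).arw_mul_ide τ W _
  · rintro (α | i) c
    · by_cases h : p α
      · rw [shiftArrow_of h (hp α h), smul_mul_assoc, mul_assoc, (Q.sQuiver L).arw_mul_sc,
          ← mul_assoc, (Q.sQuiver L).arw_mul_sc, hτ, hσp α h, mul_smul_comm, mul_assoc]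
        rfl
      · rw [shiftArrow_of_not h, (Q.sQuiver L).arw_mul_sc, hσn α h]
    · rw [hσ, ← hτ i]
      exact (Q.sQuiver L).arw_mul_sc τ W _ c
  · rintro _ ⟨i, rfl, h⟩
    exact (Q.sQuiver L).loop_mul_self_real τ W ⟨i, rfl, h⟩
  · rintro _ ⟨i, rfl, h⟩
    exact (Q.sQuiver L).loop_mul_self_quat τ W ⟨i, rfl, h⟩

/-- Two shifts multiply `α` by `r s` and by `s_v² = ±e_v`; the condition `hrs` says that these
factors cancel. -/
theorem shiftHom_comp_eq_id {s : V → ℝ} (hrs : ∀ v, r v * s v * Q.loopSign v = 1)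
    {F : (Q.sQuiver L).ClannishAlg σ Z →ₐ[ℝ] (Q.sQuiver L).ClannishAlg τ W}
    {G : (Q.sQuiver L).ClannishAlg τ W →ₐ[ℝ] (Q.sQuiver L).ClannishAlg σ Z}
    (hFs : ∀ c, F ((Q.sQuiver L).sc σ Z c) = (Q.sQuiver L).sc τ W c)
    (hFi : ∀ v, F ((Q.sQuiver L).ide σ Z v) = (Q.sQuiver L).ide τ W v)
    (hFa : ∀ α, F ((Q.sQuiver L).arw σ Z α) = shiftArrow τ W p r α)
    (hGs : ∀ c, G ((Q.sQuiver L).sc τ W c) = (Q.sQuiver L).sc σ Z c)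
    (hGi : ∀ v, G ((Q.sQuiver L).ide τ W v) = (Q.sQuiver L).ide σ Z v)
    (hGa : ∀ α, G ((Q.sQuiver L).arw τ W α) = shiftArrow σ Z p s α) :
    G.comp F = AlgHom.id ℝ _ := by
  refine (Q.sQuiver L).hom_ext (fun c => ?_) (fun v => ?_) ?_
  · rw [AlgHom.comp_apply, hFs, hGs, AlgHom.id_apply]
  · rw [AlgHom.comp_apply, hFi, hGi, AlgHom.id_apply]
  · rintro (α | i)
    · rw [AlgHom.comp_apply, hFa, AlgHom.id_apply]
      by_cases h : p α ∧ Q.mod (Q.src α.1) ≠ .cplx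
      · rw [shiftArrow_of h.1 h.2, map_smul, map_mul, hGa, hGa, shiftArrow_of h.1 h.2]
        change r _ • (s _ • (_ * _) * (Q.sQuiver L).arw σ Z (.inr _)) = _
        rw [smul_mul_assoc, mul_assoc, arw_inr_mul_self, mul_smul_comm, smul_smul, smul_smul,
          hrs, one_smul]
        exact (Q.sQuiver L).arw_mul_ide σ Z (.inl α)
      · have h1 : shiftArrow τ W p r (.inl α) = (Q.sQuiver L).arw τ W (.inl α) := dif_neg h
        have h2 : shiftArrow σ Z p s (.inl α) = (Q.sQuiver L).arw σ Z (.inl α) := dif_neg h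
        rw [h1, hGa, h2]
    · rw [AlgHom.comp_apply, hFa, AlgHom.id_apply]
      exact hGa _

theorem prod_shiftArrow_eq_zero_of_not {α β : Q.OrdArrow L} (h : ¬ p α)
    (hW : [Sum.inl α, Sum.inl β] ∈ W) :
    ([Sum.inl α, Sum.inl β].map (shiftArrow τ W p r)).prod = 0 := by
  have h0 := (Q.sQuiver L).prod_arw_eq_zero τ W hW
  obtain ⟨x, hx⟩ := shiftArrow_eq_mul (τ := τ) (W := W) (p := p) (r := r) β
  simp only [List.map_cons, List.map_nil, List.prod_cons, List.prod_nil, mul_one] at h0 ⊢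
  rw [shiftArrow_of_not h, hx, ← mul_assoc, h0, zero_mul]

theorem prod_shiftArrow_eq_zero_of {α β : Q.OrdArrow L} (h : p α)
    (hv : Q.mod (Q.src α.1) ≠ .cplx)
    (hW : [Sum.inl α, Sum.inr ⟨Q.src α.1, hv⟩, Sum.inl β] ∈ W) :
    ([Sum.inl α, Sum.inl β].map (shiftArrow τ W p r)).prod = 0 := by
  have h0 := (Q.sQuiver L).prod_arw_eq_zero τ W hW
  obtain ⟨x, hx⟩ := shiftArrow_eq_mul (τ := τ) (W := W) (p := p) (r := r) β
  simp only [List.map_cons, List.map_nil, List.prod_cons, List.prod_nil, mul_one] at h0 ⊢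
  rw [← mul_assoc] at h0
  rw [shiftArrow_of h hv, hx, smul_mul_assoc, ← mul_assoc, h0, zero_mul, smul_zero]

/-- The shifted path contains `α s_v s_v`, a real multiple of `α`, so it reduces to `α β`. -/
theorem prod_shiftArrow_loop_eq_zero_of {α β : Q.OrdArrow L} (h : p α)
    (hv : Q.mod (Q.src α.1) ≠ .cplx) (hW : [Sum.inl α, Sum.inl β] ∈ W) :
    ([Sum.inl α, Sum.inr ⟨Q.src α.1, hv⟩, Sum.inl β].map (shiftArrow τ W p r)).prod = 0 := by
  have h0 := (Q.sQuiver L).prod_arw_eq_zero τ W hW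
  obtain ⟨x, hx⟩ := shiftArrow_eq_mul (τ := τ) (W := W) (p := p) (r := r) β
  have h1 : shiftArrow τ W p r (.inr ⟨Q.src α.1, hv⟩) = (Q.sQuiver L).arw τ W (.inr ⟨_, hv⟩) := rfl
  have h2 : (Q.sQuiver L).arw τ W (.inl α) * (Q.sQuiver L).ide τ W (Q.src α.1) = _ :=
    (Q.sQuiver L).arw_mul_ide τ W (.inl α)
  have h3 := arw_inr_mul_self τ W ⟨Q.src α.1, hv⟩
  simp only [List.map_cons, List.map_nil, List.prod_cons, List.prod_nil, mul_one] at h0 ⊢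
  rw [shiftArrow_of h hv, h1, ← mul_assoc, smul_mul_assoc, mul_assoc, h3, mul_smul_comm, h2,
    hx, smul_mul_assoc, smul_mul_assoc, ← mul_assoc, h0, zero_mul, smul_zero, smul_zero]

end Shift

/-- The twists `σ` and `σ'` differ at `α`. -/
def IsShifted (Q : ModulatedQuiver V E) (L : Set E) (I : TwoSidedIdeal Q.TensorAlg)
    (α : Q.OrdArrow L) : Prop :=
  ¬ (Q.mod (Q.src α.1) = .cplx ∧ Q.mod (Q.tgt α.1) = .cplx) ∧
    (¬ ∃ l, Q.IsMaximalSpecialPath L l ∧ ¬ Q.IsOrientedCycle L l ∧ l.getLast? = some α) ∧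
    Q.exponent L I (Q.src α.1) = 1

variable {I : TwoSidedIdeal Q.TensorAlg}

theorem exponent_le_one (v : V) : Q.exponent L I v ≤ 1 := by
  unfold exponent
  split_ifs <;> simp

/-- An arrow starting at `ℂ` is the last factor of a maximal special path that is not a cycle, so it
is never shifted; a shifted arrow has a loop at its source. -/
theorem IsShifted.mod_ne [Finite E] {α : Q.OrdArrow L} (h : Q.IsShifted L I α) :
    Q.mod (Q.src α.1) ≠ .cplx := fun h' => h.2.1 (exists_isMaximalSpecialPath h')

theorem IsShifted.twist_eq {α : Q.OrdArrow L} (h : Q.IsShifted L I α) (c : ℂ) :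
    Q.twist L I (.inl α) c = Q.twist' L (.inl α) (starRingEnd ℂ c) := by
  have h1 : Q.twist' L (.inl α) = 1 := if_neg fun h' => h.1 ⟨h'.1, h'.2.1⟩
  have h2 : Q.twist L I (.inl α) = Complex.conjAe ^ Q.exponent L I (Q.src α.1) :=
    (if_neg h.1).trans (if_neg h.2.1)
  rw [h1, h2, h.2.2, pow_one]
  rfl

theorem twist_eq_of_not_isShifted {α : Q.OrdArrow L} (h : ¬ Q.IsShifted L I α) :
    Q.twist L I (.inl α) = Q.twist' L (.inl α) := by
  by_cases h1 : Q.mod (Q.src α.1) = .cplx ∧ Q.mod (Q.tgt α.1) = .cplx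
  · refine (if_pos h1).trans ?_
    by_cases h2 : Q.bar α.1
    · exact (if_pos h2).trans (if_pos ⟨h1.1, h1.2, h2⟩).symm
    · exact (if_neg h2).trans (if_neg fun h' => h2 h'.2.2).symm
  · refine (if_neg h1).trans (Eq.trans ?_ (if_neg fun h' => h1 ⟨h'.1, h'.2.1⟩).symm)
    split_ifs with h2
    · rfl
    · have := Q.exponent_le_one (L := L) (I := I) (Q.src α.1)
      have h3 : Q.exponent L I (Q.src α.1) ≠ 1 := fun h3 => h ⟨h1, h2, h3⟩
      rw [show Q.exponent L I (Q.src α.1) = 0 by omega, pow_zero]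

/-- Where an ordinary arrow is followed by `α`, the twist of `α` is given by the exponent. -/
theorem isShifted_iff [Fintype V] [Finite E] (hL : Q.IsLabelling L) (hI : Q.IsSpecialType L I)
    {α β : Q.OrdArrow L} (hv : Q.mod (Q.src α.1) ≠ .cplx) (hβ : Q.src α.1 = Q.tgt β.1) :
    Q.IsShifted L I α ↔ Q.localIdeal I (Q.src α.1) = Q.special L 1 (Q.src α.1) := by
  constructor
  · rintro ⟨-, -, h⟩
    rcases hI.xor_special hv rfl hβ.symm with h' | h'
    · rw [exponent_eq_zero hL hI hv rfl hβ.symm h'.1] at h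
      exact absurd h zero_ne_one
    · exact h'.1
  · intro h
    exact ⟨fun h' => hv h'.1, fun ⟨l, hl, hc, hα⟩ => hl.not_tgt_eq hI hc hα hv hβ,
      exponent_eq_one h⟩

variable [Fintype V] [Finite E]

theorem prod_shiftArrow_eq_zero_of_mem_zeroC {τ : Q.SArrow L → (ℂ ≃ₐ[ℝ] ℂ)}
    {W : Set (List (Q.SArrow L))} {r : V → ℝ} (hW : Q.zeroC L I ⊆ W) {l : List (Q.SArrow L)}
    (hl : l ∈ Q.zeroC L I) : (l.map (shiftArrow τ W (Q.IsShifted L I) r)).prod = 0 := by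
  have hl' := hW hl
  obtain ⟨α, β, -, hv, -, rfl⟩ := hl
  exact prod_shiftArrow_eq_zero_of_not (fun h => h.mod_ne hv) hl'

theorem prod_shiftArrow_eq_zero_of_mem_zeroSet' (hL : Q.IsLabelling L) (hI : Q.IsSpecialType L I)
    {r : V → ℝ} {l : List (Q.SArrow L)} (hl : l ∈ Q.zeroSet' L I) :
    (l.map (shiftArrow (Q.twist L I) (Q.zeroSet L I) (Q.IsShifted L I) r)).prod = 0 := by
  rcases hl with ⟨α, β, hαβ, hv, ⟨h, rfl⟩ | ⟨h, rfl⟩⟩ | hl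
  · refine prod_shiftArrow_eq_zero_of_not ?_ (Or.inl ⟨α, β, hαβ, hv, rfl⟩)
    rw [isShifted_iff hL hI hv hαβ]
    exact fun h' => (hI.xor_special hv rfl hαβ.symm).elim (fun h1 => h1.2 h') fun h1 => h1.2 h
  · exact prod_shiftArrow_loop_eq_zero_of ((isShifted_iff hL hI hv hαβ).mpr h) hv
      (Or.inl ⟨α, β, hαβ, hv, rfl⟩)
  · exact prod_shiftArrow_eq_zero_of_mem_zeroC Set.subset_union_right hl

theorem prod_shiftArrow_eq_zero_of_mem_zeroSet (hL : Q.IsLabelling L) (hI : Q.IsSpecialType L I)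
    {r : V → ℝ} {l : List (Q.SArrow L)} (hl : l ∈ Q.zeroSet L I) :
    (l.map (shiftArrow (Q.twist' L) (Q.zeroSet' L I) (Q.IsShifted L I) r)).prod = 0 := by
  rcases hl with ⟨α, β, hαβ, hv, rfl⟩ | hl
  · by_cases h : Q.IsShifted L I α
    · exact prod_shiftArrow_eq_zero_of h hv
        (Or.inl ⟨α, β, hαβ, hv, Or.inr ⟨(isShifted_iff hL hI hv hαβ).mp h, rfl⟩⟩)
    · refine prod_shiftArrow_eq_zero_of_not h (Or.inl ⟨α, β, hαβ, hv, Or.inl ⟨?_, rfl⟩⟩)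
      rw [isShifted_iff hL hI hv hαβ] at h
      exact (hI.xor_special hv rfl hαβ.symm).elim (fun h1 => h1.1) fun h1 => absurd h1.1 h
  · exact prod_shiftArrow_eq_zero_of_mem_zeroC Set.subset_union_right hl

/-- The two presentations of the semilinear clannish algebra are isomorphic over `ℂ`. -/
theorem exists_clannishAlgEquiv (hL : Q.IsLabelling L) (hI : Q.IsSpecialType L I) :
    ∃ e : (Q.sQuiver L).ClannishAlg (Q.twist' L) (Q.zeroSet' L I) ≃ₐ[ℝ]
        (Q.sQuiver L).ClannishAlg (Q.twist L I) (Q.zeroSet L I),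
      ∀ c : ℂ, e ((Q.sQuiver L).scalarMap (Q.twist' L) (Q.zeroSet' L I) c) =
        (Q.sQuiver L).scalarMap (Q.twist L I) (Q.zeroSet L I) c := by
  obtain ⟨F, hFs, hFi, hFa⟩ := exists_shiftHom (σ := Q.twist' L) (Z := Q.zeroSet' L I)
    (τ := Q.twist L I) (W := Q.zeroSet L I) (p := Q.IsShifted L I) (r := 1)
    (fun α h => h.mod_ne) (fun _ => rfl) (fun _ => rfl) (fun α h c => by
      rw [h.twist_eq, Complex.conj_conj]) (fun α h => (twist_eq_of_not_isShifted h).symm)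
    fun l hl => prod_shiftArrow_eq_zero_of_mem_zeroSet' hL hI hl
  -- The inverse shift carries the sign of `s_v²`, while the first one has factor `1`.
  obtain ⟨G, hGs, hGi, hGa⟩ := exists_shiftHom (σ := Q.twist L I) (Z := Q.zeroSet L I)
    (τ := Q.twist' L) (W := Q.zeroSet' L I) (p := Q.IsShifted L I) (r := Q.loopSign)
    (fun α h => h.mod_ne) (fun _ => rfl) (fun _ => rfl) (fun α h c => h.twist_eq c)
    (fun α h => twist_eq_of_not_isShifted h)
    fun l hl => prod_shiftArrow_eq_zero_of_mem_zeroSet hL hI hl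
  refine ⟨AlgEquiv.ofAlgHom F G ?_ ?_, fun c => hFs c⟩
  · exact shiftHom_comp_eq_id (fun v => by simp [loopSign_mul_self]) hGs hGi hGa hFs hFi hFa
  · exact shiftHom_comp_eq_id (fun v => by simp [loopSign_mul_self]) hFs hFi hFa hGs hGi hGa

end ModulatedQuiver

/-! ## The semilinear clannish algebra is of gentle type -/

namespace ModulatedQuiver

variable {V : Type u} {E : Type w} {Q : ModulatedQuiver V E} {L : Set E}
  {I : TwoSidedIdeal Q.TensorAlg}

theorem mem_specialLoops {x : Q.SArrow L} :
    x ∈ (Q.sQuiver L).specialLoops ↔ ∃ i, x = Sum.inr i := by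
  constructor
  · rintro (⟨i, h, -⟩ | ⟨i, h, -⟩) <;> exact ⟨i, h⟩
  · rintro ⟨i, rfl⟩
    have := i.2
    cases hi : Q.mod i.1 with
    | real => exact Or.inl ⟨i, rfl, hi⟩
    | cplx => exact absurd hi this
    | quat => exact Or.inr ⟨i, rfl, hi⟩

theorem exists_of_mem_zeroSet {l : List (Q.SArrow L)} (hl : l ∈ Q.zeroSet L I) :
    ∃ α β : Q.OrdArrow L, Q.src α.1 = Q.tgt β.1 ∧ l = [Sum.inl α, Sum.inl β] := by
  obtain ⟨α, β, h, -, rfl⟩ | ⟨α, β, h, -, -, rfl⟩ := hl <;> exact ⟨α, β, h, rfl⟩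

/-- At a vertex with `ℂ`, containment in `I_v` amounts to containment in `I`, as `M(αβ)` is one of
the summands over the paths through `v`. -/
theorem inl_inl_mem_zeroSet {α β : Q.OrdArrow L} (h : Q.src α.1 = Q.tgt β.1) :
    [Sum.inl α, Sum.inl β] ∈ Q.zeroSet L I ↔
      Q.mod (Q.src α.1) ≠ .cplx ∨ Q.pathSpace α.1 β.1 ≤ idealSpace I := by
  constructor
  · rintro (⟨α', β', -, hv, h'⟩ | ⟨α', β', -, -, hle, h'⟩)
    · simp only [List.cons.injEq, Sum.inl.injEq, and_true] at h'
      rw [h'.1]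
      exact Or.inl hv
    · simp only [List.cons.injEq, Sum.inl.injEq, and_true] at h'
      rw [h'.1, h'.2]
      exact Or.inr (hle.trans inf_le_right)
  · intro h'
    by_cases hv : Q.mod (Q.src α.1) = .cplx
    · refine Or.inr ⟨α, β, h, hv, le_inf ?_ (h'.resolve_left (not_not.mpr hv)), rfl⟩
      exact le_iSup₂_of_le α.1 rfl (le_iSup₂_of_le β.1 h.symm le_rfl)
    · exact Or.inl ⟨α, β, h, hv, rfl⟩

theorem IsSpecialType.eq_of_src_eq (hI : Q.IsSpecialType L I) {α β : Q.OrdArrow L}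
    (hv : Q.mod (Q.src α.1) ≠ .cplx) (h : Q.src β.1 = Q.src α.1) : β = α := by
  obtain ⟨a, a', ha⟩ := hI.exists_isOut hv
  exact Subtype.ext ((ha.eq_of_not_mem β.2 h).trans (ha.eq_of_not_mem α.2 rfl).symm)

theorem IsSpecialType.eq_of_tgt_eq (hI : Q.IsSpecialType L I) {α β : Q.OrdArrow L}
    (hv : Q.mod (Q.tgt α.1) ≠ .cplx) (h : Q.tgt β.1 = Q.tgt α.1) : β = α := by
  obtain ⟨a, a', ha⟩ := hI.exists_isIn hv
  exact Subtype.ext ((ha.eq_of_not_mem β.2 h).trans (ha.eq_of_not_mem α.2 rfl).symm)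

theorem IsSpecialType.encard_out_le (hI : Q.IsSpecialType L I) (v : V) :
    {x | (Q.sQuiver L).src x = v}.encard ≤ 2 := by
  by_cases hv : Q.mod v = .cplx
  · have hsub : {x | (Q.sQuiver L).src x = v} ⊆ Sum.inl '' {α : Q.OrdArrow L | Q.src α.1 = v} := by
      rintro (α | i) h
      · exact ⟨α, h, rfl⟩
      · exact absurd ((congrArg Q.mod h).trans hv) i.2
    refine (Set.encard_le_encard hsub).trans ((Set.encard_image_le _ _).trans ?_)
    rw [← Subtype.val_injective.encard_image]
    refine (Set.encard_le_encard ?_).trans (hI.ordinarilyGentle hv).out_le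
    rintro _ ⟨α, h, rfl⟩
    exact h
  · have hsub : ∃ y, {x | (Q.sQuiver L).src x = v} ⊆ {y, Sum.inr ⟨v, hv⟩} := by
      by_cases hex : ∃ α : Q.OrdArrow L, Q.src α.1 = v
      · obtain ⟨α, rfl⟩ := hex
        refine ⟨.inl α, ?_⟩
        rintro (β | i) h
        · exact Or.inl (congrArg _ (hI.eq_of_src_eq hv h))
        · exact Or.inr (congrArg _ (Subtype.ext h))
      · refine ⟨Sum.inr ⟨v, hv⟩, ?_⟩
        rintro (β | i) h
        · exact absurd ⟨β, h⟩ hex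
        · exact Or.inr (congrArg _ (Subtype.ext h))
    obtain ⟨y, hy⟩ := hsub
    exact (Set.encard_le_encard hy).trans (Set.encard_insert_le _ _ |>.trans (by simp [one_add_one_eq_two]))

theorem IsSpecialType.encard_in_le (hI : Q.IsSpecialType L I) (v : V) :
    {x | (Q.sQuiver L).tgt x = v}.encard ≤ 2 := by
  by_cases hv : Q.mod v = .cplx
  · have hsub : {x | (Q.sQuiver L).tgt x = v} ⊆ Sum.inl '' {α : Q.OrdArrow L | Q.tgt α.1 = v} := by
      rintro (α | i) h
      · exact ⟨α, h, rfl⟩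
      · exact absurd ((congrArg Q.mod h).trans hv) i.2
    refine (Set.encard_le_encard hsub).trans ((Set.encard_image_le _ _).trans ?_)
    rw [← Subtype.val_injective.encard_image]
    refine (Set.encard_le_encard ?_).trans (hI.ordinarilyGentle hv).in_le
    rintro _ ⟨α, h, rfl⟩
    exact h
  · have hsub : ∃ y, {x | (Q.sQuiver L).tgt x = v} ⊆ {y, Sum.inr ⟨v, hv⟩} := by
      by_cases hex : ∃ α : Q.OrdArrow L, Q.tgt α.1 = v
      · obtain ⟨α, rfl⟩ := hex
        refine ⟨.inl α, ?_⟩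
        rintro (β | i) h
        · exact Or.inl (congrArg _ (hI.eq_of_tgt_eq hv h))
        · exact Or.inr (congrArg _ (Subtype.ext h))
      · refine ⟨Sum.inr ⟨v, hv⟩, ?_⟩
        rintro (β | i) h
        · exact absurd ⟨β, h⟩ hex
        · exact Or.inr (congrArg _ (Subtype.ext h))
    obtain ⟨y, hy⟩ := hsub
    exact (Set.encard_le_encard hy).trans (Set.encard_insert_le _ _ |>.trans (by simp [one_add_one_eq_two]))

theorem not_mem_zeroSet_inr_right {x : Q.SArrow L} {i} : [x, Sum.inr i] ∉ Q.zeroSet L I := fun h => by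
  obtain ⟨α, β, -, h⟩ := exists_of_mem_zeroSet h
  simp at h

theorem not_mem_zeroSet_inr_left {x : Q.SArrow L} {i} : [Sum.inr i, x] ∉ Q.zeroSet L I := fun h => by
  obtain ⟨α, β, -, h⟩ := exists_of_mem_zeroSet h
  simp at h

/-- At a vertex without `ℂ` there are at most one incoming and one outgoing ordinary arrow, besides
the loop. Their composite lies in `Z` and composites with the loop do not, which gives all four
bounds of (G2). At a vertex with `ℂ` there is no loop, and the bounds are the exclusive alternatives
of ordinary gentleness. -/
theorem isClannishGentle [Fintype V] (hI : Q.IsSpecialType L I) :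
    (Q.sQuiver L).IsClannishGentle (Q.twist L I) (Q.zeroSet L I) where
  loop s hs := by
    obtain ⟨i, rfl⟩ := mem_specialLoops.mp hs
    rfl
  twist s hs := by
    obtain ⟨i, rfl⟩ := mem_specialLoops.mp hs
    rfl
  disjoint := by
    rw [Set.disjoint_left]
    rintro _ ⟨i, rfl, hi⟩ ⟨j, h, hj⟩
    rw [← Sum.inr_injective h, hi] at hj
    cases hj
  unique s hs s' hs' h := by
    obtain ⟨i, rfl⟩ := mem_specialLoops.mp hs
    obtain ⟨j, rfl⟩ := mem_specialLoops.mp hs'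
    exact congrArg _ (Subtype.ext h)
  path l hl := by
    obtain ⟨α, β, h, rfl⟩ := exists_of_mem_zeroSet hl
    exact List.isChain_pair.mpr h
  two_le l hl := by
    obtain ⟨α, β, h, rfl⟩ := exists_of_mem_zeroSet hl
    simp
  head l hl s hs := by
    obtain ⟨i, rfl⟩ := mem_specialLoops.mp hs
    obtain ⟨α, β, h, rfl⟩ := exists_of_mem_zeroSet hl
    simp
  square l hl s hs h' := by
    obtain ⟨i, rfl⟩ := mem_specialLoops.mp hs
    obtain ⟨α, β, h, rfl⟩ := exists_of_mem_zeroSet hl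
    simpa using h'.subset (List.mem_cons_self)
  out_le := hI.encard_out_le
  in_le := hI.encard_in_le
  right_not_mem := by
    rintro (α | i) hα
    · by_cases hv : Q.mod (Q.src α.1) = .cplx
      · rintro (β | i) ⟨hβ, hβZ⟩ (γ | j) ⟨hγ, hγZ⟩
        · by_contra hne
          rw [inl_inl_mem_zeroSet hβ, not_or] at hβZ
          rw [inl_inl_mem_zeroSet hγ, not_or] at hγZ
          exact ((hI.ordinarilyGentle hv).xor_in α.1 rfl β.1 hβ.symm γ.1 hγ.symm
            fun h => hne (congrArg _ (Subtype.ext h))).elim (fun h => hβZ.2 h.1) fun h => hγZ.2 h.1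
        · exact absurd ((congrArg Q.mod hγ.symm).trans hv) j.2
        · exact absurd ((congrArg Q.mod hβ.symm).trans hv) i.2
        · exact absurd ((congrArg Q.mod hβ.symm).trans hv) i.2
      · rintro (β | i) ⟨hβ, hβZ⟩ (γ | j) ⟨hγ, hγZ⟩
        · exact absurd ((inl_inl_mem_zeroSet hβ).mpr (Or.inl hv)) hβZ
        · exact absurd ((inl_inl_mem_zeroSet hβ).mpr (Or.inl hv)) hβZ
        · exact absurd ((inl_inl_mem_zeroSet hγ).mpr (Or.inl hv)) hγZ
        · exact congrArg _ (Subtype.ext (hβ.symm.trans hγ))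
    · exact absurd (mem_specialLoops.mpr ⟨i, rfl⟩) hα
  left_not_mem := by
    rintro (α | i) hα
    · by_cases hv : Q.mod (Q.tgt α.1) = .cplx
      · rintro (β | i) ⟨hβ, hβZ⟩ (γ | j) ⟨hγ, hγZ⟩
        · by_contra hne
          rw [inl_inl_mem_zeroSet hβ, not_or] at hβZ
          rw [inl_inl_mem_zeroSet hγ, not_or] at hγZ
          exact ((hI.ordinarilyGentle hv).xor_out α.1 rfl β.1 hβ γ.1 hγ
            fun h => hne (congrArg _ (Subtype.ext h))).elim (fun h => hβZ.2 h.1) fun h => hγZ.2 h.1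
        · exact absurd ((congrArg Q.mod hγ).trans hv) j.2
        · exact absurd ((congrArg Q.mod hβ).trans hv) i.2
        · exact absurd ((congrArg Q.mod hβ).trans hv) i.2
      · rintro (β | i) ⟨hβ, hβZ⟩ (γ | j) ⟨hγ, hγZ⟩
        · exact absurd ((inl_inl_mem_zeroSet hβ).mpr (Or.inl (ne_of_eq_of_ne (congrArg _ hβ) hv))) hβZ
        · exact absurd ((inl_inl_mem_zeroSet hβ).mpr (Or.inl (ne_of_eq_of_ne (congrArg _ hβ) hv))) hβZ
        · exact absurd ((inl_inl_mem_zeroSet hγ).mpr (Or.inl (ne_of_eq_of_ne (congrArg _ hγ) hv))) hγZ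
        · exact congrArg _ (Subtype.ext (hβ.trans hγ.symm))
    · exact absurd (mem_specialLoops.mpr ⟨i, rfl⟩) hα
  right_mem := by
    rintro (α | i) hα
    · rintro (β | i) ⟨hβ, hβZ⟩ (γ | j) ⟨hγ, hγZ⟩
      · by_cases hv : Q.mod (Q.src α.1) = .cplx
        · by_contra hne
          rw [inl_inl_mem_zeroSet hβ] at hβZ
          rw [inl_inl_mem_zeroSet hγ] at hγZ
          exact ((hI.ordinarilyGentle hv).xor_in α.1 rfl β.1 hβ.symm γ.1 hγ.symm
            fun h => hne (congrArg _ (Subtype.ext h))).elim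
            (fun h => h.2 (hγZ.resolve_left (not_not.mpr hv)))
            fun h => h.2 (hβZ.resolve_left (not_not.mpr hv))
        · exact congrArg _ (hI.eq_of_tgt_eq (ne_of_eq_of_ne (congrArg _ hγ.symm) hv)
            (hβ.symm.trans hγ))
      · exact absurd hγZ not_mem_zeroSet_inr_right
      · exact absurd hβZ not_mem_zeroSet_inr_right
      · exact absurd hβZ not_mem_zeroSet_inr_right
    · exact absurd (mem_specialLoops.mpr ⟨i, rfl⟩) hα
  left_mem := by
    rintro (α | i) hα
    · rintro (β | i) ⟨hβ, hβZ⟩ (γ | j) ⟨hγ, hγZ⟩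
      · by_cases hv : Q.mod (Q.tgt α.1) = .cplx
        · by_contra hne
          rw [inl_inl_mem_zeroSet hβ] at hβZ
          rw [inl_inl_mem_zeroSet hγ] at hγZ
          have hvβ : Q.mod (Q.src β.1) = .cplx := (congrArg _ hβ).trans hv
          have hvγ : Q.mod (Q.src γ.1) = .cplx := (congrArg _ hγ).trans hv
          exact ((hI.ordinarilyGentle hv).xor_out α.1 rfl β.1 hβ γ.1 hγ
            fun h => hne (congrArg _ (Subtype.ext h))).elim
            (fun h => h.2 (hγZ.resolve_left (not_not.mpr hvγ)))
            fun h => h.2 (hβZ.resolve_left (not_not.mpr hvβ))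
        · exact congrArg _ (hI.eq_of_src_eq (ne_of_eq_of_ne (congrArg _ hγ) hv)
            (hβ.trans hγ.symm))
      · exact absurd hγZ not_mem_zeroSet_inr_left
      · exact absurd hβZ not_mem_zeroSet_inr_left
      · exact absurd hβZ not_mem_zeroSet_inr_left
    · exact absurd (mem_specialLoops.mpr ⟨i, rfl⟩) hα
  length_eq l hl := by
    obtain ⟨α, β, h, rfl⟩ := exists_of_mem_zeroSet hl
    rfl

end ModulatedQuiver

theorem mainTheorem4 {V : Type u} {E : Type w} [Fintype V] [Finite E]
    (Q : ModulatedQuiver V E) (L : Set E) (hL : Q.IsLabelling L)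
    (I : TwoSidedIdeal Q.TensorAlg) (hI : Q.IsSpecialType L I) :
    IsMoritaEquivalent ℝ (Q.QuotientAlg I)
        ((Q.sQuiver L).ClannishAlg (Q.twist' L) (Q.zeroSet' L I)) ∧
      (∃ e : (Q.sQuiver L).ClannishAlg (Q.twist' L) (Q.zeroSet' L I) ≃ₐ[ℝ]
          (Q.sQuiver L).ClannishAlg (Q.twist L I) (Q.zeroSet L I),
        ∀ c : ℂ, e ((Q.sQuiver L).scalarMap (Q.twist' L) (Q.zeroSet' L I) c) =
          (Q.sQuiver L).scalarMap (Q.twist L I) (Q.zeroSet L I) c) ∧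
      (Q.sQuiver L).IsClannishGentle (Q.twist L I) (Q.zeroSet L I) := by
  exact ⟨ModulatedQuiver.isMoritaEquivalent hL hI, ModulatedQuiver.exists_clannishAlgEquiv hL hI,
    ModulatedQuiver.isClannishGentle hI⟩
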